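/- Let $d_v,d_c\ge 1$ and $\ell\ge 0$ be integers, and fix one of the three verification-based decoders Genie, LM, SBB described below. **Model.** Let $G$ be uniformly distributed on the set (assumed non-empty) of simple bipartite graphs with $n$ labelled variable nodes of degree $d_v$ and $m$ labelled check nodes of degree $d_c$. Independently, let the edge weights $w_{cv}$ be i.i.d. from a probability distribution $f$ on $\mathbb R\setminus\{0\}$, and let the signal elements $x_v$ be i.i.d., equal to $0$ with probability $1-\alpha$ and distributed according to a probability distribution $g$ on $\mathbb R\setminus\{0\}$ with probability $\alpha\in[0,1]$. The measurement at a check node $c$ is $\sum_{v\sim c}w_{cv}x_v$. **Decoders.** At each time a variable node is unverified or verified with some value, and verified nodes never change. In a round, each check node $c$ sends to every neighbour $v$ the pair $(d,\xi/w_{cv})$, where $d$ is the number of unverified neighbours of $c$ and $\xi$ is the measurement at $c$ minus $\sum w_{cv'}\hat x_{v'}$ over its verified neighbours $v'$ with verified values $\hat x_{v'}$; then the unverified variable nodes are updated simultaneously by the rules in force: * D1CN: $v$ is verified with the value $\xi$ of a received message of the form $(1,\xi)$; * ECN: $v$ is verified with the common value of at least two received messages with equal second coordinates; * ZCN: $v$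 is verified with the value $0$ if some received message has second coordinate $0$. If D1CN and ECN allow several messages to be used, one of these messages is chosen uniformly at random, independently of everything else. In Genie the zero-valued variable nodes are verified (with value $0$) from the start, iteration $0$ verifies nothing more, and every iteration $\ge1$ is one round with D1CN. In LM and SBB all variable nodes are unverified at the start, iteration $0$ is one round with ZCN, and every iteration $\ge 1$ consists of one round with D1CN (LM), respectively with D1CN and ECN (SBB), followed by one round with ZCN. Let $\beta^{(\ell)}=\frac1n\#\{v: x_v\ne0,\ v\text{ unverified at the beginning of iteration }\ell\}$. Let $\alpha^{(\ell)}$ be the probability that the root is nonzero and unverified at the beginning of iteration $\ell$ when the same decoder is run, with weights and signal of the same laws, on the infinite tree rooted at a variable node in which variable nodes have degree $d_v$ and check nodes degree $d_c$ (the cycle-free case). **Theorem.** There exist constants $\mu,\gamma>0$ depending only on $d_v$, $d_c$, $\ell$ and the decoder (not on $n,m,f,g,\alpha$) such that (i) for every $\epsilon>0$, $\displaystyle \Pr\left[\left|\beta^{(\ell)}-\mathbf E[\beta^{(\ell)}]\right|>\epsilon/2\right]\le 2e^{-\epsilon^2n/\mu}$; (ii) for every $\epsilon>0$ and $n>2\gamma/\epsilon$,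 $\displaystyle\left|\mathbf E[\beta^{(\ell)}]-\alpha^{(\ell)}\right|<\epsilon/2$. -/

import Mathlib

open MeasureTheory ProbabilityTheory

noncomputable section

namespace VB

/-! ## Bipartite graphs

`V` is the type of variable nodes, `C` the type of check nodes. Graphs are simple (the edges form
a set of pairs) and locally finite. -/

/-- A locally finite bigraph, given by the neighbourhoods of its nodes. -/
structure Bigraph (V C : Type) where
  /-- the check nodes adjacent to a variable node -/
  checksOf : V → Finset C
  /-- the variable nodes adjacent to a check node -/
  varsOf : C → Finset V
  mem_iff : ∀ v c, c ∈ checksOf v ↔ v ∈ varsOf c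

/-- Every variable node has degree `dv` and every check node has degree `dc`. -/
def Bigraph.IsBiregular {V C : Type} (G : Bigraph V C) (dv dc : ℕ) : Prop :=
  (∀ v, (G.checksOf v).card = dv) ∧ ∀ c, (G.varsOf c).card = dc

/-- The bigraph with biadjacency matrix `A` (rows: check nodes, columns: variable nodes). -/
def ofBiadjacency {m n : ℕ} (A : Fin m → Fin n → Bool) : Bigraph (Fin n) (Fin m) where
  checksOf v := Finset.univ.filter fun c => A c v = true
  varsOf c := Finset.univ.filter fun v => A c v = true
  mem_iff := by simp

/-- The ensemble of all `(n, dv, dc)`-biregular graphs with labelled nodes and `m` check nodes,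
each given by its biadjacency matrix. -/
def biregularEnsemble (m n dv dc : ℕ) : Set (Fin m → Fin n → Bool) :=
  {A | (ofBiadjacency A).IsBiregular dv dc}

/-! ## The decoders

The nonzero weight of the edge between `c` and `v` is `w (c, v)`, the signal is `x`. The numbers
`u (c, v)` (independent, uniform on `[0,1]`) are used for the choices "at random" among several
admissible messages: the incoming message with the smallest number is chosen. -/

/-- The verification status of all variable nodes: `none` for unverified, i.e. the message `(0,0)`,
and `some a` for verified with value `a`, i.e. the message `(1,a)`. -/
abbrev Status (V : Type) := V → Option ℝ

section Decoder

variable {V C : Type} (G : Bigraph V C) (w : C × V → ℝ) (x : V → ℝ) (u : C × V → unitInterval)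

/-- The measurement at the check node `c`. -/
def measurement (c : C) : ℝ := ∑ v ∈ G.varsOf c, w (c, v) * x v

open Classical in
/-- The first coordinate of the message sent by `c`: the number of unverified neighbours. -/
def checkDegree (s : Status V) (c : C) : ℕ := ((G.varsOf c).filter fun v => s v = none).card

/-- The second coordinate of the message sent by `c`: the measurement minus the contribution of
the verified neighbours. -/
def checkValue (s : Status V) (c : C) : ℝ :=
  measurement G w x c - ∑ v ∈ G.varsOf c, w (c, v) * (s v).getD 0

/-- The message received by `v` from `c`; the edge divides the value by its weight. -/
def received (s : Status V) (v : V) (c : C) : ℕ × ℝ :=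
  (checkDegree G s c, checkValue G w x s c / w (c, v))

open Classical in
/-- Degree one check node rule: the neighbours of `v` whose message has the form `(1, ξ)`. -/
def degreeOneSenders (s : Status V) (v : V) : Finset C :=
  (G.checksOf v).filter fun c => (received G w x s v c).1 = 1

open Classical in
/-- Equal check nodes rule: the neighbours of `v` whose message has the same value as the message
of at least one other neighbour. -/
def equalSenders (s : Status V) (v : V) : Finset C :=
  (G.checksOf v).filter fun c =>
    ∃ c' ∈ G.checksOf v, c' ≠ c ∧ (received G w x s v c').2 = (received G w x s v c).2

open Classical in
/-- If `S` is nonempty, verify `v` with the value of a message chosen at random among those sent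
by the nodes of `S`; otherwise leave `v` unverified. (The minimum over the chosen nodes only
matters in the null event that two of the numbers `u` agree.) -/
def verifyFrom (s : Status V) (v : V) (S : Finset C) : Option ℝ :=
  if h : (S.filter fun c => ∀ c' ∈ S, u (c, v) ≤ u (c', v)).Nonempty then
    some ((S.filter fun c => ∀ c' ∈ S, u (c, v) ≤ u (c', v)).inf' h
      fun c => (received G w x s v c).2)
  else none

/-- A round in which the unverified variable nodes apply the degree one check node rule. -/
def roundD1CN (s : Status V) : Status V := fun v =>
  match s v with
  | some a => some a
  | none => verifyFrom G w x u s v (degreeOneSenders G w x s v)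

open Classical in
/-- A round in which the unverified variable nodes apply the degree one and the equal check nodes
rules. -/
def roundD1CNorECN (s : Status V) : Status V := fun v =>
  match s v with
  | some a => some a
  | none => verifyFrom G w x u s v (degreeOneSenders G w x s v ∪ equalSenders G w x s v)

open Classical in
/-- A round in which the unverified variable nodes apply the zero check node rule. -/
def roundZCN (s : Status V) : Status V := fun v =>
  match s v with
  | some a => some a
  | none => if ∃ c ∈ G.checksOf v, (received G w x s v c).2 = 0 then some 0 else none

/-- The three verification-based algorithms. -/
inductive Algorithm
  | genie
  | lm
  | sbb

open Classical in
/-- The status at the beginning of iteration `0`: Genie knows the support of the signal, and the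
other decoders know nothing. -/
def initialStatus : Algorithm → Status V
  | .genie => fun v => if x v = 0 then some 0 else none
  | .lm => fun _ => none
  | .sbb => fun _ => none

/-- Iteration `0`. In Genie no further variable node is verified; in LM and SBB it consists of one
round with the zero check node rule. -/
def iterationZero : Algorithm → Status V → Status V
  | .genie, s => s
  | .lm, s => roundZCN G w x s
  | .sbb, s => roundZCN G w x s

/-- An iteration `ℓ ≥ 1`. -/
def iteration : Algorithm → Status V → Status V
  | .genie, s => roundD1CN G w x u s
  | .lm, s => roundZCN G w x (roundD1CN G w x u s)
  | .sbb, s => roundZCN G w x (roundD1CNorECN G w x u s)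

/-- The status at the beginning of iteration `ℓ`. -/
def status (alg : Algorithm) : ℕ → Status V
  | 0 => initialStatus x alg
  | 1 => iterationZero G w x alg (initialStatus x alg)
  | ℓ + 2 => iteration G w x u alg (status alg (ℓ + 1))

/-- The variable node `v` is nonzero, and unverified at the beginning of iteration `ℓ`. -/
def IsUnverifiedNonzero (alg : Algorithm) (ℓ : ℕ) (v : V) : Prop :=
  x v ≠ 0 ∧ status G w x u alg ℓ v = none

end Decoder

/-! ## Random weights and signals -/

/-- The law of a signal element: zero with probability `1 - α`, distributed as `g` with
probability `α`. -/
def signalElementLaw (g : Measure ℝ) (α : ℝ) : Measure ℝ :=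
  ENNReal.ofReal α • g + ENNReal.ofReal (1 - α) • Measure.dirac 0

/-- The joint law of independent edge weights (i.i.d. with law `f`), signal elements (i.i.d.) and
auxiliary numbers for the random choices (i.i.d. uniform on `[0,1]`). -/
def inputLaw (V C : Type) (f g : Measure ℝ) (α : ℝ) :
    Measure ((C × V → ℝ) × (V → ℝ) × (C × V → unitInterval)) :=
  (Measure.infinitePi fun _ : C × V => f).prod
    ((Measure.infinitePi fun _ : V => signalElementLaw g α).prod
      (Measure.infinitePi fun _ : C × V => (volume : Measure unitInterval)))

/-- The joint law of a uniformly random `(n, dv, dc)`-biregular graph and, independently of it,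
the weights, the signal and the auxiliary numbers. -/
def sensingLaw (m n dv dc : ℕ) (f g : Measure ℝ) (α : ℝ) :
    Measure ((Fin m → Fin n → Bool) ×
      ((Fin m × Fin n → ℝ) × (Fin n → ℝ) × (Fin m × Fin n → unitInterval))) :=
  (uniformOn (biregularEnsemble m n dv dc)).prod (inputLaw (Fin n) (Fin m) f g α)

open Classical in
/-- `β^(ℓ)`: the fraction (of all `n` variable nodes) of nonzero variable nodes that are unverified
at the beginning of iteration `ℓ`. -/
def unverifiedFraction {m n : ℕ} (alg : Algorithm) (ℓ : ℕ)
    (T : (Fin m → Fin n → Bool) ×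
      ((Fin m × Fin n → ℝ) × (Fin n → ℝ) × (Fin m × Fin n → unitInterval))) : ℝ :=
  ((Finset.univ.filter fun v : Fin n =>
    IsUnverifiedNonzero (ofBiadjacency T.1) T.2.1 T.2.2.1 T.2.2.2 alg ℓ v).card : ℝ) / n

/-! ## The cycle-free case: the infinite biregular tree rooted at a variable node -/

/-- The check nodes of the infinite tree: `top i` is the `i`-th child of the root, and
`deeper c b j` is the `j`-th child of the `b`-th child of the check node `c`. -/
inductive TreeCheck (dv dc : ℕ) : Type
  | top (i : Fin dv) : TreeCheck dv dc
  | deeper (c : TreeCheck dv dc) (b : Fin (dc - 1)) (j : Fin (dv - 1)) : TreeCheck dv dc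

/-- The variable nodes of the infinite tree: `none` is the root, and `some (c, b)` is the `b`-th
child of the check node `c`. -/
abbrev TreeVar (dv dc : ℕ) : Type := Option (TreeCheck dv dc × Fin (dc - 1))

/-- The parent of a check node. -/
def TreeCheck.parent {dv dc : ℕ} : TreeCheck dv dc → TreeVar dv dc
  | .top _ => none
  | .deeper c b _ => some (c, b)

open Classical in
/-- The infinite tree. -/
def tree (dv dc : ℕ) : Bigraph (TreeVar dv dc) (TreeCheck dv dc) where
  checksOf
    | none => Finset.univ.image TreeCheck.top
    | some (c, b) => insert c (Finset.univ.image (TreeCheck.deeper c b))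
  varsOf c := insert c.parent (Finset.univ.image fun b => some (c, b))
  mem_iff := by
    rintro (_ | ⟨c', b⟩) (i | ⟨c, b', j⟩)
    · simp [TreeCheck.parent]
    · simp [TreeCheck.parent]
    · simp [TreeCheck.parent, eq_comm]
    · simp [TreeCheck.parent]
      grind

theorem tree_isBiregular {dv dc : ℕ} (hv : 0 < dv) (hc : 0 < dc) :
    (tree dv dc).IsBiregular dv dc := by
  classical
  have hne : ∀ (c : TreeCheck dv dc) b j, TreeCheck.deeper c b j ≠ c := by
    intro c b j h
    have := congrArg sizeOf h
    simp at this
    omega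
  constructor
  · rintro (_ | ⟨c, b⟩)
    · simp only [tree]
      rw [Finset.card_image_of_injective _ (fun _ _ h => by simpa using h)]
      simp
    · simp only [tree]
      rw [Finset.card_insert_of_notMem (by simpa using fun j => hne c b j),
        Finset.card_image_of_injective _ (fun _ _ h => by simpa using h)]
      simp
      omega
  · intro c
    have hp : c.parent ∉ Finset.univ.image fun b : Fin (dc - 1) => (some (c, b) : TreeVar dv dc) := by
      cases c with
      | top i => simp [TreeCheck.parent]
      | deeper c b j =>
        simp only [TreeCheck.parent, Finset.mem_image, Finset.mem_univ, true_and, not_exists]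
        intro b' h
        simp only [Option.some.injEq, Prod.mk.injEq] at h
        exact hne _ _ _ h.1
    simp only [tree]
    rw [Finset.card_insert_of_notMem hp,
      Finset.card_image_of_injective _ (fun _ _ h => by simpa using h)]
    simp
    omega

/-- `α^(ℓ)`: the probability that, in the cycle-free case, a variable node is nonzero and
unverified at the beginning of iteration `ℓ`. -/
def cycleFreeValue (alg : Algorithm) (dv dc ℓ : ℕ) (f g : Measure ℝ) (α : ℝ) : ℝ :=
  (inputLaw (TreeVar dv dc) (TreeCheck dv dc) f g α).real
    {ω | IsUnverifiedNonzero (tree dv dc) ω.1 ω.2.1 ω.2.2 alg ℓ none}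

end VB

end

/-! The status of a node at the beginning of iteration ℓ is a function of the graph, the weights,
the signal and the tie-breaking numbers in a bounded neighbourhood: an iteration has at most two
rounds, and a round reads only the checks of a node and their neighbours. Both claims rest on this
locality (`status_eq_of_agree_near`).

The uniform biregular graph is replaced by a uniform configuration, a bijection between half-edges.
Every graph comes from the same number of simple configurations (`card_fiber`), and a configuration
is simple with probability at least a constant not depending on n (`card_le_simplicityConst_mul`).
Hence the expectation of a nonnegative function over the graphs is at most a constant times its
expectation over all configurations.

(i) Changing one weight, signal element or tie-breaking number, or transposing two half-edges, moves
β by O(1/n), and only O(n) of these variables matter. Exponential moments are bounded by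
conditioning on one variable at a time, with Hoeffding's lemma at each step, for product measures
(`GaussianMoments.prod`, `gaussianMoments_pi`) and for uniform permutations (`sum_exp_perm_le`).
Restricting to simple configurations multiplies the exponential moment by a constant and recentring
squares that constant (`exp_moment_mean_le`); a larger μ absorbs it in the tail bound
(`le_two_mul_exp_of_le`).

(ii) A simple configuration and a root r define a covering map from the infinite tree to the graph.
Whether or not there are cycles, the decoder at r does what the tree decoder does at its root on the
input read through this map (`IsSimple.localMatch`). When the map is injective on the finite region
that the root depends on, the input read there is again independent, so the probability is exactly
the cycle-free value (`IsSimple.real_isUnverifiedNonzero_eq`). A switching argument bounds the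
probability of a collision by O(1/n) (`card_not_injectiveOn_le`), and averaging over r gives the
claim. -/

namespace VB

/-! ## Locality of the decoders -/

section Transport

variable {V' C' V C : Type}

/-- Around the variable node `v`, the maps `φ` and `ψ` identify the graph `G`, the weights, the
signal and the auxiliary numbers with those of `G'` around `φ v`. -/
structure LocalMatch (G : Bigraph V C) (G' : Bigraph V' C') (φ : V → V') (ψ : C → C')
    (w : C × V → ℝ) (x : V → ℝ) (u : C × V → unitInterval)
    (w' : C' × V' → ℝ) (x' : V' → ℝ) (u' : C' × V' → unitInterval) (v : V) : Prop where
  checks_inj : Set.InjOn ψ (G.checksOf v)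
  checks_iff : ∀ c', c' ∈ G'.checksOf (φ v) ↔ ∃ c ∈ G.checksOf v, ψ c = c'
  vars_inj : ∀ c ∈ G.checksOf v, Set.InjOn φ (G.varsOf c)
  vars_iff : ∀ c ∈ G.checksOf v, ∀ z', z' ∈ G'.varsOf (ψ c) ↔ ∃ z ∈ G.varsOf c, φ z = z'
  weight : ∀ c ∈ G.checksOf v, ∀ z ∈ G.varsOf c, w' (ψ c, φ z) = w (c, z)
  signal_self : x' (φ v) = x v
  signal : ∀ c ∈ G.checksOf v, ∀ z ∈ G.varsOf c, x' (φ z) = x z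
  tie : ∀ c ∈ G.checksOf v, u' (ψ c, φ v) = u (c, v)

variable {G : Bigraph V C} {G' : Bigraph V' C'} {φ : V → V'} {ψ : C → C'}
  {w : C × V → ℝ} {x : V → ℝ} {u : C × V → unitInterval}
  {w' : C' × V' → ℝ} {x' : V' → ℝ} {u' : C' × V' → unitInterval} {v : V}
  {s : Status V} {s' : Status V'}

theorem LocalMatch.sum_varsOf (h : LocalMatch G G' φ ψ w x u w' x' u' v) {c : C}
    (hc : c ∈ G.checksOf v) (F : V' → ℝ) :
    ∑ z ∈ G'.varsOf (ψ c), F z = ∑ z ∈ G.varsOf c, F (φ z) := by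
  classical
  have : G'.varsOf (ψ c) = (G.varsOf c).image φ := by
    ext z
    simp [h.vars_iff c hc]
  rw [this, Finset.sum_image (h.vars_inj c hc)]

theorem LocalMatch.received_eq (h : LocalMatch G G' φ ψ w x u w' x' u' v)
    (hs : ∀ c ∈ G.checksOf v, ∀ z ∈ G.varsOf c, s' (φ z) = s z) {c : C} (hc : c ∈ G.checksOf v) :
    received G' w' x' s' (φ v) (ψ c) = received G w x s v c := by
  classical
  have hv : v ∈ G.varsOf c := (G.mem_iff v c).1 hc
  have hval : checkValue G' w' x' s' (ψ c) = checkValue G w x s c := by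
    unfold checkValue measurement
    rw [h.sum_varsOf hc, h.sum_varsOf hc]
    congr 1
    · exact Finset.sum_congr rfl fun z hz => by rw [h.weight c hc z hz, h.signal c hc z hz]
    · exact Finset.sum_congr rfl fun z hz => by rw [h.weight c hc z hz, hs c hc z hz]
  have hdeg : checkDegree G' s' (ψ c) = checkDegree G s c := by
    unfold checkDegree
    have : (G'.varsOf (ψ c)).filter (fun z => s' z = none)
        = ((G.varsOf c).filter fun z => s z = none).image φ := by
      ext z
      simp only [Finset.mem_filter, Finset.mem_image, h.vars_iff c hc]
      constructor
      · rintro ⟨⟨y, hy, rfl⟩, hz⟩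
        exact ⟨y, ⟨hy, by rwa [hs c hc y hy] at hz⟩, rfl⟩
      · rintro ⟨y, ⟨hy, hz⟩, rfl⟩
        exact ⟨⟨y, hy, rfl⟩, by rwa [hs c hc y hy]⟩
    rw [this, Finset.card_image_of_injOn]
    exact (h.vars_inj c hc).mono fun z hz => (Finset.mem_filter.1 hz).1
  unfold received
  rw [hval, hdeg, h.weight c hc v hv]

open Classical in
theorem LocalMatch.degreeOneSenders_eq (h : LocalMatch G G' φ ψ w x u w' x' u' v)
    (hs : ∀ c ∈ G.checksOf v, ∀ z ∈ G.varsOf c, s' (φ z) = s z) :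
    degreeOneSenders G' w' x' s' (φ v) = (degreeOneSenders G w x s v).image ψ := by
  ext c
  simp only [degreeOneSenders, Finset.mem_filter, Finset.mem_image, h.checks_iff]
  constructor
  · rintro ⟨⟨y, hy, rfl⟩, hz⟩
    exact ⟨y, ⟨hy, by rwa [h.received_eq hs hy] at hz⟩, rfl⟩
  · rintro ⟨y, ⟨hy, hz⟩, rfl⟩
    exact ⟨⟨y, hy, rfl⟩, by rwa [h.received_eq hs hy]⟩

open Classical in
-- This is the one rule for which `checks_inj` matters: two distinct senders with equal values must
-- have distinct images.
theorem LocalMatch.equalSenders_eq (h : LocalMatch G G' φ ψ w x u w' x' u' v)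
    (hs : ∀ c ∈ G.checksOf v, ∀ z ∈ G.varsOf c, s' (φ z) = s z) :
    equalSenders G' w' x' s' (φ v) = (equalSenders G w x s v).image ψ := by
  ext c
  simp only [equalSenders, Finset.mem_filter, Finset.mem_image, h.checks_iff]
  constructor
  · rintro ⟨⟨y, hy, rfl⟩, c', ⟨y', hy', rfl⟩, hne, heq⟩
    rw [h.received_eq hs hy, h.received_eq hs hy'] at heq
    exact ⟨y, ⟨hy, y', hy', fun e => hne (by rw [e]), heq⟩, rfl⟩
  · rintro ⟨y, ⟨hy, y', hy', hne, heq⟩, rfl⟩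
    rw [← h.received_eq hs hy, ← h.received_eq hs hy'] at heq
    exact ⟨⟨y, hy, rfl⟩, ψ y', ⟨y', hy', rfl⟩, fun e => hne (h.checks_inj hy' hy e), heq⟩

open Classical in
-- Since the tie-breaking numbers agree, `ψ` carries minimisers to minimisers. An infimum does not
-- notice repetitions, so injectivity of `ψ` plays no role.
theorem LocalMatch.verifyFrom_eq (h : LocalMatch G G' φ ψ w x u w' x' u' v)
    (hs : ∀ c ∈ G.checksOf v, ∀ z ∈ G.varsOf c, s' (φ z) = s z) {S : Finset C}
    (hS : S ⊆ G.checksOf v) :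
    verifyFrom G' w' x' u' s' (φ v) (S.image ψ) = verifyFrom G w x u s v S := by
  have key : ((S.image ψ).filter fun c => ∀ c' ∈ S.image ψ, u' (c, φ v) ≤ u' (c', φ v))
      = (S.filter fun c => ∀ c' ∈ S, u (c, v) ≤ u (c', v)).image ψ := by
    ext c
    simp only [Finset.mem_filter, Finset.mem_image]
    constructor
    · rintro ⟨⟨y, hy, rfl⟩, hmin⟩
      refine ⟨y, ⟨hy, fun z hz => ?_⟩, rfl⟩
      rw [← h.tie y (hS hy), ← h.tie z (hS hz)]
      exact hmin _ ⟨z, hz, rfl⟩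
    · rintro ⟨y, ⟨hy, hmin⟩, rfl⟩
      refine ⟨⟨y, hy, rfl⟩, ?_⟩
      rintro _ ⟨z, hz, rfl⟩
      rw [h.tie y (hS hy), h.tie z (hS hz)]
      exact hmin z hz
  unfold verifyFrom
  by_cases hne : (S.filter fun c => ∀ c' ∈ S, u (c, v) ≤ u (c', v)).Nonempty
  · rw [dif_pos hne, dif_pos (by rw [key]; exact hne.image ψ)]
    congr 1
    rw [Finset.inf'_congr _ key (fun _ _ => rfl), Finset.inf'_image]
    refine Finset.inf'_congr _ rfl fun c hc => ?_
    simp only [Function.comp]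
    rw [h.received_eq hs (hS (Finset.mem_filter.1 hc).1)]
  · rw [dif_neg hne, dif_neg (by rw [key]; simpa [Finset.image_nonempty] using hne)]

theorem mem_degreeOneSenders {c : C} : c ∈ degreeOneSenders G w x s v ↔
    c ∈ G.checksOf v ∧ (received G w x s v c).1 = 1 := by
  classical
  rw [degreeOneSenders, Finset.mem_filter]

theorem degreeOneSenders_subset : degreeOneSenders G w x s v ⊆ G.checksOf v := by
  intro c hc
  exact (Finset.mem_filter.1 hc).1

theorem equalSenders_subset : equalSenders G w x s v ⊆ G.checksOf v := by
  intro c hc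
  classical
  rw [equalSenders, Finset.mem_filter] at hc
  exact hc.1

theorem LocalMatch.roundD1CN_eq (h : LocalMatch G G' φ ψ w x u w' x' u' v)
    (hs : ∀ c ∈ G.checksOf v, ∀ z ∈ G.varsOf c, s' (φ z) = s z) (hv : s' (φ v) = s v) :
    roundD1CN G' w' x' u' s' (φ v) = roundD1CN G w x u s v := by
  unfold roundD1CN
  rw [hv, h.degreeOneSenders_eq hs, h.verifyFrom_eq hs degreeOneSenders_subset]

theorem LocalMatch.roundD1CNorECN_eq (h : LocalMatch G G' φ ψ w x u w' x' u' v)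
    (hs : ∀ c ∈ G.checksOf v, ∀ z ∈ G.varsOf c, s' (φ z) = s z) (hv : s' (φ v) = s v) :
    roundD1CNorECN G' w' x' u' s' (φ v) = roundD1CNorECN G w x u s v := by
  classical
  unfold roundD1CNorECN
  rw [hv, h.degreeOneSenders_eq hs, h.equalSenders_eq hs, ← Finset.image_union,
    h.verifyFrom_eq hs (Finset.union_subset degreeOneSenders_subset equalSenders_subset)]

theorem LocalMatch.roundZCN_eq (h : LocalMatch G G' φ ψ w x u w' x' u' v)
    (hs : ∀ c ∈ G.checksOf v, ∀ z ∈ G.varsOf c, s' (φ z) = s z) (hv : s' (φ v) = s v) :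
    roundZCN G' w' x' s' (φ v) = roundZCN G w x s v := by
  have : (∃ c ∈ G'.checksOf (φ v), (received G' w' x' s' (φ v) c).2 = 0) ↔
      ∃ c ∈ G.checksOf v, (received G w x s v c).2 = 0 := by
    constructor
    · rintro ⟨c, hc, h0⟩
      obtain ⟨y, hy, rfl⟩ := (h.checks_iff c).1 hc
      exact ⟨y, hy, by rwa [h.received_eq hs hy] at h0⟩
    · rintro ⟨y, hy, h0⟩
      exact ⟨ψ y, (h.checks_iff _).2 ⟨y, hy, rfl⟩, by rwa [h.received_eq hs hy]⟩
  unfold roundZCN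
  rw [hv]
  simp only [this]

theorem initialStatus_eq (alg : Algorithm) (h : x' (φ v) = x v) :
    initialStatus x' alg (φ v) = initialStatus x alg v := by
  cases alg <;> simp [initialStatus, h]

/-- If the graphs are locally identified everywhere, then so are the statuses. -/
theorem status_eq_of_localMatch (h : ∀ v, LocalMatch G G' φ ψ w x u w' x' u' v)
    (alg : Algorithm) (ℓ : ℕ) :
    ∀ v, status G' w' x' u' alg ℓ (φ v) = status G w x u alg ℓ v := by
  have h0 : ∀ v, initialStatus x' alg (φ v) = initialStatus x alg v :=
    fun v => initialStatus_eq alg (h v).signal_self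
  induction ℓ with
  | zero => exact h0
  | succ k ih =>
    cases k with
    | zero =>
      intro v
      simp only [status]
      cases alg
      · exact h0 v
      · exact (h v).roundZCN_eq (fun _ _ z _ => h0 z) (h0 v)
      · exact (h v).roundZCN_eq (fun _ _ z _ => h0 z) (h0 v)
    | succ k =>
      intro v
      simp only [status]
      cases alg
      · exact (h v).roundD1CN_eq (fun _ _ z _ => ih z) (ih v)
      · have := fun v => (h v).roundD1CN_eq (fun _ _ z _ => ih z) (ih v)
        exact (h v).roundZCN_eq (fun _ _ z _ => this z) (this v)
      · have := fun v => (h v).roundD1CNorECN_eq (fun _ _ z _ => ih z) (ih v)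
        exact (h v).roundZCN_eq (fun _ _ z _ => this z) (this v)

end Transport

/-! ### Neighbourhoods of variable nodes and their sizes -/

section Near

variable {V C : Type} (G : Bigraph V C)

open Classical in
/-- The variable nodes at distance at most two from `v`. -/
noncomputable def Bigraph.nbr (v : V) : Finset V :=
  insert v ((G.checksOf v).biUnion G.varsOf)

open Classical in
/-- The variable nodes at distance at most `2 * k` from `v`. -/
noncomputable def Bigraph.near : ℕ → V → Finset V
  | 0, v => {v}
  | k + 1, v => (G.nbr v).biUnion (Bigraph.near k)

theorem Bigraph.mem_nbr {v z : V} :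
    z ∈ G.nbr v ↔ z = v ∨ ∃ c ∈ G.checksOf v, z ∈ G.varsOf c := by
  classical
  simp [Bigraph.nbr]

theorem Bigraph.mem_near_succ {k : ℕ} {v z : V} :
    z ∈ G.near (k + 1) v ↔ ∃ y ∈ G.nbr v, z ∈ G.near k y := by
  classical
  simp [Bigraph.near]

theorem Bigraph.nbr_symm {v z : V} : z ∈ G.nbr v ↔ v ∈ G.nbr z := by
  simp only [Bigraph.mem_nbr, G.mem_iff]
  grind

theorem Bigraph.mem_near_succ' {k : ℕ} {v z : V} :
    z ∈ G.near (k + 1) v ↔ ∃ y ∈ G.near k v, z ∈ G.nbr y := by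
  induction k generalizing v with
  | zero => simp [Bigraph.near]
  | succ k ih =>
    rw [Bigraph.mem_near_succ]
    simp only [ih]
    constructor
    · rintro ⟨y, hy, t, ht, hz⟩
      exact ⟨t, (G.mem_near_succ).2 ⟨y, hy, ht⟩, hz⟩
    · rintro ⟨t, ht, hz⟩
      obtain ⟨y, hy, ht⟩ := (G.mem_near_succ).1 ht
      exact ⟨y, hy, t, ht, hz⟩

/-- Turns "the nodes on which `v` depends" into "the nodes that depend on `v`", whose number can
then be bounded by `card_near_le`. The recursion peels steps off at one end only; `mem_near_succ'`
peels at the other. -/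
theorem Bigraph.near_symm {k : ℕ} {v z : V} : z ∈ G.near k v ↔ v ∈ G.near k z := by
  induction k generalizing v z with
  | zero => simp [Bigraph.near, eq_comm]
  | succ k ih =>
    rw [Bigraph.mem_near_succ, Bigraph.mem_near_succ']
    exact exists_congr fun y => by rw [ih, G.nbr_symm]; tauto

theorem Bigraph.self_mem_nbr (v : V) : v ∈ G.nbr v := (G.mem_nbr).2 (Or.inl rfl)

theorem Bigraph.near_subset_succ (k : ℕ) (v : V) : G.near k v ⊆ G.near (k + 1) v :=
  fun _ hz => (G.mem_near_succ).2 ⟨v, G.self_mem_nbr v, hz⟩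

theorem Bigraph.self_mem_near (k : ℕ) (v : V) : v ∈ G.near k v := by
  induction k with
  | zero => simp [Bigraph.near]
  | succ k ih => exact G.near_subset_succ k v ih

/-- All degrees are bounded by `dv` and `dc`, respectively. -/
def Bigraph.DegreesLE (dv dc : ℕ) : Prop :=
  (∀ v, (G.checksOf v).card ≤ dv) ∧ ∀ c, (G.varsOf c).card ≤ dc

theorem Bigraph.card_nbr_le {dv dc : ℕ} (h : G.DegreesLE dv dc) (v : V) :
    (G.nbr v).card ≤ dv * dc + 1 := by
  classical
  unfold Bigraph.nbr
  refine (Finset.card_insert_le _ _).trans ?_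
  gcongr
  refine (Finset.card_biUnion_le_card_mul _ _ dc fun c _ => h.2 c).trans ?_
  gcongr
  exact h.1 v

theorem Bigraph.card_near_le {dv dc : ℕ} (h : G.DegreesLE dv dc) (k : ℕ) (v : V) :
    (G.near k v).card ≤ (dv * dc + 1) ^ k := by
  classical
  induction k generalizing v with
  | zero => simp [Bigraph.near]
  | succ k ih =>
    unfold Bigraph.near
    refine (Finset.card_biUnion_le_card_mul _ _ _ fun y _ => ih y).trans ?_
    rw [pow_succ']
    gcongr
    exact G.card_nbr_le h v

end Near

/-! ### Dependence of the decoders on nearby data -/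

section Agree

variable {V C : Type} {G G' : Bigraph V C} {w w' : C × V → ℝ} {x x' : V → ℝ}
  {u u' : C × V → unitInterval}

/-- The data seen by the variable node `v` in one round are the same. -/
abbrev Agree (G G' : Bigraph V C) (w : C × V → ℝ) (x : V → ℝ) (u : C × V → unitInterval)
    (w' : C × V → ℝ) (x' : V → ℝ) (u' : C × V → unitInterval) (v : V) : Prop :=
  LocalMatch G G' id id w x u w' x' u' v

theorem Agree.of_eq {v : V} (h1 : G'.checksOf v = G.checksOf v)
    (h2 : ∀ c ∈ G.checksOf v, G'.varsOf c = G.varsOf c)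
    (hw : ∀ c ∈ G.checksOf v, ∀ z ∈ G.varsOf c, w' (c, z) = w (c, z)) (hx0 : x' v = x v)
    (hx : ∀ c ∈ G.checksOf v, ∀ z ∈ G.varsOf c, x' z = x z)
    (hu : ∀ c ∈ G.checksOf v, u' (c, v) = u (c, v)) : Agree G G' w x u w' x' u' v where
  checks_inj := Function.injective_id.injOn
  checks_iff := by simp [h1]
  vars_inj := fun _ _ => Function.injective_id.injOn
  vars_iff := fun c hc z => by simp [h2 c hc]
  weight := hw
  signal_self := hx0
  signal := hx
  tie := hu

/-- The status of `v` at the beginning of iteration `ℓ` only depends on the data near `v`. -/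
theorem status_eq_of_agree_near (alg : Algorithm) (ℓ : ℕ) (v : V)
    (h : ∀ z ∈ G.near (2 * ℓ) v, Agree G G' w x u w' x' u' z) :
    status G' w' x' u' alg ℓ v = status G w x u alg ℓ v := by
  have h0 : ∀ v, Agree G G' w x u w' x' u' v →
      initialStatus x' alg v = initialStatus x alg v :=
    fun v hv => initialStatus_eq (φ := id) alg hv.signal_self
  -- The index of `near` counts rounds. An iteration has at most two rounds, hence the radius `2 *
  -- ℓ`; passing from `v` to a node of `nbr v` uses up one unit.
  have step : ∀ v k, (∀ z ∈ G.near (k + 1) v, Agree G G' w x u w' x' u' z) →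
      ∀ y ∈ G.nbr v, ∀ z ∈ G.near k y, Agree G G' w x u w' x' u' z :=
    fun v k hv y hy z hz => hv z ((G.mem_near_succ).2 ⟨y, hy, hz⟩)
  have hn : ∀ {v c z}, c ∈ G.checksOf v → z ∈ G.varsOf c → z ∈ G.nbr v :=
    fun hc hz => (G.mem_nbr).2 (Or.inr ⟨_, hc, hz⟩)
  induction ℓ generalizing v with
  | zero => exact h0 v (h v (G.self_mem_near _ v))
  | succ k ih =>
    have hv := h v (G.self_mem_near _ v)
    have h2 := step v (2 * k + 1) h
    cases k with
    | zero =>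
      have h1 : ∀ y ∈ G.nbr v, initialStatus x' alg y = initialStatus x alg y :=
        fun y hy => h0 y (h2 y hy y (G.self_mem_near _ y))
      simp only [status]
      cases alg
      · exact h1 v (G.self_mem_nbr v)
      · exact hv.roundZCN_eq (fun c hc z hz => h1 z (hn hc hz)) (h1 v (G.self_mem_nbr v))
      · exact hv.roundZCN_eq (fun c hc z hz => h1 z (hn hc hz)) (h1 v (G.self_mem_nbr v))
    | succ k =>
      simp only [status]
      have h3 : ∀ y ∈ G.nbr v, ∀ z ∈ G.nbr y,
          status G' w' x' u' alg (k + 1) z = status G w x u alg (k + 1) z :=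
        fun y hy z hz => ih z (step y _ (h2 y hy) z hz)
      have hself : ∀ y ∈ G.nbr v, Agree G G' w x u w' x' u' y :=
        fun y hy => h2 y hy y (G.self_mem_near _ y)
      have hvv := G.self_mem_nbr v
      cases alg
      · exact hv.roundD1CN_eq (fun c hc z hz => h3 v hvv z (hn hc hz)) (h3 v hvv v hvv)
      · have h4 : ∀ y ∈ G.nbr v, roundD1CN G' w' x' u' (status G' w' x' u' .lm (k + 1)) y
            = roundD1CN G w x u (status G w x u .lm (k + 1)) y := fun y hy =>
          (hself y hy).roundD1CN_eq (fun c hc z hz => h3 y hy z (hn hc hz))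
            (h3 y hy y (G.self_mem_nbr y))
        exact hv.roundZCN_eq (fun c hc z hz => h4 z (hn hc hz)) (h4 v hvv)
      · have h4 : ∀ y ∈ G.nbr v, roundD1CNorECN G' w' x' u' (status G' w' x' u' .sbb (k + 1)) y
            = roundD1CNorECN G w x u (status G w x u .sbb (k + 1)) y := fun y hy =>
          (hself y hy).roundD1CNorECN_eq (fun c hc z hz => h3 y hy z (hn hc hz))
            (h3 y hy y (G.self_mem_nbr y))
        exact hv.roundZCN_eq (fun c hc z hz => h4 z (hn hc hz)) (h4 v hvv)

theorem isUnverifiedNonzero_iff_of_agree_near (alg : Algorithm) (ℓ : ℕ) (v : V)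
    (h : ∀ z ∈ G.near (2 * ℓ) v, Agree G G' w x u w' x' u' z) :
    IsUnverifiedNonzero G' w' x' u' alg ℓ v ↔ IsUnverifiedNonzero G w x u alg ℓ v := by
  unfold IsUnverifiedNonzero
  rw [status_eq_of_agree_near alg ℓ v h,
    show x' v = x v from (h v (G.self_mem_near _ v)).signal_self]

end Agree

/-- Changing the data seen by the variable nodes of `T` changes the fraction of unverified nonzero
variable nodes by at most a constant times `|T| / n`. -/
theorem abs_unverifiedFraction_sub_le {m n dv dc : ℕ} (alg : Algorithm) (ℓ : ℕ)
    {A A' : Fin m → Fin n → Bool} (hA : (ofBiadjacency A).DegreesLE dv dc)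
    {z z' : (Fin m × Fin n → ℝ) × (Fin n → ℝ) × (Fin m × Fin n → unitInterval)}
    (T : Finset (Fin n)) (h : ∀ v ∉ T, Agree (ofBiadjacency A) (ofBiadjacency A')
      z.1 z.2.1 z.2.2 z'.1 z'.2.1 z'.2.2 v) :
    |unverifiedFraction alg ℓ (A', z') - unverifiedFraction alg ℓ (A, z)|
      ≤ T.card * (dv * dc + 1) ^ (2 * ℓ) / n := by
  classical
  set G := ofBiadjacency A
  set P : Finset (Fin n) := Finset.univ.filter fun v =>
    IsUnverifiedNonzero (ofBiadjacency A) z.1 z.2.1 z.2.2 alg ℓ v with hP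
  set P' : Finset (Fin n) := Finset.univ.filter fun v =>
    IsUnverifiedNonzero (ofBiadjacency A') z'.1 z'.2.1 z'.2.2 alg ℓ v with hP'
  set N := T.biUnion (G.near (2 * ℓ)) with hN
  -- By symmetry of `near`, every node that can see `T` lies in the union of the balls around `T`.
  -- Balls are taken in the graph of `A`, so only that graph needs bounded degrees.
  have hout : ∀ v ∉ N, v ∈ P' ↔ v ∈ P := by
    intro v hv
    simp only [hP, hP', Finset.mem_filter, Finset.mem_univ, true_and]
    refine isUnverifiedNonzero_iff_of_agree_near alg ℓ v fun y hy => h y fun hyT => hv ?_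
    exact Finset.mem_biUnion.2 ⟨y, hyT, (G.near_symm).1 hy⟩
  have hcard : N.card ≤ T.card * (dv * dc + 1) ^ (2 * ℓ) :=
    Finset.card_biUnion_le_card_mul _ _ _ fun y _ => G.card_near_le hA _ y
  have h1 : P'.card ≤ P.card + N.card := by
    refine (Finset.card_le_card (t := P ∪ N) fun v hv => ?_).trans (Finset.card_union_le _ _)
    by_cases hvN : v ∈ N
    · simp [hvN]
    · simp [(hout v hvN).1 hv]
  have h2 : P.card ≤ P'.card + N.card := by
    refine (Finset.card_le_card (t := P' ∪ N) fun v hv => ?_).trans (Finset.card_union_le _ _)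
    by_cases hvN : v ∈ N
    · simp [hvN]
    · simp [(hout v hvN).2 hv]
  unfold unverifiedFraction
  change |(P'.card : ℝ) / n - (P.card : ℝ) / n| ≤ _
  rw [← sub_div, abs_div, Nat.abs_cast]
  gcongr
  have h1' : (P'.card : ℝ) ≤ P.card + N.card := by exact_mod_cast h1
  have h2' : (P.card : ℝ) ≤ P'.card + N.card := by exact_mod_cast h2
  have h3' : (N.card : ℝ) ≤ T.card * (dv * dc + 1) ^ (2 * ℓ) := by exact_mod_cast hcard
  rw [abs_le]
  constructor <;> linarith

/-! ## Measurability of the decoders -/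

section Measurability

variable {Ω : Type*} [MeasurableSpace Ω]

/-- A random status is measurable when the verification pattern and the values are. -/
def MeasurableStatus {V : Type} (s : Ω → Status V) : Prop :=
  ∀ v, MeasurableSet {ω | s ω v = none} ∧ Measurable fun ω => (s ω v).getD 0

/-- A random subset of the fixed finite set `K` takes finitely many values, each on a measurable
event; on each of these events the function is one of the measurable `F Q`. -/
theorem measurable_of_finite_choice {ι : Type*} {K : Finset ι} {P : Ω → Finset ι}
    (hP : ∀ ω, P ω ⊆ K) (hPm : ∀ c ∈ K, MeasurableSet {ω | c ∈ P ω}) {F : Finset ι → Ω → ℝ}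
    (hF : ∀ Q ⊆ K, Measurable (F Q)) : Measurable fun ω => F (P ω) ω := by
  classical
  have hset : ∀ Q ⊆ K, MeasurableSet {ω | P ω = Q} := by
    intro Q hQ
    have : {ω | P ω = Q} = ⋂ c ∈ K, {ω | c ∈ P ω ↔ c ∈ Q} := by
      ext ω
      simp only [Set.mem_ofPred_eq, Set.mem_iInter]
      constructor
      · rintro rfl c _
        rfl
      · intro h
        ext c
        constructor
        · exact fun hc => (h c (hP ω hc)).1 hc
        · exact fun hc => (h c (hQ hc)).2 hc
    rw [this]
    refine K.measurableSet_biInter fun c hc => ?_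
    by_cases hcQ : c ∈ Q
    · simpa only [hcQ, iff_true] using hPm c hc
    · simp only [hcQ, iff_false]
      exact (hPm c hc).compl
  have : (fun ω => F (P ω) ω) =
      fun ω => ∑ Q ∈ K.powerset, Set.indicator {ω | P ω = Q} (F Q) ω := by
    funext ω
    rw [Finset.sum_eq_single (P ω)]
    · simp
    · intro Q _ hQ
      simp [Set.indicator, hQ.symm]
    · intro h
      exact absurd (Finset.mem_powerset.2 (hP ω)) h
  rw [this]
  exact Finset.measurable_sum _ fun Q hQ =>
    (hF Q (Finset.mem_powerset.1 hQ)).indicator (hset Q (Finset.mem_powerset.1 hQ))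

theorem measurable_finset_inf' {ι : Type*} {Q : Finset ι} (hQ : Q.Nonempty) {F : Ω → ι → ℝ}
    (hF : ∀ c, Measurable fun ω => F ω c) : Measurable fun ω => Q.inf' hQ (F ω) := by
  induction hQ using Finset.Nonempty.cons_induction with
  | singleton c => simpa using hF c
  | cons c Q hc hQ ih =>
    simp only [Finset.inf'_cons hQ]
    exact (hF c).inf ih

variable {V C : Type} (G : Bigraph V C) {w : Ω → C × V → ℝ} {x : Ω → V → ℝ}
  {u : Ω → C × V → unitInterval} {s : Ω → Status V}

theorem measurable_checkDegree (hs : MeasurableStatus s) (c : C) :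
    Measurable fun ω => checkDegree G (s ω) c := by
  classical
  have : (fun ω => checkDegree G (s ω) c)
      = fun ω => ∑ v ∈ G.varsOf c, if s ω v = none then 1 else 0 := by
    funext ω
    rw [checkDegree, Finset.card_filter]
  rw [this]
  exact Finset.measurable_sum _ fun v _ =>
    Measurable.ite (hs v).1 measurable_const measurable_const

theorem measurable_checkValue (hw : ∀ e, Measurable fun ω => w ω e)
    (hx : ∀ v, Measurable fun ω => x ω v) (hs : MeasurableStatus s) (c : C) :
    Measurable fun ω => checkValue G (w ω) (x ω) (s ω) c := by
  unfold checkValue measurement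
  exact (Finset.measurable_sum _ fun v _ => (hw _).mul (hx v)).sub
    (Finset.measurable_sum _ fun v _ => (hw _).mul (hs v).2)

theorem measurable_received_snd (hw : ∀ e, Measurable fun ω => w ω e)
    (hx : ∀ v, Measurable fun ω => x ω v) (hs : MeasurableStatus s) (v : V) (c : C) :
    Measurable fun ω => (received G (w ω) (x ω) (s ω) v c).2 :=
  (measurable_checkValue G hw hx hs c).div (hw _)

theorem measurableSet_mem_degreeOneSenders (hs : MeasurableStatus s) (v : V) (c : C) :
    MeasurableSet {ω | c ∈ degreeOneSenders G (w ω) (x ω) (s ω) v} := by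
  classical
  by_cases hc : c ∈ G.checksOf v
  · have : {ω | c ∈ degreeOneSenders G (w ω) (x ω) (s ω) v}
        = (fun ω => checkDegree G (s ω) c) ⁻¹' {1} := by
      ext ω
      simp only [Set.mem_ofPred_eq, mem_degreeOneSenders, hc, true_and]
      rfl
    rw [this]
    exact measurable_checkDegree G hs c (measurableSet_singleton 1)
  · have : {ω | c ∈ degreeOneSenders G (w ω) (x ω) (s ω) v} = ∅ := by
      ext ω
      simp [mem_degreeOneSenders, hc]
    rw [this]
    exact MeasurableSet.empty

theorem measurableSet_mem_equalSenders (hw : ∀ e, Measurable fun ω => w ω e)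
    (hx : ∀ v, Measurable fun ω => x ω v) (hs : MeasurableStatus s) (v : V) (c : C) :
    MeasurableSet {ω | c ∈ equalSenders G (w ω) (x ω) (s ω) v} := by
  classical
  simp only [equalSenders, Finset.mem_filter]
  have : MeasurableSet {ω | ∃ c' ∈ G.checksOf v, c' ≠ c ∧
      (received G (w ω) (x ω) (s ω) v c').2 = (received G (w ω) (x ω) (s ω) v c).2} := by
    have : {ω | ∃ c' ∈ G.checksOf v, c' ≠ c ∧
        (received G (w ω) (x ω) (s ω) v c').2 = (received G (w ω) (x ω) (s ω) v c).2}
        = ⋃ c' ∈ G.checksOf v, {ω | c' ≠ c ∧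
          (received G (w ω) (x ω) (s ω) v c').2 = (received G (w ω) (x ω) (s ω) v c).2} := by
      ext ω
      simp only [Set.mem_ofPred_eq, Set.mem_iUnion, exists_prop]
    rw [this]
    refine Finset.measurableSet_biUnion _ fun c' _ => ?_
    by_cases hne : c' = c
    · simp [hne]
    · simpa only [ne_eq, hne, not_false_eq_true, true_and] using
        measurableSet_eq_fun (measurable_received_snd G hw hx hs v c')
        (measurable_received_snd G hw hx hs v c)
  by_cases hc : c ∈ G.checksOf v
  · simpa only [hc, true_and] using this
  · simp [hc]

/-- The set of minimisers of the tie-breaking numbers is a random subset of the fixed finite set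
`G.checksOf v`, so `measurable_of_finite_choice` applies to the value. -/
theorem measurable_verifyFrom (hw : ∀ e, Measurable fun ω => w ω e)
    (hx : ∀ v, Measurable fun ω => x ω v) (hu : ∀ e, Measurable fun ω => u ω e)
    (hs : MeasurableStatus s) (v : V) {S : Ω → Finset C} (hS : ∀ ω, S ω ⊆ G.checksOf v)
    (hSm : ∀ c, MeasurableSet {ω | c ∈ S ω}) :
    MeasurableSet {ω | verifyFrom G (w ω) (x ω) (u ω) (s ω) v (S ω) = none} ∧
      Measurable fun ω => (verifyFrom G (w ω) (x ω) (u ω) (s ω) v (S ω)).getD 0 := by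
  classical
  set P : Ω → Finset C := fun ω => (S ω).filter fun c => ∀ c' ∈ S ω, u ω (c, v) ≤ u ω (c', v)
    with hP
  have hPsub : ∀ ω, P ω ⊆ G.checksOf v := fun ω => (Finset.filter_subset _ _).trans (hS ω)
  have hPm : ∀ c, MeasurableSet {ω | c ∈ P ω} := by
    intro c
    have : {ω | c ∈ P ω} = {ω | c ∈ S ω} ∩
        ⋂ c' ∈ G.checksOf v, ({ω | c' ∈ S ω}ᶜ ∪ {ω | u ω (c, v) ≤ u ω (c', v)}) := by
      ext ω
      simp only [hP, Finset.mem_filter, Set.mem_ofPred_eq, Set.mem_inter_iff, Set.mem_iInter,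
        Set.mem_union, Set.mem_compl_iff]
      refine and_congr_right fun _ => ⟨fun h c' _ => ?_, fun h c' hc' => ?_⟩
      · by_cases hc' : c' ∈ S ω
        · exact Or.inr (h c' hc')
        · exact Or.inl hc'
      · exact (h c' (hS ω hc')).resolve_left (not_not.2 hc')
    rw [this]
    exact (hSm c).inter (Finset.measurableSet_biInter _ fun c' _ =>
      (hSm c').compl.union (measurableSet_le (hu _) (hu _)))
  have hnone : ∀ ω, verifyFrom G (w ω) (x ω) (u ω) (s ω) v (S ω) = none ↔ ¬ (P ω).Nonempty := by
    intro ω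
    unfold verifyFrom
    by_cases h : (P ω).Nonempty
    · rw [dif_pos (by convert h)]
      simp [h]
    · rw [dif_neg (by convert h)]
      simp [h]
  constructor
  · have : {ω | verifyFrom G (w ω) (x ω) (u ω) (s ω) v (S ω) = none}
        = (⋃ c ∈ G.checksOf v, {ω | c ∈ P ω})ᶜ := by
      ext ω
      simp only [Set.mem_ofPred_eq, hnone, Set.mem_compl_iff, Set.mem_iUnion]
      refine not_congr ⟨fun ⟨c, hc⟩ => ⟨c, hPsub ω hc, hc⟩, fun ⟨c, _, hc⟩ => ⟨c, hc⟩⟩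
    rw [this]
    exact (Finset.measurableSet_biUnion _ fun c _ => hPm c).compl
  · have : (fun ω => (verifyFrom G (w ω) (x ω) (u ω) (s ω) v (S ω)).getD 0) = fun ω =>
        (fun (Q : Finset C) (ω : Ω) => if h : Q.Nonempty then
          Q.inf' h (fun c => (received G (w ω) (x ω) (s ω) v c).2) else 0) (P ω) ω := by
      funext ω
      unfold verifyFrom
      by_cases h : (P ω).Nonempty
      · rw [dif_pos (by convert h)]
        simp only [h, dif_pos, Option.getD_some]
        congr!
      · rw [dif_neg (by convert h)]
        simp [h]
    rw [this]
    refine measurable_of_finite_choice (F := fun (Q : Finset C) (ω : Ω) => if h : Q.Nonempty then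
      Q.inf' h (fun c => (received G (w ω) (x ω) (s ω) v c).2) else 0) hPsub
      (fun c _ => hPm c) fun Q _ => ?_
    by_cases hQ : Q.Nonempty
    · simp only [hQ, dif_pos]
      exact measurable_finset_inf' hQ fun c => measurable_received_snd G hw hx hs v c
    · simp only [hQ, dif_neg, not_false_eq_true]
      exact measurable_const

/-- All three rounds have this shape, because verified nodes never change. -/
theorem MeasurableStatus.update {s t : Ω → Status V} (hs : MeasurableStatus s)
    (ht : MeasurableStatus t) : MeasurableStatus fun ω v =>
      match s ω v with
      | some a => some a
      | none => t ω v := by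
  classical
  intro v
  constructor
  · have : {ω | (match s ω v with
      | some a => some a
      | none => t ω v) = none} = {ω | s ω v = none} ∩ {ω | t ω v = none} := by
      ext ω
      simp only [Set.mem_ofPred_eq, Set.mem_inter_iff]
      cases s ω v <;> simp
    rw [this]
    exact (hs v).1.inter (ht v).1
  · have : (fun ω => (match s ω v with
      | some a => some a
      | none => t ω v).getD 0) = fun ω => if s ω v = none then (t ω v).getD 0
        else (s ω v).getD 0 := by
      funext ω
      cases s ω v <;> simp
    rw [this]
    exact Measurable.ite (hs v).1 (ht v).2 (hs v).2

theorem measurableStatus_roundD1CN (hw : ∀ e, Measurable fun ω => w ω e)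
    (hx : ∀ v, Measurable fun ω => x ω v) (hu : ∀ e, Measurable fun ω => u ω e)
    (hs : MeasurableStatus s) :
    MeasurableStatus fun ω => roundD1CN G (w ω) (x ω) (u ω) (s ω) :=
  hs.update (t := fun ω v => verifyFrom G (w ω) (x ω) (u ω) (s ω) v
    (degreeOneSenders G (w ω) (x ω) (s ω) v)) fun v =>
      measurable_verifyFrom G hw hx hu hs v (fun _ => degreeOneSenders_subset)
        (measurableSet_mem_degreeOneSenders G hs v)

open Classical in
theorem measurableStatus_roundD1CNorECN (hw : ∀ e, Measurable fun ω => w ω e)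
    (hx : ∀ v, Measurable fun ω => x ω v) (hu : ∀ e, Measurable fun ω => u ω e)
    (hs : MeasurableStatus s) :
    MeasurableStatus fun ω => roundD1CNorECN G (w ω) (x ω) (u ω) (s ω) :=
  hs.update (t := fun ω v => verifyFrom G (w ω) (x ω) (u ω) (s ω) v
    (degreeOneSenders G (w ω) (x ω) (s ω) v ∪ equalSenders G (w ω) (x ω) (s ω) v)) fun v =>
      measurable_verifyFrom G hw hx hu hs v
        (fun _ => Finset.union_subset degreeOneSenders_subset equalSenders_subset)
        fun c => by
          simp only [Finset.mem_union]
          exact (measurableSet_mem_degreeOneSenders G hs v c).union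
            (measurableSet_mem_equalSenders G hw hx hs v c)

open Classical in
theorem measurableStatus_roundZCN (hw : ∀ e, Measurable fun ω => w ω e)
    (hx : ∀ v, Measurable fun ω => x ω v) (hs : MeasurableStatus s) :
    MeasurableStatus fun ω => roundZCN G (w ω) (x ω) (s ω) := by
  refine hs.update (t := fun ω v =>
    if ∃ c ∈ G.checksOf v, (received G (w ω) (x ω) (s ω) v c).2 = 0 then some 0 else none)
    fun v => ?_
  have hm : MeasurableSet {ω | ∃ c ∈ G.checksOf v, (received G (w ω) (x ω) (s ω) v c).2 = 0} := by
    have : {ω | ∃ c ∈ G.checksOf v, (received G (w ω) (x ω) (s ω) v c).2 = 0}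
        = ⋃ c ∈ G.checksOf v, {ω | (received G (w ω) (x ω) (s ω) v c).2 = 0} := by
      ext ω
      simp
    rw [this]
    exact Finset.measurableSet_biUnion _ fun c _ =>
      measurable_received_snd G hw hx hs v c (measurableSet_singleton 0)
  constructor
  · have : {ω | (if ∃ c ∈ G.checksOf v, (received G (w ω) (x ω) (s ω) v c).2 = 0
        then some (0 : ℝ) else none) = none}
        = {ω | ∃ c ∈ G.checksOf v, (received G (w ω) (x ω) (s ω) v c).2 = 0}ᶜ := by
      ext ω
      simp only [Set.mem_ofPred_eq, Set.mem_compl_iff]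
      split_ifs with h <;> simp [h]
    rw [this]
    exact hm.compl
  · have : (fun ω => (if ∃ c ∈ G.checksOf v, (received G (w ω) (x ω) (s ω) v c).2 = 0
        then some (0 : ℝ) else none).getD 0) = fun _ => 0 := by
      funext ω
      split_ifs <;> simp
    rw [this]
    exact measurable_const

theorem measurableStatus_status (hw : ∀ e, Measurable fun ω => w ω e)
    (hx : ∀ v, Measurable fun ω => x ω v) (hu : ∀ e, Measurable fun ω => u ω e)
    (alg : Algorithm) (ℓ : ℕ) :
    MeasurableStatus fun ω => status G (w ω) (x ω) (u ω) alg ℓ := by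
  classical
  have h0 : MeasurableStatus fun ω => initialStatus (x ω) alg := by
    intro v
    cases alg
    · have hm : MeasurableSet {ω | x ω v = 0} := hx v (measurableSet_singleton 0)
      constructor
      · have : {ω | initialStatus (x ω) .genie v = none} = {ω | x ω v = 0}ᶜ := by
          ext ω
          simp [initialStatus]
        rw [this]
        exact hm.compl
      · have : (fun ω => (initialStatus (x ω) .genie v).getD 0) = fun _ => 0 := by
          funext ω
          simp only [initialStatus]
          split_ifs <;> simp
        rw [this]
        exact measurable_const
    · simp [initialStatus]
    · simp [initialStatus]
  induction ℓ with
  | zero => exact h0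
  | succ k ih =>
    cases k with
    | zero =>
      simp only [status]
      cases alg
      · exact h0
      · exact measurableStatus_roundZCN G hw hx h0
      · exact measurableStatus_roundZCN G hw hx h0
    | succ k =>
      simp only [status]
      cases alg
      · exact measurableStatus_roundD1CN G hw hx hu ih
      · exact measurableStatus_roundZCN G hw hx (measurableStatus_roundD1CN G hw hx hu ih)
      · exact measurableStatus_roundZCN G hw hx (measurableStatus_roundD1CNorECN G hw hx hu ih)

theorem measurableSet_isUnverifiedNonzero (alg : Algorithm) (ℓ : ℕ) (v : V) :
    MeasurableSet {ω : (C × V → ℝ) × (V → ℝ) × (C × V → unitInterval) |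
      IsUnverifiedNonzero G ω.1 ω.2.1 ω.2.2 alg ℓ v} := by
  have hx : ∀ v, Measurable fun ω : (C × V → ℝ) × (V → ℝ) × (C × V → unitInterval) =>
      ω.2.1 v := fun v => by fun_prop
  exact (hx v (measurableSet_singleton 0)).compl.inter
    ((measurableStatus_status G (Ω := (C × V → ℝ) × (V → ℝ) × (C × V → unitInterval))
      (w := fun ω => ω.1) (x := fun ω => ω.2.1) (u := fun ω => ω.2.2)
      (fun e => by fun_prop) hx (fun e => by fun_prop) alg ℓ) v).1

/-- There are finitely many graphs, so measurability can be checked for one fixed graph at a time.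
-/
theorem measurable_unverifiedFraction {m n : ℕ} (alg : Algorithm) (ℓ : ℕ) :
    Measurable (unverifiedFraction (m := m) (n := n) alg ℓ) := by
  classical
  refine measurable_from_prod_countable_right fun A => ?_
  unfold unverifiedFraction
  refine Measurable.div_const ?_ _
  have : (fun z : (Fin m × Fin n → ℝ) × (Fin n → ℝ) × (Fin m × Fin n → unitInterval) =>
      ((Finset.univ.filter fun v : Fin n =>
        IsUnverifiedNonzero (ofBiadjacency A) z.1 z.2.1 z.2.2 alg ℓ v).card : ℝ))
      = fun z => ∑ v : Fin n,
        if IsUnverifiedNonzero (ofBiadjacency A) z.1 z.2.1 z.2.2 alg ℓ v then (1 : ℝ) else 0 := by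
    funext z
    rw [Finset.card_filter]
    push_cast
    rfl
  convert Finset.measurable_sum (s := Finset.univ) (f := fun (v : Fin n)
    (z : (Fin m × Fin n → ℝ) × (Fin n → ℝ) × (Fin m × Fin n → unitInterval)) =>
      if IsUnverifiedNonzero (ofBiadjacency A) z.1 z.2.1 z.2.2 alg ℓ v then (1 : ℝ) else 0)
      (fun v _ => Measurable.ite
        (measurableSet_isUnverifiedNonzero (ofBiadjacency A) alg ℓ v)
        measurable_const measurable_const) using 1

end Measurability

/-! ## Exponential moments of functions with bounded differences -/

section Subgaussian

variable {Ω Ω' : Type*} [MeasurableSpace Ω'] [MeasurableSpace Ω]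

/-- A Gaussian bound for the exponential moments of the centred function `f`. -/
def GaussianMoments (μ : Measure Ω) (f : Ω → ℝ) (V : ℝ) : Prop :=
  ∀ t : ℝ, ∫ ω, Real.exp (t * (f ω - ∫ ω', f ω' ∂μ)) ∂μ ≤ Real.exp (t ^ 2 * V / 2)

theorem integrable_of_bounded {μ : Measure Ω} [IsFiniteMeasure μ] {f : Ω → ℝ} {B : ℝ}
    (hf : Measurable f) (hB : ∀ ω, |f ω| ≤ B) : Integrable f μ :=
  Integrable.of_bound hf.aestronglyMeasurable B (Filter.Eventually.of_forall hB)

theorem integrable_exp_of_bounded {μ : Measure Ω} [IsFiniteMeasure μ] {f : Ω → ℝ} {B : ℝ}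
    (hf : Measurable f) (hB : ∀ ω, |f ω| ≤ B) (t m : ℝ) :
    Integrable (fun ω => Real.exp (t * (f ω - m))) μ := by
  refine integrable_of_bounded (B := Real.exp (|t| * (B + |m|))) (by fun_prop) fun ω => ?_
  rw [Real.abs_exp]
  refine Real.exp_le_exp.2 ((le_abs_self _).trans ?_)
  rw [abs_mul]
  gcongr
  exact (abs_sub _ _).trans (by gcongr; exact hB ω)

theorem abs_integral_le_of_bounded {μ : Measure Ω} [IsProbabilityMeasure μ] {f : Ω → ℝ} {B : ℝ}
    (hB : ∀ ω, |f ω| ≤ B) : |∫ ω, f ω ∂μ| ≤ B := by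
  have := norm_integral_le_of_norm_le_const (μ := μ) (f := f) (C := B)
    (Filter.Eventually.of_forall hB)
  simpa using this

/-- With `g` the conditional mean given the first coordinate and `m` the overall mean, `f - m = (f -
g) + (g - m)`. The inner integral controls the first summand uniformly in `a`, the outer one the
second, so the variance bounds add. -/
theorem GaussianMoments.prod {μ : Measure Ω} {ν : Measure Ω'} [IsProbabilityMeasure μ]
    [IsProbabilityMeasure ν] {f : Ω × Ω' → ℝ} {B V₁ V₂ : ℝ} (hf : Measurable f)
    (hB : ∀ z, |f z| ≤ B) (h₁ : GaussianMoments μ (fun a => ∫ b, f (a, b) ∂ν) V₁)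
    (h₂ : ∀ a, GaussianMoments ν (fun b => f (a, b)) V₂) :
    GaussianMoments (μ.prod ν) f (V₁ + V₂) := by
  intro t
  set g : Ω → ℝ := fun a => ∫ b, f (a, b) ∂ν with hg
  have hm : ∫ z, f z ∂(μ.prod ν) = ∫ a, g a ∂μ :=
    integral_prod f (integrable_of_bounded hf hB)
  set m := ∫ a, g a ∂μ
  have hgB : ∀ a, |g a| ≤ B := fun a => abs_integral_le_of_bounded fun b => hB (a, b)
  have hgm : Measurable g :=
    (hf.stronglyMeasurable.integral_prod_right' (ν := ν)).measurable
  rw [hm, integral_prod _ (integrable_exp_of_bounded hf hB t m)]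
  calc ∫ a, ∫ b, Real.exp (t * (f (a, b) - m)) ∂ν ∂μ
      = ∫ a, Real.exp (t * (g a - m)) * ∫ b, Real.exp (t * (f (a, b) - g a)) ∂ν ∂μ := by
        refine integral_congr_ae (Filter.Eventually.of_forall fun a => ?_)
        simp only
        rw [← integral_const_mul]
        refine integral_congr_ae (Filter.Eventually.of_forall fun b => ?_)
        simp only
        rw [← Real.exp_add]
        ring_nf
    _ ≤ ∫ a, Real.exp (t * (g a - m)) * Real.exp (t ^ 2 * V₂ / 2) ∂μ := by
        refine integral_mono_of_nonneg (Filter.Eventually.of_forall fun a => ?_)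
          ((integrable_exp_of_bounded hgm hgB t m).mul_const _)
          (Filter.Eventually.of_forall fun a => ?_)
        · exact mul_nonneg (Real.exp_nonneg _) (integral_nonneg fun _ => Real.exp_nonneg _)
        · exact mul_le_mul_of_nonneg_left (h₂ a t) (Real.exp_nonneg _)
    _ ≤ Real.exp (t ^ 2 * V₁ / 2) * Real.exp (t ^ 2 * V₂ / 2) := by
        rw [integral_mul_const]
        exact mul_le_mul_of_nonneg_right (h₁ t) (Real.exp_nonneg _)
    _ = Real.exp (t ^ 2 * (V₁ + V₂) / 2) := by
        rw [← Real.exp_add]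
        ring_nf

theorem GaussianMoments.of_measurePreserving {μ : Measure Ω} {ν : Measure Ω'} (e : Ω ≃ᵐ Ω')
    (he : MeasurePreserving e μ ν) {f : Ω' → ℝ} {V : ℝ} (h : GaussianMoments ν f V) :
    GaussianMoments μ (fun ω => f (e ω)) V := by
  intro t
  rw [he.integral_comp' (g := f),
    he.integral_comp' (g := fun z => Real.exp (t * (f z - ∫ ω', f ω' ∂ν)))]
  exact h t

/-- Hoeffding's lemma. -/
theorem GaussianMoments.of_oscillation {μ : Measure Ω} [IsProbabilityMeasure μ] {f : Ω → ℝ}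
    {c : ℝ} (hf : Measurable f) (hc : ∀ a b, |f a - f b| ≤ c) :
    GaussianMoments μ f (c ^ 2) := by
  intro t
  obtain ⟨a⟩ : Nonempty Ω := μ.nonempty_of_neZero
  have hc0 : 0 ≤ c := (abs_nonneg _).trans (hc a a)
  -- All values lie within `c` of `f a`. This interval has length `2 * c`, which yields the variance
  -- bound `c ^ 2` rather than the optimal `c ^ 2 / 4`; only the constant `μ` of the theorem is
  -- affected.
  have h := (hasSubgaussianMGF_of_mem_Icc (μ := μ) (a := f a - c) (b := f a + c) hf.aemeasurable
    (Filter.Eventually.of_forall fun b => by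
      have := abs_le.1 (hc a b)
      exact ⟨by linarith [this.2], by linarith [this.1]⟩)).mgf_le t
  refine h.trans (Real.exp_le_exp.2 (le_of_eq ?_))
  have : (f a + c - (f a - c)) = 2 * c := by ring
  rw [this]
  push_cast
  rw [Real.norm_of_nonneg (by positivity)]
  ring

/-- Coordinate 0 is split off. The average over the other coordinates oscillates by at most `c 0` as
a function of it, which is Hoeffding's lemma; for a fixed value of coordinate 0 the induction
hypothesis applies. -/
theorem gaussianMoments_pi {E : Type*} [MeasurableSpace E] (μ : Measure E)
    [IsProbabilityMeasure μ] (n : ℕ) : ∀ {f : (Fin n → E) → ℝ} {B : ℝ} (_ : Measurable f)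
    (_ : ∀ z, |f z| ≤ B) (c : Fin n → ℝ)
    (_ : ∀ z i a, |f (Function.update z i a) - f z| ≤ c i),
    GaussianMoments (Measure.pi fun _ => μ) f (∑ i, c i ^ 2) := by
  induction n with
  | zero =>
    intro f B hf hB c hc t
    have : ∀ z, f z = f Fin.elim0 := fun z => by rw [Subsingleton.elim z Fin.elim0]
    simp [this]
  | succ n ih =>
    intro f B hf hB c hc
    have hmp := measurePreserving_piFinSuccAbove (fun _ : Fin (n + 1) => μ) 0
    set e := MeasurableEquiv.piFinSuccAbove (fun _ : Fin (n + 1) => E) 0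
    have hsymm : ∀ a z, e.symm (a, z) = Fin.cons a z := by
      intro a z
      change (Fin.insertNth 0 a z : Fin (n + 1) → E) = _
      rw [Fin.insertNth_zero']
    have hF : Measurable fun p => f (e.symm p) := hf.comp e.symm.measurable
    have hprod : GaussianMoments (μ.prod (Measure.pi fun _ : Fin n => μ))
        (fun p => f (e.symm p)) (c 0 ^ 2 + ∑ i : Fin n, c i.succ ^ 2) := by
      refine GaussianMoments.prod hF (fun p => hB _) ?_ fun a => ?_
      · refine GaussianMoments.of_oscillation
          (hF.stronglyMeasurable.integral_prod_right').measurable fun a b => ?_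
        have hint : ∀ a, Integrable (fun z => f (e.symm (a, z))) (Measure.pi fun _ : Fin n => μ) :=
          fun a => integrable_of_bounded (hF.comp measurable_prodMk_left) fun z => hB _
        rw [← integral_sub (hint a) (hint b)]
        refine abs_integral_le_of_bounded fun z => ?_
        have := hc (Fin.cons b z) 0 a
        rwa [Fin.update_cons_zero, ← hsymm, ← hsymm] at this
      · refine ih (hF.comp measurable_prodMk_left) (fun z => hB _) (fun i => c i.succ)
          fun z i b => ?_
        simp only [hsymm, Function.comp]
        rw [Fin.cons_update]
        exact hc _ _ _
    have := hprod.of_measurePreserving e hmp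
    rw [Fin.sum_univ_succ]
    simpa using this

/-- A function of finitely many independent variables that changes by at most `c i` when the
variable `i` is changed has Gaussian exponential moments. -/
theorem gaussianMoments_infinitePi {ι E : Type*} [Fintype ι] [DecidableEq ι] [MeasurableSpace E]
    (μ : Measure E) [IsProbabilityMeasure μ] {f : (ι → E) → ℝ} {B : ℝ} (hf : Measurable f)
    (hB : ∀ z, |f z| ≤ B) (c : ι → ℝ) (hc : ∀ z i a, |f (Function.update z i a) - f z| ≤ c i) :
    GaussianMoments (Measure.infinitePi fun _ => μ) f (∑ i, c i ^ 2) := by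
  rw [Measure.infinitePi_eq_pi]
  set r := Fintype.equivFin ι
  have hmp := measurePreserving_piCongrLeft (fun _ : ι => μ) r.symm
  set e := MeasurableEquiv.piCongrLeft (fun _ : ι => E) r.symm
  have he : ∀ z i, e z i = z (r i) := by
    intro z i
    have := Equiv.piCongrLeft_apply_apply (fun _ : ι => E) r.symm z (r i)
    rw [Equiv.symm_apply_apply] at this
    exact this
  have h := gaussianMoments_pi μ (Fintype.card ι) (f := fun z => f (e z)) (B := B)
    (hf.comp e.measurable) (fun z => hB _) (fun i => c (r.symm i)) fun z i a => by
      have : e (Function.update z i a) = Function.update (e z) (r.symm i) a := by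
        funext j
        rw [he]
        by_cases hj : j = r.symm i
        · subst hj
          simp
        · rw [Function.update_of_ne hj, he, Function.update_of_ne]
          exact fun hij => hj (by rw [← hij, Equiv.symm_apply_apply])
      rw [this]
      exact hc _ _ _
  have h2 := h.of_measurePreserving e.symm hmp.symm
  rw [Equiv.sum_comp r.symm (fun i => c i ^ 2)] at h2
  simpa using h2

end Subgaussian

/-! ### Exponential moments for uniform permutations and bijections -/

section Permutations

/-- Convexity puts the exponential below its chord on `[-tc, tc]`, giving `cosh (t * c) + (y / c) *
sinh (t * c)`, and `cosh z ≤ exp (z ^ 2 / 2)`. The term linear in `y` is kept because it vanishes on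
averaging a centred function; multiplying by `c` covers `c = 0`. -/
theorem exp_le_of_abs_le {y c : ℝ} (hy : |y| ≤ c) (t : ℝ) :
    c * Real.exp (t * y) ≤ c * Real.exp (t ^ 2 * c ^ 2 / 2) + y * Real.sinh (t * c) := by
  have hc : 0 ≤ c := (abs_nonneg _).trans hy
  rcases hc.eq_or_lt with rfl | hc
  · have : y = 0 := by simpa using hy
    simp [this]
  have hy' := abs_le.1 hy
  have hconv := convexOn_exp.2 (Set.mem_univ (t * c)) (Set.mem_univ (-(t * c)))
    (show 0 ≤ (c + y) / (2 * c) from div_nonneg (by linarith) (by linarith))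
    (show 0 ≤ (c - y) / (2 * c) from div_nonneg (by linarith) (by linarith))
    (by field_simp; ring)
  simp only [smul_eq_mul] at hconv
  have he : (c + y) / (2 * c) * (t * c) + (c - y) / (2 * c) * (-(t * c)) = t * y := by
    field_simp
    ring
  rw [he] at hconv
  have hcosh := Real.cosh_le_exp_half_sq (t * c)
  have h2 : (c + y) / (2 * c) * Real.exp (t * c) + (c - y) / (2 * c) * Real.exp (-(t * c))
      = Real.cosh (t * c) + y / c * Real.sinh (t * c) := by
    rw [Real.cosh_eq, Real.sinh_eq]
    field_simp
    ring
  calc c * Real.exp (t * y) ≤ c * (Real.cosh (t * c) + y / c * Real.sinh (t * c)) := by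
        rw [← h2]
        exact mul_le_mul_of_nonneg_left hconv hc.le
    _ = c * Real.cosh (t * c) + y * Real.sinh (t * c) := by
        field_simp
    _ ≤ _ := by
        gcongr
        rwa [mul_pow] at hcosh

/-- Hoeffding's lemma for the uniform distribution on a finite set. -/
theorem sum_exp_le_of_oscillation {ι : Type*} [Fintype ι] [Nonempty ι] {g : ι → ℝ} {c : ℝ}
    (hc : ∀ i j, |g i - g j| ≤ c) (t : ℝ) :
    ∑ i, Real.exp (t * (g i - (∑ j, g j) / Fintype.card ι))
      ≤ Fintype.card ι * Real.exp (t ^ 2 * c ^ 2 / 2) := by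
  set m := (∑ j, g j) / Fintype.card ι with hm
  have hcard : (0 : ℝ) < Fintype.card ι := by exact_mod_cast Fintype.card_pos
  have hc0 : 0 ≤ c := (abs_nonneg _).trans (hc (Classical.arbitrary ι) (Classical.arbitrary ι))
  have hdev : ∀ i, |g i - m| ≤ c := by
    intro i
    have : g i - m = (∑ j, (g i - g j)) / Fintype.card ι := by
      rw [hm, Finset.sum_sub_distrib]
      simp
      field_simp
    rw [this, abs_div, Nat.abs_cast, div_le_iff₀ hcard]
    refine (Finset.abs_sum_le_sum_abs _ _).trans ((Finset.sum_le_sum fun j _ => hc i j).trans ?_)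
    simp [mul_comm]
  have hsum0 : ∑ i, (g i - m) = 0 := by
    rw [Finset.sum_sub_distrib, hm]
    simp
    field_simp
    simp
  rcases hc0.eq_or_lt with rfl | hcpos
  · have : ∀ i, g i - m = 0 := fun i => by simpa using hdev i
    simp [this]
  have key : c * ∑ i, Real.exp (t * (g i - m))
      ≤ c * (Fintype.card ι * Real.exp (t ^ 2 * c ^ 2 / 2)) := by
    rw [Finset.mul_sum]
    refine (Finset.sum_le_sum fun i _ => exp_le_of_abs_le (hdev i) t).trans ?_
    rw [Finset.sum_add_distrib, ← Finset.sum_mul (f := fun i => g i - m), hsum0]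
    simp
    exact le_of_eq (by ring)
  exact le_of_mul_le_mul_left key hcpos

/-- Conjugating a transposition by `swap 0 p` gives a transposition. Hence, with the image `p` of 0
fixed, a function stable under transpositions stays so as a function of the remaining permutation,
as the induction in `sum_exp_perm_le` requires. -/
theorem decomposeFin_symm_swap_mul {N : ℕ} (p : Fin (N + 1)) (a b : Fin N)
    (e : Equiv.Perm (Fin N)) :
    Equiv.Perm.decomposeFin.symm (p, Equiv.swap a b * e)
      = Equiv.swap (Equiv.swap 0 p a.succ) (Equiv.swap 0 p b.succ)
        * Equiv.Perm.decomposeFin.symm (p, e) := by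
  have hconj : ∀ y, Equiv.swap (Equiv.swap 0 p a.succ) (Equiv.swap 0 p b.succ) (Equiv.swap 0 p y)
      = Equiv.swap 0 p (Equiv.swap a.succ b.succ y) := by
    intro y
    rw [(Equiv.swap 0 p).injective.swap_apply]
  ext1 x
  refine Fin.cases ?_ (fun x => ?_) x
  · rw [Equiv.Perm.mul_apply, Equiv.Perm.decomposeFin_symm_apply_zero,
      Equiv.Perm.decomposeFin_symm_apply_zero]
    have := hconj 0
    rw [Equiv.swap_apply_left, Equiv.swap_apply_of_ne_of_ne (Fin.succ_ne_zero a).symm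
      (Fin.succ_ne_zero b).symm, Equiv.swap_apply_left] at this
    exact this.symm
  · rw [Equiv.Perm.mul_apply, Equiv.Perm.decomposeFin_symm_apply_succ,
      Equiv.Perm.decomposeFin_symm_apply_succ, hconj, Equiv.Perm.mul_apply,
      (Fin.succ_injective N).swap_apply]

/-- The image of 0 is revealed, then the rest by induction. The conditional mean given that image
oscillates by at most `2 * c`, so each of the `N` steps contributes `(2 * c) ^ 2` to the variance
bound. -/
theorem sum_exp_perm_le {N : ℕ} : ∀ {f : Equiv.Perm (Fin N) → ℝ} {c : ℝ}
    (_ : ∀ π a b, |f (Equiv.swap a b * π) - f π| ≤ c) (t : ℝ),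
    ∑ π, Real.exp (t * (f π - (∑ ρ, f ρ) / Fintype.card (Equiv.Perm (Fin N))))
      ≤ Fintype.card (Equiv.Perm (Fin N)) * Real.exp (t ^ 2 * (N * (2 * c) ^ 2) / 2) := by
  induction N with
  | zero =>
    intro f c _ t
    simp
  | succ N ih =>
    intro f c hc t
    set M : ℝ := (Fintype.card (Equiv.Perm (Fin N)) : ℝ) with hM
    have hMpos : 0 < M := by
      rw [hM]
      exact_mod_cast Fintype.card_pos
    have hcard : (Fintype.card (Equiv.Perm (Fin (N + 1))) : ℝ) = (N + 1) * M := by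
      simp [hM, Fintype.card_perm, Nat.factorial_succ]
    have hsum : ∀ F : Equiv.Perm (Fin (N + 1)) → ℝ,
        ∑ π, F π = ∑ p, ∑ e, F (Equiv.Perm.decomposeFin.symm (p, e)) := by
      intro F
      rw [← Equiv.sum_comp Equiv.Perm.decomposeFin.symm F, Fintype.sum_prod_type]
    set g : Fin (N + 1) → ℝ := fun p =>
      (∑ e, f (Equiv.Perm.decomposeFin.symm (p, e))) / M with hg
    set m := (∑ p, g p) / Fintype.card (Fin (N + 1)) with hm
    have hmean : (∑ ρ, f ρ) / Fintype.card (Equiv.Perm (Fin (N + 1))) = m := by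
      rw [hcard, hsum, hm, hg, ← Finset.sum_div]
      simp
      field_simp
    have hosc : ∀ p q, |g p - g q| ≤ 2 * c := by
      intro p q
      have hpq : ∀ e, |f (Equiv.Perm.decomposeFin.symm (p, e))
          - f (Equiv.Perm.decomposeFin.symm (q, e))| ≤ 2 * c := by
        intro e
        -- The permutations indexed by `p` and by `q` are each one transposition away from the one
        -- indexed by 0, hence the bound `2 * c`.
        have hp : ∀ p, Equiv.Perm.decomposeFin.symm (p, e)
            = Equiv.swap 0 p * Equiv.Perm.decomposeFin.symm (0, e) := by
          intro p
          ext1 x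
          refine Fin.cases ?_ (fun x => ?_) x <;> simp
        have h1 := hc (Equiv.Perm.decomposeFin.symm (0, e)) 0 p
        have h2 := hc (Equiv.Perm.decomposeFin.symm (0, e)) 0 q
        rw [hp p, hp q]
        rw [abs_le] at *
        constructor <;> linarith [h1.1, h1.2, h2.1, h2.2]
      simp only [hg]
      rw [← sub_div, ← Finset.sum_sub_distrib, abs_div, abs_of_pos hMpos, div_le_iff₀ hMpos]
      refine (Finset.abs_sum_le_sum_abs _ _).trans ((Finset.sum_le_sum fun e _ => hpq e).trans ?_)
      rw [Finset.sum_const, Finset.card_univ, nsmul_eq_mul, mul_comm]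
    have hinner : ∀ p, ∑ e, Real.exp (t * (f (Equiv.Perm.decomposeFin.symm (p, e)) - m))
        ≤ Real.exp (t * (g p - m)) * (M * Real.exp (t ^ 2 * (N * (2 * c) ^ 2) / 2)) := by
      intro p
      have := ih (f := fun e => f (Equiv.Perm.decomposeFin.symm (p, e))) (c := c)
        (fun π a b => by rw [decomposeFin_symm_swap_mul]; exact hc _ _ _) t
      refine le_trans (le_of_eq ?_) (mul_le_mul_of_nonneg_left this (Real.exp_nonneg _))
      rw [Finset.mul_sum]
      refine Finset.sum_congr rfl fun e _ => ?_
      rw [← Real.exp_add]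
      congr 1
      simp only [hg]
      ring
    rw [hmean, hsum]
    refine (Finset.sum_le_sum fun p _ => hinner p).trans ?_
    rw [← Finset.sum_mul]
    refine (mul_le_mul_of_nonneg_right (sum_exp_le_of_oscillation hosc t) (by positivity)).trans
      (le_of_eq ?_)
    rw [hcard, Fintype.card_fin]
    push_cast
    have : Real.exp (t ^ 2 * (((N : ℝ) + 1) * (2 * c) ^ 2) / 2)
        = Real.exp (t ^ 2 * (2 * c) ^ 2 / 2) * Real.exp (t ^ 2 * (N * (2 * c) ^ 2) / 2) := by
      rw [← Real.exp_add]
      ring_nf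
    rw [this]
    ring

/-- A function of a uniformly random bijection that changes by at most `c` under transpositions
has Gaussian exponential moments. -/
theorem sum_exp_equiv_le {X Y : Type*} [Fintype X] [Fintype Y] [DecidableEq X] [DecidableEq Y]
    {f : X ≃ Y → ℝ} {c : ℝ} (hc : ∀ σ a b, |f ((Equiv.swap a b).trans σ) - f σ| ≤ c) (t : ℝ) :
    ∑ σ, Real.exp (t * (f σ - (∑ ρ, f ρ) / Fintype.card (X ≃ Y)))
      ≤ Fintype.card (X ≃ Y) * Real.exp (t ^ 2 * (Fintype.card X * (2 * c) ^ 2) / 2) := by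
  rcases isEmpty_or_nonempty (X ≃ Y) with hE | ⟨⟨σ₀⟩⟩
  · simp
  set r := Fintype.equivFin X
  -- The inverse turns multiplication by a transposition on the left into exchanging two arguments
  -- of the bijection, which is the form of `hc`.
  let Φ : Equiv.Perm (Fin (Fintype.card X)) ≃ (X ≃ Y) :=
    (Equiv.inv _).trans (Equiv.equivCongr r.symm (r.symm.trans σ₀))
  have hΦ : ∀ π x, Φ π x = σ₀ (r.symm (π⁻¹ (r x))) := fun π x => rfl
  have hcard : Fintype.card (X ≃ Y) = Fintype.card (Equiv.Perm (Fin (Fintype.card X))) :=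
    (Fintype.card_congr Φ).symm
  have h := sum_exp_perm_le (f := fun π => f (Φ π)) (c := c) (fun π a b => by
    have : Φ (Equiv.swap a b * π) = (Equiv.swap (r.symm a) (r.symm b)).trans (Φ π) := by
      ext1 x
      rw [hΦ, Equiv.trans_apply, hΦ, mul_inv_rev, Equiv.Perm.mul_apply, Equiv.swap_inv,
        ← r.injective.swap_apply]
      simp
    rw [this]
    exact hc _ _ _) t
  rw [Equiv.sum_comp Φ f, ← hcard,
    Equiv.sum_comp Φ fun σ => Real.exp (t * (f σ - (∑ ρ, f ρ) / Fintype.card (X ≃ Y)))] at h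
  exact h

end Permutations

/-! ## The configuration model -/

section Switching

variable {X Y : Type*} [Fintype X] [Fintype Y] [DecidableEq X] [DecidableEq Y]

/-- If the bijections in `S` send a point `a σ` into a set `T σ`, and neither the point nor the
set is affected when the value at `a σ` is exchanged with the value outside a small set, then `S`
is small. -/
theorem card_mul_le_of_switching (S : Finset (X ≃ Y)) (a : (X ≃ Y) → X)
    (T : (X ≃ Y) → Finset Y) (E : (X ≃ Y) → Finset X) (K k : ℕ) (hT : ∀ σ, (T σ).card ≤ K)
    (hE : ∀ σ ∈ S, (E σ).card ≤ k) (hmem : ∀ σ ∈ S, σ (a σ) ∈ T σ)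
    (ha : ∀ σ ∈ S, ∀ x ∉ E σ, a ((Equiv.swap (a σ) x).trans σ) = a σ)
    (hTi : ∀ σ ∈ S, ∀ x ∉ E σ, T ((Equiv.swap (a σ) x).trans σ) = T σ) :
    S.card * (Fintype.card X - k) ≤ K * Fintype.card (X ≃ Y) := by
  -- Double counting: the pairs of some `σ ∈ S` and some `x ∉ E σ` are mapped injectively to pairs
  -- of a bijection and a point of its set `T`, by switching the values at `a σ` and `x` and
  -- remembering `σ (a σ)`.
  have h1 : S.card * (Fintype.card X - k) ≤ (S.sigma fun σ => (E σ)ᶜ).card := by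
    rw [Finset.card_sigma, ← smul_eq_mul, ← Finset.sum_const]
    refine Finset.sum_le_sum fun σ hσ => ?_
    rw [Finset.card_compl]
    have := hE σ hσ
    omega
  have h2 : (Finset.univ.sigma T).card ≤ K * Fintype.card (X ≃ Y) := by
    rw [Finset.card_sigma]
    refine (Finset.sum_le_sum fun σ _ => hT σ).trans ?_
    simp [mul_comm]
  refine h1.trans (le_trans ?_ h2)
  refine Finset.card_le_card_of_injOn
    (fun p => ⟨(Equiv.swap (a p.1) p.2).trans p.1, p.1 (a p.1)⟩) ?_ ?_
  · rintro ⟨σ, x⟩ hp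
    simp only [Finset.coe_sigma, Set.mem_sigma_iff, Finset.mem_coe, Finset.mem_compl] at hp
    simp only [Finset.coe_sigma, Set.mem_sigma_iff, Finset.mem_coe, Finset.mem_univ, true_and]
    rw [hTi σ hp.1 x hp.2]
    exact hmem σ hp.1
  · rintro ⟨σ, x⟩ hp ⟨σ', x'⟩ hp' heq
    simp only [Finset.coe_sigma, Set.mem_sigma_iff, Finset.mem_coe, Finset.mem_compl] at hp hp'
    simp only [Sigma.mk.injEq, heq_eq_eq] at heq
    obtain ⟨h1, h2⟩ := heq
    -- The switching can be undone: `a` is the same before and after it, and `x` is where the new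
    -- bijection takes the remembered value.
    have haa : a σ = a σ' := by rw [← ha σ hp.1 x hp.2, h1, ha σ' hp'.1 x' hp'.2]
    have hx : x = x' := by
      have e1 : ((Equiv.swap (a σ) x).trans σ) x = σ (a σ) := by simp
      have e2 : ((Equiv.swap (a σ') x').trans σ') x' = σ' (a σ') := by simp
      rw [← h1, ← h2, ← e1] at e2
      exact (Equiv.injective _ e2).symm
    subst hx
    rw [← haa] at h1
    have : σ = σ' := by
      ext1 z
      have := Equiv.congr_fun h1 (Equiv.swap (a σ) x z)
      simpa using this
    rw [this]

end Switching

/-- A configuration: a perfect matching of the half-edges at the variable nodes with the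
half-edges at the check nodes. -/
abbrev Config (m n dv dc : ℕ) : Type := Fin n × Fin dv ≃ Fin m × Fin dc

/-! ### The probability that a configuration is simple -/

namespace Config

variable {m n dv dc : ℕ}

/-- The biadjacency matrix of a configuration. -/
def graph (σ : Config m n dv dc) : Fin m → Fin n → Bool :=
  fun c v => decide (∃ i, (σ (v, i)).1 = c)

/-- The configuration has no parallel edges. -/
def IsSimple (σ : Config m n dv dc) : Prop :=
  Function.Injective fun x => (x.1, (σ x).1)

/-- The ordered pairs of distinct parallel edges. -/
def parallel (σ : Config m n dv dc) : Finset ((Fin n × Fin dv) × (Fin n × Fin dv)) :=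
  Finset.univ.filter fun p => p.1 ≠ p.2 ∧ p.1.1 = p.2.1 ∧ (σ p.1).1 = (σ p.2).1

theorem mem_parallel {σ : Config m n dv dc} {p : (Fin n × Fin dv) × (Fin n × Fin dv)} :
    p ∈ σ.parallel ↔ p.1 ≠ p.2 ∧ p.1.1 = p.2.1 ∧ (σ p.1).1 = (σ p.2).1 := by
  simp [parallel]

theorem isSimple_iff (σ : Config m n dv dc) : σ.IsSimple ↔ σ.parallel = ∅ := by
  rw [Finset.eq_empty_iff_forall_notMem]
  constructor
  · rintro h ⟨x, y⟩ hp
    obtain ⟨hne, h1, h2⟩ := mem_parallel.1 hp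
    exact hne (h (Prod.ext h1 h2))
  · intro h x y hxy
    by_contra hne
    simp only [Prod.mk.injEq] at hxy
    exact h (x, y) (mem_parallel.2 ⟨hne, hxy⟩)

/-- First moment: there are at most `n * dv * dv` ordered pairs of half-edges at a common node.
Switching the second half-edge with any half-edge other than the first shows that each pair is
parallel with probability at most `dc / (n * dv - 1)`. -/
theorem sum_card_parallel_le :
    (∑ σ : Config m n dv dc, σ.parallel.card) * (n * dv - 1)
      ≤ n * dv * (dv * dc) * Fintype.card (Config m n dv dc) := by
  classical
  set P : Finset ((Fin n × Fin dv) × (Fin n × Fin dv)) :=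
    Finset.univ.filter fun p => p.1 ≠ p.2 ∧ p.1.1 = p.2.1 with hP
  have hPcard : P.card ≤ n * dv * dv := by
    have : P ⊆ (Finset.univ : Finset ((Fin n × Fin dv) × Fin dv)).image
        fun q => (q.1, (q.1.1, q.2)) := by
      rintro ⟨x, y⟩ hp
      simp only [hP, Finset.mem_filter, Finset.mem_univ, true_and] at hp
      exact Finset.mem_image.2 ⟨(x, y.2), Finset.mem_univ _, by
        simp only [Prod.mk.injEq, true_and]
        exact Prod.ext hp.2 rfl⟩
    refine (Finset.card_le_card this).trans (Finset.card_image_le.trans ?_)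
    simp
  have hsum : ∑ σ : Config m n dv dc, σ.parallel.card
      = ∑ p ∈ P, (Finset.univ.filter fun σ : Config m n dv dc => (σ p.1).1 = (σ p.2).1).card := by
    simp only [Finset.card_filter]
    rw [Finset.sum_comm]
    refine Finset.sum_congr rfl fun σ _ => ?_
    rw [← Finset.card_filter, hP, Finset.filter_filter]
    congr 1
    ext p
    simp [mem_parallel, and_assoc]
  rw [hsum, Finset.sum_mul]
  calc _ ≤ ∑ p ∈ P, dc * Fintype.card (Config m n dv dc) := by
        refine Finset.sum_le_sum fun p hp => ?_
        simp only [hP, Finset.mem_filter, Finset.mem_univ, true_and] at hp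
        have := card_mul_le_of_switching
          (Finset.univ.filter fun σ : Config m n dv dc => (σ p.1).1 = (σ p.2).1)
          (fun _ => p.2) (fun σ => (Finset.univ : Finset (Fin dc)).image fun j => ((σ p.1).1, j))
          (fun _ => {p.1}) dc 1 (fun σ => Finset.card_image_le.trans (by simp))
          (fun σ _ => by simp) (fun σ hσ => by
            simp only [Finset.mem_filter, Finset.mem_univ, true_and] at hσ
            exact Finset.mem_image.2 ⟨(σ p.2).2, Finset.mem_univ _, Prod.ext hσ rfl⟩)
          (fun _ _ _ _ => rfl) (fun σ _ x hx => by
            simp only [Finset.mem_singleton] at hx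
            simp only [Equiv.trans_apply]
            rw [Equiv.swap_apply_of_ne_of_ne hp.1 (Ne.symm hx)])
        simpa using this
    _ = P.card * (dc * Fintype.card (Config m n dv dc)) := by simp
    _ ≤ n * dv * dv * (dc * Fintype.card (Config m n dv dc)) := by gcongr
    _ = _ := by ring

/-- The half-edges that must not be exchanged with `x` when a parallel edge at `x` is removed. -/
def blocked (σ : Config m n dv dc) (x : Fin n × Fin dv) : Finset (Fin n × Fin dv) :=
  ((Finset.univ : Finset (Fin dv × Fin dc)).image fun q => σ.symm ((σ (x.1, q.1)).1, q.2)) ∪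
    (Finset.univ : Finset (Fin dv × Fin dc)).image fun q => ((σ.symm ((σ x).1, q.2)).1, q.1)

theorem card_blocked_le (σ : Config m n dv dc) (x : Fin n × Fin dv) :
    (σ.blocked x).card ≤ 2 * (dv * dc) := by
  refine (Finset.card_union_le _ _).trans ?_
  rw [two_mul]
  gcongr <;> exact Finset.card_image_le.trans (by simp)

theorem ne_of_notMem_blocked {σ : Config m n dv dc} {x z : Fin n × Fin dv}
    (hz : z ∉ σ.blocked x) :
    (∀ y, y.1 = x.1 → (σ y).1 ≠ (σ z).1) ∧ ∀ y, y.1 = z.1 → (σ y).1 ≠ (σ x).1 := by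
  simp only [blocked, Finset.mem_union, Finset.mem_image, Finset.mem_univ, true_and, not_or,
    not_exists] at hz
  constructor
  · rintro y hy h
    refine hz.1 (y.2, (σ z).2) ?_
    rw [show ((x.1, (y.2, (σ z).2).1) : Fin n × Fin dv) = y from Prod.ext hy.symm rfl, h]
    simp
  · rintro y hy h
    refine hz.2 (z.2, (σ y).2) ?_
    rw [← h]
    simp [hy]

/-- Outside `blocked`, neither of the two new edges is parallel to any edge and all other edges are
unchanged, so no parallel pair appears, while `(x, x')` disappears. -/
theorem parallel_swap_ssubset {σ : Config m n dv dc} {x x' z : Fin n × Fin dv}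
    (hp : (x, x') ∈ σ.parallel) (hz : z ∉ σ.blocked x) :
    parallel ((Equiv.swap x z).trans σ) ⊂ σ.parallel := by
  obtain ⟨h1, h2⟩ := ne_of_notMem_blocked hz
  obtain ⟨hne, hv, hc⟩ := mem_parallel.1 hp
  simp only at hne hv hc
  have hxz : x ≠ z := fun h => h1 x rfl (by rw [h])
  have hx'z : x' ≠ z := fun h => h1 x rfl (by rw [hc, h])
  have ex : ((Equiv.swap x z).trans σ) x = σ z := by simp
  have ez : ((Equiv.swap x z).trans σ) z = σ x := by simp
  have eo : ∀ y, y ≠ x → y ≠ z → ((Equiv.swap x z).trans σ) y = σ y := by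
    intro y hy hy'
    rw [Equiv.trans_apply, Equiv.swap_apply_of_ne_of_ne hy hy']
  have nx : ∀ q, q ≠ x → q.1 = x.1 → (((Equiv.swap x z).trans σ) q).1 ≠ (σ z).1 := by
    intro q hq hqx
    by_cases hqz : q = z
    · exact absurd rfl (h1 z (by rw [← hqz, hqx]))
    · rw [eo q hq hqz]
      exact h1 q hqx
  have nz : ∀ q, q ≠ z → q.1 = z.1 → (((Equiv.swap x z).trans σ) q).1 ≠ (σ x).1 := by
    intro q hq hqz
    by_cases hqx : q = x
    · exact absurd rfl (h2 x (by rw [← hqz, hqx]))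
    · rw [eo q hqx hq]
      exact h2 q hqz
  rw [Finset.ssubset_iff_of_subset]
  · refine ⟨(x, x'), hp, fun h => ?_⟩
    obtain ⟨-, -, h⟩ := mem_parallel.1 h
    exact nx x' hne.symm hv.symm (by rw [← ex]; exact h.symm)
  · rintro ⟨p, q⟩ hpq
    obtain ⟨hpq0, hpq1, hpq2⟩ := mem_parallel.1 hpq
    simp only at hpq0 hpq1 hpq2
    by_cases hpx : p = x
    · subst hpx
      exact absurd (by rw [← hpq2, ex]) (nx q hpq0.symm hpq1.symm)
    by_cases hqx : q = x
    · subst hqx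
      exact absurd (by rw [hpq2, ex]) (nx p hpq0 hpq1)
    by_cases hpz : p = z
    · subst hpz
      exact absurd (by rw [← hpq2, ez]) (nz q hpq0.symm hpq1.symm)
    by_cases hqz : q = z
    · subst hqz
      exact absurd (by rw [hpq2, ez]) (nz p hpq0 hpq1)
    rw [eo p hpx hpz, eo q hqx hqz] at hpq2
    exact mem_parallel.2 ⟨hpq0, hpq1, hpq2⟩

/-- Each configuration with `k` parallel pairs allows at least `n * dv - 2 * (dv * dc)` switchings,
all of which lower the number of pairs. A switching is recovered from its result, the half-edge `x'`
parallel to the moved half-edge `x`, the index of `x` at its node and the index of its partner at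
the check node; this leaves `n * dv * (dv * dc)` choices. -/
theorem card_parallel_eq_mul_le {k : ℕ} (hk : 0 < k) :
    (Finset.univ.filter fun σ : Config m n dv dc => σ.parallel.card = k).card
        * (n * dv - 2 * (dv * dc))
      ≤ (Finset.univ.filter fun σ : Config m n dv dc => σ.parallel.card < k).card
        * (n * dv * (dv * dc)) := by
  classical
  set S := Finset.univ.filter fun σ : Config m n dv dc => σ.parallel.card = k with hS
  set S' := Finset.univ.filter fun σ : Config m n dv dc => σ.parallel.card < k with hS'
  have hne : ∀ σ ∈ S, ∃ p, p ∈ σ.parallel := by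
    intro σ hσ
    simp only [hS, Finset.mem_filter, Finset.mem_univ, true_and] at hσ
    exact Finset.card_pos.1 (by omega)
  by_cases hX : Nonempty (Fin n × Fin dv)
  swap
  · have : S = ∅ := by
      rw [Finset.eq_empty_iff_forall_notMem]
      intro σ hσ
      obtain ⟨p, -⟩ := hne σ hσ
      exact hX ⟨p.1⟩
    simp [this]
  have : ∃ P : Config m n dv dc → (Fin n × Fin dv) × (Fin n × Fin dv),
      ∀ σ ∈ S, P σ ∈ σ.parallel := by
    choose! P hP using hne
    exact ⟨P, hP⟩
  obtain ⟨P, hP⟩ := this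
  have h1 : S.card * (n * dv - 2 * (dv * dc)) ≤ (S.sigma fun σ => (σ.blocked (P σ).1)ᶜ).card := by
    rw [Finset.card_sigma, ← smul_eq_mul, ← Finset.sum_const]
    refine Finset.sum_le_sum fun σ hσ => ?_
    rw [Finset.card_compl]
    have := σ.card_blocked_le (P σ).1
    simp only [Fintype.card_prod, Fintype.card_fin]
    omega
  have h2 : (S' ×ˢ (Finset.univ : Finset ((Fin n × Fin dv) × (Fin dv × Fin dc)))).card
      = S'.card * (n * dv * (dv * dc)) := by
    simp [Finset.card_product]
  rw [← h2]
  refine h1.trans (Finset.card_le_card_of_injOn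
    (fun p => ((Equiv.swap (P p.1).1 p.2).trans p.1,
      ((P p.1).2, ((P p.1).1.2, (p.1 (P p.1).1).2)))) ?_ ?_)
  · rintro ⟨σ, z⟩ hp
    simp only [Finset.coe_sigma, Set.mem_sigma_iff, Finset.mem_coe, Finset.mem_compl] at hp
    simp only [Finset.coe_product, Set.mem_prod, Finset.mem_coe, Finset.mem_univ, and_true]
    have hlt := Finset.card_lt_card (parallel_swap_ssubset (hP σ hp.1) hp.2)
    simp only [hS, Finset.mem_filter, Finset.mem_univ, true_and] at hp
    simp only [hS', Finset.mem_filter, Finset.mem_univ, true_and]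
    omega
  -- Decoding: `x` sits at the same variable node as `x'`, and after the switching `z` is matched to
  -- a half-edge at the check node to which `x'` is still matched.
  · have hrec : ∀ σ ∈ S, ∀ z ∉ σ.blocked (P σ).1,
        (P σ).1 = ((P σ).2.1, (P σ).1.2) ∧
        ((Equiv.swap (P σ).1 z).trans σ) z
          = ((((Equiv.swap (P σ).1 z).trans σ) (P σ).2).1, (σ (P σ).1).2) := by
      intro σ hσ z hz
      obtain ⟨hne, hv, hc⟩ := mem_parallel.1 (hP σ hσ)
      have h1 := (ne_of_notMem_blocked hz).1
      have hx'z : (P σ).2 ≠ z := fun h => h1 _ rfl (by rw [hc, h])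
      refine ⟨Prod.ext hv rfl, ?_⟩
      rw [Equiv.trans_apply, Equiv.swap_apply_right, Equiv.trans_apply,
        Equiv.swap_apply_of_ne_of_ne hne.symm hx'z, ← hc]
    rintro ⟨σ, z⟩ hp ⟨σ', z'⟩ hp' heq
    simp only [Finset.coe_sigma, Set.mem_sigma_iff, Finset.mem_coe, Finset.mem_compl] at hp hp'
    simp only [Prod.mk.injEq] at heq
    obtain ⟨e1, e2, e3, e4⟩ := heq
    obtain ⟨r1, r2⟩ := hrec σ hp.1 z hp.2
    obtain ⟨r1', r2'⟩ := hrec σ' hp'.1 z' hp'.2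
    have hx : (P σ).1 = (P σ').1 := by rw [r1, r1', e2, e3]
    have hz : z = z' := by
      rw [← e1, ← e2, ← e4, ← r2] at r2'
      exact (Equiv.injective _ r2').symm
    subst hz
    rw [← hx] at e1
    have : σ = σ' := by
      ext1 y
      have := Equiv.congr_fun e1 (Equiv.swap (P σ).1 z y)
      simpa using this
    rw [this]

/-- The constant bounding the inverse of the probability that a configuration is simple. -/
def simplicityConst (dv dc : ℕ) : ℕ :=
  2 * (1 + 2 * (dv * dc)) ^ (4 * (dv * dc)) + (4 * (dv * dc)).factorial

theorem simplicityConst_pos (dv dc : ℕ) : 0 < simplicityConst dv dc :=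
  Nat.add_pos_right _ (Nat.factorial_pos _)

/-- The assumption `hN` makes `n * dv - 2 * (dv * dc)` at least half of `n * dv`, so the factor `n *
dv` cancels in `card_parallel_eq_mul_le` and the ratio is bounded independently of `n`. -/
theorem card_parallel_le_succ (hN : 4 * (dv * dc) ≤ n * dv) (hpos : 0 < dv * dc) (k : ℕ) :
    (Finset.univ.filter fun σ : Config m n dv dc => σ.parallel.card ≤ k + 1).card
      ≤ (1 + 2 * (dv * dc))
        * (Finset.univ.filter fun σ : Config m n dv dc => σ.parallel.card ≤ k).card := by
  classical
  have h := card_parallel_eq_mul_le (m := m) (n := n) (dv := dv) (dc := dc) (k := k + 1)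
    (Nat.succ_pos k)
  simp only [Nat.lt_succ_iff] at h
  set a := (Finset.univ.filter fun σ : Config m n dv dc => σ.parallel.card = k + 1).card
  set b := (Finset.univ.filter fun σ : Config m n dv dc => σ.parallel.card ≤ k).card
  have hsplit : (Finset.univ.filter fun σ : Config m n dv dc => σ.parallel.card ≤ k + 1).card
      ≤ b + a := by
    refine (Finset.card_le_card fun σ hσ => ?_).trans (Finset.card_union_le _ _)
    simp only [Finset.mem_filter, Finset.mem_univ, true_and, Finset.mem_union] at hσ ⊢
    omega
  set q := dv * dc
  set N := n * dv
  have hhalf : a * N ≤ 2 * (a * (N - 2 * q)) :=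
    (Nat.mul_le_mul_left a (by omega : N ≤ 2 * (N - 2 * q))).trans
      (Nat.mul_left_comm a 2 (N - 2 * q)).le
  have : a * N ≤ (2 * q * b) * N := by
    calc a * N ≤ 2 * (b * (N * q)) := hhalf.trans (by gcongr)
      _ = _ := by ring
  have := Nat.le_of_mul_le_mul_right this (by omega)
  calc _ ≤ b + a := hsplit
    _ ≤ b + 2 * q * b := by gcongr
    _ = _ := by ring

theorem card_parallel_le_le (hN : 4 * (dv * dc) ≤ n * dv) (hpos : 0 < dv * dc) (k : ℕ) :
    (Finset.univ.filter fun σ : Config m n dv dc => σ.parallel.card ≤ k).card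
      ≤ (1 + 2 * (dv * dc)) ^ k
        * (Finset.univ.filter fun σ : Config m n dv dc => σ.parallel.card ≤ 0).card := by
  induction k with
  | zero => simp
  | succ k ih =>
    refine (card_parallel_le_succ hN hpos k).trans ?_
    rw [pow_succ', mul_assoc]
    gcongr

/-- Markov's inequality: the mean number of parallel pairs is at most `2 * (dv * dc)`, so at least
half of the configurations have at most twice as many. -/
theorem card_le_two_mul (hN : 4 * (dv * dc) ≤ n * dv) (hpos : 0 < dv * dc) :
    Fintype.card (Config m n dv dc) ≤ 2 *
      (Finset.univ.filter fun σ : Config m n dv dc => σ.parallel.card ≤ 4 * (dv * dc)).card := by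
  classical
  have h := sum_card_parallel_le (m := m) (n := n) (dv := dv) (dc := dc)
  set q := dv * dc
  set N := n * dv
  set M := Fintype.card (Config m n dv dc)
  set s := ∑ σ : Config m n dv dc, σ.parallel.card
  have h1 : s ≤ 2 * q * M := by
    have : s * N ≤ 2 * q * M * N := by
      calc s * N ≤ s * (2 * (N - 1)) := by
            gcongr
            omega
        _ = 2 * (s * (N - 1)) := by ring
        _ ≤ 2 * (N * q * M) := by gcongr
        _ = _ := by ring
    exact Nat.le_of_mul_le_mul_right this (by omega)
  have h2 : (Finset.univ.filter fun σ : Config m n dv dc => ¬ σ.parallel.card ≤ 4 * q).card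
      * (4 * q) ≤ s := by
    rw [← smul_eq_mul, ← Finset.sum_const]
    refine (Finset.sum_le_sum (g := fun σ : Config m n dv dc => σ.parallel.card)
      fun σ hσ => ?_).trans (Finset.sum_le_sum_of_subset (Finset.subset_univ _))
    simp only [Finset.mem_filter, Finset.mem_univ, true_and] at hσ
    omega
  have h3 := Finset.card_filter_add_card_filter_not (s := (Finset.univ : Finset (Config m n dv dc)))
    (fun σ => σ.parallel.card ≤ 4 * q)
  rw [Finset.card_univ] at h3
  set a := (Finset.univ.filter fun σ : Config m n dv dc => ¬ σ.parallel.card ≤ 4 * q).card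
  have h4 : (2 * a) * (2 * q) ≤ M * (2 * q) := by
    calc (2 * a) * (2 * q) = a * (4 * q) := by ring
      _ ≤ 2 * q * M := h2.trans h1
      _ = _ := by ring
  have h5 := Nat.le_of_mul_le_mul_right h4 (by omega)
  omega

open Classical in
/-- The probability that a configuration is simple is bounded away from zero. -/
theorem card_le_simplicityConst_mul (hdv : 0 < dv) (hdc : 0 < dc)
    (hne : ∃ σ : Config m n dv dc, σ.IsSimple) :
    Fintype.card (Config m n dv dc) ≤ simplicityConst dv dc *
      (Finset.univ.filter fun σ : Config m n dv dc => σ.IsSimple).card := by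
  have hpos : 0 < dv * dc := Nat.mul_pos hdv hdc
  rcases le_total (4 * (dv * dc)) (n * dv) with hN | hN
  · have h0 : (Finset.univ.filter fun σ : Config m n dv dc => σ.parallel.card ≤ 0)
        = Finset.univ.filter fun σ : Config m n dv dc => σ.IsSimple := by
      ext σ
      simp [isSimple_iff]
    refine (card_le_two_mul hN hpos).trans ?_
    refine (Nat.mul_le_mul_left 2 (card_parallel_le_le hN hpos _)).trans ?_
    rw [h0, ← mul_assoc]
    gcongr
    exact Nat.le_add_right _ _
  -- For small `n` there are at most `(4 * (dv * dc))!` configurations, so a single simple one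
  -- suffices. This is the second summand of `simplicityConst`.
  · obtain ⟨σ, hσ⟩ := hne
    have h1 : Fintype.card (Config m n dv dc) = (n * dv).factorial := by
      rw [Fintype.card_equiv σ]
      simp
    have h2 : 1 ≤ (Finset.univ.filter fun σ : Config m n dv dc => σ.IsSimple).card :=
      Finset.card_pos.2 ⟨σ, by simpa using hσ⟩
    rw [h1]
    calc (n * dv).factorial ≤ (4 * (dv * dc)).factorial := Nat.factorial_le hN
      _ ≤ simplicityConst dv dc := Nat.le_add_left _ _
      _ ≤ _ := Nat.le_mul_of_pos_right _ h2

end Config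

namespace Config

variable {m n dv dc : ℕ}

/-! ### Simple configurations and biregular graphs -/

theorem mem_checksOf_graph {σ : Config m n dv dc} {v : Fin n} {c : Fin m} :
    c ∈ (ofBiadjacency σ.graph).checksOf v ↔ ∃ i, (σ (v, i)).1 = c := by
  simp [ofBiadjacency, graph]

theorem mem_varsOf_graph {σ : Config m n dv dc} {v : Fin n} {c : Fin m} :
    v ∈ (ofBiadjacency σ.graph).varsOf c ↔ ∃ j, (σ.symm (c, j)).1 = v := by
  rw [← (ofBiadjacency σ.graph).mem_iff, mem_checksOf_graph]
  constructor
  · rintro ⟨i, rfl⟩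
    exact ⟨(σ (v, i)).2, by simp⟩
  · rintro ⟨j, rfl⟩
    exact ⟨(σ.symm (c, j)).2, by simp⟩

theorem checksOf_graph_eq (σ : Config m n dv dc) (v : Fin n) :
    (ofBiadjacency σ.graph).checksOf v = Finset.univ.image fun i => (σ (v, i)).1 := by
  ext c
  simp [mem_checksOf_graph]

theorem varsOf_graph_eq (σ : Config m n dv dc) (c : Fin m) :
    (ofBiadjacency σ.graph).varsOf c = Finset.univ.image fun j => (σ.symm (c, j)).1 := by
  ext v
  simp [mem_varsOf_graph]

theorem degreesLE_graph (σ : Config m n dv dc) : (ofBiadjacency σ.graph).DegreesLE dv dc := by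
  constructor
  · intro v
    rw [checksOf_graph_eq]
    exact Finset.card_image_le.trans (by simp)
  · intro c
    rw [varsOf_graph_eq]
    exact Finset.card_image_le.trans (by simp)

theorem IsSimple.injective_check {σ : Config m n dv dc} (h : σ.IsSimple) (v : Fin n) :
    Function.Injective fun i => (σ (v, i)).1 := by
  intro i i' hi
  have := @h (v, i) (v, i') (Prod.ext rfl hi)
  simpa using this

theorem IsSimple.injective_var {σ : Config m n dv dc} (h : σ.IsSimple) (c : Fin m) :
    Function.Injective fun j => (σ.symm (c, j)).1 := by
  intro j j' hj
  have := @h (σ.symm (c, j)) (σ.symm (c, j')) (Prod.ext hj (by simp))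
  simpa using this

theorem IsSimple.graph_mem {σ : Config m n dv dc} (h : σ.IsSimple) :
    σ.graph ∈ biregularEnsemble m n dv dc := by
  constructor
  · intro v
    rw [checksOf_graph_eq, Finset.card_image_of_injective _ (h.injective_check v)]
    simp
  · intro c
    rw [varsOf_graph_eq, Finset.card_image_of_injective _ (h.injective_var c)]
    simp

/-- Handles the transport between index types in the two inverse laws of `fiberEquiv`. -/
theorem symm_mk_of_eq {ι κ I : Type*} {S : ι → Finset κ} (p : (v : ι) → (I ≃ S v)) {v v' : ι}
    (h : v' = v) (i : I) (hc : (p v i).1 ∈ S v') : (p v').symm ⟨(p v i).1, hc⟩ = i := by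
  subst h
  simp

/-- The simple configurations of a given biregular graph correspond to the orderings of the
neighbourhoods of its nodes. -/
noncomputable def fiberEquiv {A : Fin m → Fin n → Bool} :
    {σ : Config m n dv dc // σ.IsSimple ∧ σ.graph = A} ≃
      ((v : Fin n) → (Fin dv ≃ ((ofBiadjacency A).checksOf v : Finset (Fin m)))) ×
      ((c : Fin m) → (Fin dc ≃ ((ofBiadjacency A).varsOf c : Finset (Fin n)))) where
  toFun σ := ⟨fun v => Equiv.ofBijective
      (fun i => ⟨(σ.1 (v, i)).1, by
        have h := (mem_checksOf_graph (σ := σ.1) (v := v)).2 ⟨i, rfl⟩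
        rwa [σ.2.2] at h⟩)
      ⟨fun i i' h => σ.2.1.injective_check v (congrArg Subtype.val h), fun ⟨c, hc⟩ => by
        rw [← σ.2.2] at hc
        obtain ⟨i, hi⟩ := mem_checksOf_graph.1 hc
        exact ⟨i, Subtype.ext hi⟩⟩,
    fun c => Equiv.ofBijective
      (fun j => ⟨(σ.1.symm (c, j)).1, by
        have h := (mem_varsOf_graph (σ := σ.1) (c := c)).2 ⟨j, rfl⟩
        rwa [σ.2.2] at h⟩)
      ⟨fun i i' h => σ.2.1.injective_var c (congrArg Subtype.val h), fun ⟨v, hv⟩ => by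
        rw [← σ.2.2] at hv
        obtain ⟨j, hj⟩ := mem_varsOf_graph.1 hv
        exact ⟨j, Subtype.ext hj⟩⟩⟩
  invFun p :=
    let σ : Config m n dv dc :=
      { toFun := fun x => ((p.1 x.1 x.2).1, (p.2 (p.1 x.1 x.2).1).symm
          ⟨x.1, ((ofBiadjacency A).mem_iff _ _).1 (p.1 x.1 x.2).2⟩)
        invFun := fun y => ((p.2 y.1 y.2).1, (p.1 (p.2 y.1 y.2).1).symm
          ⟨y.1, ((ofBiadjacency A).mem_iff _ _).2 (p.2 y.1 y.2).2⟩)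
        left_inv := fun x => Prod.ext (by simp) (symm_mk_of_eq p.1 (by simp) _ _)
        right_inv := fun y => Prod.ext (by simp) (symm_mk_of_eq p.2 (by simp) _ _) }
    ⟨σ, by
      constructor
      · rintro ⟨v, i⟩ ⟨v', i'⟩ h
        simp only [Prod.mk.injEq] at h
        obtain ⟨rfl, h⟩ := h
        have := (p.1 v).injective (Subtype.ext h)
        exact Prod.ext rfl this
      · funext c v
        rw [Bool.eq_iff_iff]
        have h1 : σ.graph c v = true ↔ ∃ i, ((p.1 v i).1 : Fin m) = c := by
          simp only [graph, decide_eq_true_eq]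
          rfl
        have h2 : A c v = true ↔ c ∈ (ofBiadjacency A).checksOf v := by
          simp [ofBiadjacency]
        rw [h1, h2]
        constructor
        · rintro ⟨i, rfl⟩
          exact (p.1 v i).2
        · intro hc
          exact ⟨(p.1 v).symm ⟨c, hc⟩, by simp⟩⟩
  left_inv := by
    rintro ⟨σ, hσ, rfl⟩
    apply Subtype.ext
    ext1 x
    refine Prod.ext rfl ?_
    simp only [Equiv.coe_fn_mk]
    rw [Equiv.symm_apply_eq]
    apply Subtype.ext
    change x.1 = (σ.symm ((σ x).1, (σ x).2)).1
    simp
  right_inv := by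
    rintro ⟨p, q⟩
    refine Prod.ext (funext fun v => Equiv.ext fun i => ?_) (funext fun c => Equiv.ext fun j => ?_)
    · rfl
    · rfl

open Classical in
-- The count does not depend on `A`; this is why a uniform simple configuration induces the uniform
-- distribution on biregular graphs.
theorem card_fiber {A : Fin m → Fin n → Bool} (hA : A ∈ biregularEnsemble m n dv dc) :
    (Finset.univ.filter fun σ : Config m n dv dc => σ.IsSimple ∧ σ.graph = A).card
      = dv.factorial ^ n * dc.factorial ^ m := by
  have h1 : ∀ v, Fintype.card (Fin dv ≃ ((ofBiadjacency A).checksOf v : Finset (Fin m)))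
      = dv.factorial := by
    intro v
    rw [Fintype.card_equiv (Fintype.equivOfCardEq (by simp [hA.1 v]))]
    simp
  have h2 : ∀ c, Fintype.card (Fin dc ≃ ((ofBiadjacency A).varsOf c : Finset (Fin n)))
      = dc.factorial := by
    intro c
    rw [Fintype.card_equiv (Fintype.equivOfCardEq (by simp [hA.2 c]))]
    simp
  rw [← Fintype.card_subtype, Fintype.card_congr fiberEquiv, Fintype.card_prod, Fintype.card_pi,
    Fintype.card_pi]
  simp only [h1, h2]
  simp

open Classical in
/-- Summing over the simple configurations amounts to summing over the biregular graphs. -/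
theorem sum_simple_graph (Φ : (Fin m → Fin n → Bool) → ℝ) :
    ∑ σ ∈ Finset.univ.filter (fun σ : Config m n dv dc => σ.IsSimple), Φ σ.graph
      = (dv.factorial ^ n * dc.factorial ^ m : ℕ) *
        ∑ A ∈ (biregularEnsemble m n dv dc).toFinset, Φ A := by
  rw [← Finset.sum_fiberwise_of_maps_to (t := (biregularEnsemble m n dv dc).toFinset)
    (g := fun σ : Config m n dv dc => σ.graph)
    (fun σ hσ => Set.mem_toFinset.2 (Finset.mem_filter.1 hσ).2.graph_mem), Finset.mul_sum]
  refine Finset.sum_congr rfl fun A hA => ?_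
  rw [Finset.filter_filter, Finset.sum_congr rfl (g := fun _ => Φ A)
    (fun σ hσ => by rw [(Finset.mem_filter.1 hσ).2.2]), Finset.sum_const,
    card_fiber (Set.mem_toFinset.1 hA), nsmul_eq_mul]

theorem exists_isSimple (h : (biregularEnsemble m n dv dc).Nonempty) :
    ∃ σ : Config m n dv dc, σ.IsSimple := by
  classical
  obtain ⟨A, hA⟩ := h
  have := card_fiber (m := m) (n := n) hA
  have hpos : 0 < (Finset.univ.filter fun σ : Config m n dv dc =>
      σ.IsSimple ∧ σ.graph = A).card := by
    rw [this]
    positivity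
  obtain ⟨σ, hσ⟩ := Finset.card_pos.1 hpos
  exact ⟨σ, (Finset.mem_filter.1 hσ).2.1⟩

end Config

/-! ## Exploring a configuration along the infinite tree -/

/-- The enumeration of `Fin d` without the element `i`. -/
def skip {d : ℕ} (i : Fin d) (j : Fin (d - 1)) : Fin d :=
  if j.1 < i.1 then ⟨j.1, by omega⟩ else ⟨j.1 + 1, by omega⟩

theorem skip_ne {d : ℕ} (i : Fin d) (j : Fin (d - 1)) : skip i j ≠ i := by
  unfold skip
  split_ifs with h <;> intro h' <;> have := congrArg Fin.val h' <;> simp at this <;> omega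

theorem skip_injective {d : ℕ} (i : Fin d) : Function.Injective (skip i) := by
  intro j j' h
  unfold skip at h
  ext
  split_ifs at h <;> simp at h <;> omega

theorem exists_skip_eq {d : ℕ} {i k : Fin d} (h : k ≠ i) : ∃ j, skip i j = k := by
  have h' : k.1 ≠ i.1 := fun e => h (Fin.ext e)
  rcases lt_or_gt_of_ne h' with hlt | hgt
  · exact ⟨⟨k.1, by omega⟩, by simp [skip, hlt]⟩
  · refine ⟨⟨k.1 - 1, by omega⟩, ?_⟩
    ext
    simp only [skip]
    split_ifs with h1
    · omega
    · change k.1 - 1 + 1 = k.1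
      omega

namespace Config

variable {m n dv dc : ℕ}

/-- The half-edge, at the check node, of the edge from the image of the check node `c` of the tree
to the image of its parent. -/
def checkHalfEdge (σ : Config m n dv dc) (r : Fin n) : TreeCheck dv dc → Fin m × Fin dc
  | .top i => σ (r, i)
  | .deeper c b j =>
    σ ((σ.symm ((checkHalfEdge σ r c).1, skip (checkHalfEdge σ r c).2 b)).1,
      skip (σ.symm ((checkHalfEdge σ r c).1, skip (checkHalfEdge σ r c).2 b)).2 j)

/-- The half-edge at the image of the check node `p.1` that leads to its child number `p.2`. -/
def downHalfEdge (σ : Config m n dv dc) (r : Fin n) (p : TreeCheck dv dc × Fin (dc - 1)) :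
    Fin m × Fin dc :=
  ((checkHalfEdge σ r p.1).1, skip (checkHalfEdge σ r p.1).2 p.2)

/-- The half-edge, at the variable node, of the edge from the image of a variable node of the tree
to the image of its parent. -/
def varHalfEdge (σ : Config m n dv dc) (r : Fin n) (p : TreeCheck dv dc × Fin (dc - 1)) :
    Fin n × Fin dv :=
  σ.symm (downHalfEdge σ r p)

/-- The half-edge at the image of the parent of the check node `c` that leads to `c`. -/
def outHalfEdge (σ : Config m n dv dc) (r : Fin n) : TreeCheck dv dc → Fin n × Fin dv
  | .top i => (r, i)
  | .deeper c b j => ((varHalfEdge σ r (c, b)).1, skip (varHalfEdge σ r (c, b)).2 j)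

/-- The covering map on variable nodes. -/
def coverVar (σ : Config m n dv dc) (r : Fin n) : TreeVar dv dc → Fin n
  | none => r
  | some p => (varHalfEdge σ r p).1

/-- The covering map on check nodes. -/
def coverCheck (σ : Config m n dv dc) (r : Fin n) (c : TreeCheck dv dc) : Fin m :=
  (checkHalfEdge σ r c).1

variable {σ σ' : Config m n dv dc} {r : Fin n}

theorem checkHalfEdge_eq (c : TreeCheck dv dc) : checkHalfEdge σ r c = σ (outHalfEdge σ r c) := by
  cases c <;> rfl

theorem symm_checkHalfEdge (c : TreeCheck dv dc) :
    σ.symm (checkHalfEdge σ r c) = outHalfEdge σ r c := by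
  rw [checkHalfEdge_eq, Equiv.symm_apply_apply]

theorem apply_varHalfEdge (p : TreeCheck dv dc × Fin (dc - 1)) :
    σ (varHalfEdge σ r p) = downHalfEdge σ r p := by
  simp [varHalfEdge]

theorem outHalfEdge_fst (c : TreeCheck dv dc) :
    (outHalfEdge σ r c).1 = coverVar σ r c.parent := by
  cases c <;> rfl

theorem mem_checksOf_tree_some {c c' : TreeCheck dv dc} {b : Fin (dc - 1)} :
    c' ∈ (tree dv dc).checksOf (some (c, b)) ↔ c' = c ∨ ∃ j, TreeCheck.deeper c b j = c' := by
  simp [tree]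

theorem mem_checksOf_tree_none {c' : TreeCheck dv dc} :
    c' ∈ (tree dv dc).checksOf none ↔ ∃ i, TreeCheck.top i = c' := by
  simp [tree]

theorem mem_varsOf_tree {c : TreeCheck dv dc} {v : TreeVar dv dc} :
    v ∈ (tree dv dc).varsOf c ↔ v = c.parent ∨ ∃ b, some (c, b) = v := by
  simp [tree]

/-- The covering map identifies neighbourhoods in the tree with neighbourhoods in the graph of a
simple configuration. -/
theorem IsSimple.localMatch (h : σ.IsSimple) (w : Fin m × Fin n → ℝ) (x : Fin n → ℝ)
    (u : Fin m × Fin n → unitInterval) (v : TreeVar dv dc) :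
    LocalMatch (tree dv dc) (ofBiadjacency σ.graph) (coverVar σ r) (coverCheck σ r)
      (fun e => w (coverCheck σ r e.1, coverVar σ r e.2)) (fun v => x (coverVar σ r v))
      (fun e => u (coverCheck σ r e.1, coverVar σ r e.2)) w x u v where
  weight := fun _ _ _ _ => rfl
  signal_self := rfl
  signal := fun _ _ _ _ => rfl
  tie := fun _ _ => rfl
  checks_inj := by
    intro c hc c' hc' heq
    rw [Finset.mem_coe] at hc hc'
    have hout : ∀ c : TreeCheck dv dc, coverCheck σ r c = (σ (outHalfEdge σ r c)).1 := fun c => by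
      rw [← checkHalfEdge_eq]
      rfl
    rcases v with _ | ⟨c₀, b⟩
    · obtain ⟨i, rfl⟩ := mem_checksOf_tree_none.1 hc
      obtain ⟨i', rfl⟩ := mem_checksOf_tree_none.1 hc'
      rw [h.injective_check r heq]
    -- The parent check is reached through the half-edge by which the node was entered, and the
    -- children through the ones enumerated by `skip`. Together they exhaust the half-edges of the
    -- node without repetition, and simplicity separates their check nodes.
    · have h0 : coverCheck σ r c₀
          = (σ ((varHalfEdge σ r (c₀, b)).1, (varHalfEdge σ r (c₀, b)).2)).1 := by
        change _ = (σ (varHalfEdge σ r (c₀, b))).1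
        rw [apply_varHalfEdge]
        rfl
      rcases mem_checksOf_tree_some.1 hc with rfl | ⟨j, rfl⟩ <;>
        rcases mem_checksOf_tree_some.1 hc' with rfl | ⟨j', rfl⟩
      · rfl
      · rw [h0] at heq
        exact absurd (h.injective_check _ heq).symm (skip_ne _ _)
      · rw [h0] at heq
        exact absurd (h.injective_check _ heq) (skip_ne _ _)
      · rw [skip_injective _ (h.injective_check _ heq)]
  checks_iff := by
    intro c'
    rw [mem_checksOf_graph]
    rcases v with _ | ⟨c₀, b⟩
    · simp only [mem_checksOf_tree_none]
      constructor
      · rintro ⟨i, hi⟩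
        exact ⟨_, ⟨i, rfl⟩, hi⟩
      · rintro ⟨_, ⟨i, rfl⟩, hi⟩
        exact ⟨i, hi⟩
    · have h0 : coverCheck σ r c₀
          = (σ ((varHalfEdge σ r (c₀, b)).1, (varHalfEdge σ r (c₀, b)).2)).1 := by
        change _ = (σ (varHalfEdge σ r (c₀, b))).1
        rw [apply_varHalfEdge]
        rfl
      simp only [mem_checksOf_tree_some]
      constructor
      · rintro ⟨i, hi⟩
        by_cases hi' : i = (varHalfEdge σ r (c₀, b)).2
        · exact ⟨c₀, Or.inl rfl, by rw [h0, ← hi']; exact hi⟩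
        · obtain ⟨j, rfl⟩ := exists_skip_eq hi'
          exact ⟨_, Or.inr ⟨j, rfl⟩, hi⟩
      · rintro ⟨_, rfl | ⟨j, rfl⟩, hi⟩
        · exact ⟨_, by rw [← hi, h0]; rfl⟩
        · exact ⟨_, hi⟩
  vars_inj := by
    intro c _ v hv v' hv' heq
    rw [Finset.mem_coe] at hv hv'
    have h0 : coverVar σ r c.parent
        = (σ.symm ((checkHalfEdge σ r c).1, (checkHalfEdge σ r c).2)).1 := by
      change _ = (σ.symm (checkHalfEdge σ r c)).1
      rw [symm_checkHalfEdge, outHalfEdge_fst]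
    rcases mem_varsOf_tree.1 hv with rfl | ⟨b, rfl⟩ <;>
      rcases mem_varsOf_tree.1 hv' with rfl | ⟨b', rfl⟩
    · rfl
    · rw [h0] at heq
      exact absurd (h.injective_var _ heq).symm (skip_ne _ _)
    · rw [h0] at heq
      exact absurd (h.injective_var _ heq) (skip_ne _ _)
    · have hb : b = b' := skip_injective _ (h.injective_var _ heq)
      rw [hb]
  vars_iff := by
    intro c _ v'
    have h0 : coverVar σ r c.parent
        = (σ.symm ((checkHalfEdge σ r c).1, (checkHalfEdge σ r c).2)).1 := by
      change _ = (σ.symm (checkHalfEdge σ r c)).1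
      rw [symm_checkHalfEdge, outHalfEdge_fst]
    rw [mem_varsOf_graph]
    simp only [mem_varsOf_tree]
    constructor
    · rintro ⟨j, hj⟩
      by_cases hj' : j = (checkHalfEdge σ r c).2
      · exact ⟨_, Or.inl rfl, by rw [h0, ← hj']; exact hj⟩
      · obtain ⟨b, rfl⟩ := exists_skip_eq hj'
        exact ⟨_, Or.inr ⟨b, rfl⟩, hj⟩
    · rintro ⟨_, rfl | ⟨b, rfl⟩, hj⟩
      · exact ⟨_, by rw [← hj, h0]; rfl⟩
      · exact ⟨_, hj⟩

/-- The finite sets of variable and check nodes that can be reached from the root by adding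
neighbours. -/
inductive Explored {dv dc : ℕ} : Finset (TreeVar dv dc) → Finset (TreeCheck dv dc) → Prop
  | root : Explored {none} ∅
  | var {S Q S'} (p : TreeCheck dv dc × Fin (dc - 1)) : Explored S Q → p.1 ∈ Q → some p ∉ S →
      (∀ v, v ∈ S' ↔ v = some p ∨ v ∈ S) → Explored S' Q
  | check {S Q Q'} (c : TreeCheck dv dc) : Explored S Q → c.parent ∈ S → c ∉ Q →
      (∀ c', c' ∈ Q' ↔ c' = c ∨ c' ∈ Q) → Explored S Q'

variable {S : Finset (TreeVar dv dc)} {Q : Finset (TreeCheck dv dc)}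

theorem Explored.closed (h : Explored S Q) :
    none ∈ S ∧ (∀ p, some p ∈ S → p.1 ∈ Q) ∧ ∀ c ∈ Q, c.parent ∈ S := by
  induction h with
  | root => simp
  | var p _ hp _ hS' ih =>
    refine ⟨(hS' _).2 (Or.inr ih.1), fun p' hp' => ?_, fun c hc => (hS' _).2 (Or.inr (ih.2.2 c hc))⟩
    rcases (hS' _).1 hp' with h | h
    · rw [Option.some.inj h]
      exact hp
    · exact ih.2.1 p' h
  | check c _ hc _ hQ' ih =>
    refine ⟨ih.1, fun p hp => (hQ' _).2 (Or.inr (ih.2.1 p hp)), fun c' hc' => ?_⟩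
    rcases (hQ' _).1 hc' with rfl | h
    · exact hc
    · exact ih.2.2 c' h

theorem Explored.exists_check_mem (c : TreeCheck dv dc) : ∀ {S Q}, Explored S Q →
    ∃ S' Q', Explored S' Q' ∧ S ⊆ S' ∧ Q ⊆ Q' ∧ c ∈ Q' := by
  classical
  have hadd : ∀ (c : TreeCheck dv dc) {S Q}, Explored S Q → c.parent ∈ S →
      ∃ S' Q', Explored S' Q' ∧ S ⊆ S' ∧ Q ⊆ Q' ∧ c ∈ Q' := by
    intro c S Q h hc
    by_cases hcQ : c ∈ Q
    · exact ⟨S, Q, h, subset_rfl, subset_rfl, hcQ⟩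
    · exact ⟨S, insert c Q, .check c h hc hcQ fun c' => Finset.mem_insert, subset_rfl,
        Finset.subset_insert _ _, Finset.mem_insert_self _ _⟩
  induction c with
  | top i => exact fun h => hadd _ h h.closed.1
  | deeper c b j ih =>
    intro S Q h
    obtain ⟨S₁, Q₁, h₁, hS₁, hQ₁, hc⟩ := ih h
    by_cases hp : some (c, b) ∈ S₁
    · obtain ⟨S₂, Q₂, h₂, hS₂, hQ₂, hc₂⟩ := hadd (.deeper c b j) h₁ hp
      exact ⟨S₂, Q₂, h₂, hS₁.trans hS₂, hQ₁.trans hQ₂, hc₂⟩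
    · obtain ⟨S₂, Q₂, h₂, hS₂, hQ₂, hc₂⟩ := hadd (.deeper c b j)
        (Explored.var (S' := insert (some (c, b)) S₁) (c, b) h₁ hc hp fun v => Finset.mem_insert)
        (Finset.mem_insert_self _ _)
      exact ⟨S₂, Q₂, h₂, hS₁.trans ((Finset.subset_insert _ _).trans hS₂), hQ₁.trans hQ₂, hc₂⟩

theorem Explored.exists_var_mem (v : TreeVar dv dc) (h : Explored S Q) :
    ∃ S' Q', Explored S' Q' ∧ S ⊆ S' ∧ Q ⊆ Q' ∧ v ∈ S' := by
  classical
  rcases v with _ | p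
  · exact ⟨S, Q, h, subset_rfl, subset_rfl, h.closed.1⟩
  · obtain ⟨S₁, Q₁, h₁, hS₁, hQ₁, hc⟩ := Explored.exists_check_mem p.1 h
    by_cases hp : some p ∈ S₁
    · exact ⟨S₁, Q₁, h₁, hS₁, hQ₁, hp⟩
    · exact ⟨insert (some p) S₁, Q₁, .var p h₁ hc hp fun v => Finset.mem_insert,
        hS₁.trans (Finset.subset_insert _ _), hQ₁, Finset.mem_insert_self _ _⟩

/-- Lets the finite region that the root depends on be built up one node at a time, as the collision
estimate needs. -/
theorem exists_explored_superset (S₀ : Finset (TreeVar dv dc)) (Q₀ : Finset (TreeCheck dv dc)) :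
    ∃ S Q, Explored S Q ∧ S₀ ⊆ S ∧ Q₀ ⊆ Q := by
  classical
  have hQ : ∃ S Q, Explored S Q ∧ Q₀ ⊆ Q := by
    induction Q₀ using Finset.induction_on with
    | empty => exact ⟨_, _, Explored.root, Finset.empty_subset _⟩
    | insert c Q₀ _ ih =>
      obtain ⟨S, Q, h, hQ⟩ := ih
      obtain ⟨S', Q', h', -, hQ', hc⟩ := Explored.exists_check_mem c h
      exact ⟨S', Q', h', Finset.insert_subset hc (hQ.trans hQ')⟩
  induction S₀ using Finset.induction_on with
  | empty =>
    obtain ⟨S, Q, h, hQ⟩ := hQ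
    exact ⟨S, Q, h, Finset.empty_subset _, hQ⟩
  | insert v S₀ _ ih =>
    obtain ⟨S, Q, h, hS, hQ⟩ := ih
    obtain ⟨S₁, Q₁, h₁, hS₁, hQ₁, hv⟩ := Explored.exists_var_mem v h
    exact ⟨S₁, Q₁, h₁, Finset.insert_subset hv (hS.trans hS₁), hQ.trans hQ₁⟩

/-- The covering map is injective on the variable nodes in `S` and on the check nodes in `Q`. -/
def InjectiveOn (σ : Config m n dv dc) (r : Fin n) (S : Finset (TreeVar dv dc))
    (Q : Finset (TreeCheck dv dc)) : Prop :=
  Set.InjOn (coverVar σ r) S ∧ Set.InjOn (coverCheck σ r) Q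

open Classical in
/-- The half-edges, at variable nodes, of the edges explored with `S` and `Q`. -/
noncomputable def usedHalfEdges (σ : Config m n dv dc) (r : Fin n) (S : Finset (TreeVar dv dc))
    (Q : Finset (TreeCheck dv dc)) : Finset (Fin n × Fin dv) :=
  Q.image (outHalfEdge σ r) ∪ S.eraseNone.image (varHalfEdge σ r)

theorem mem_usedHalfEdges {x : Fin n × Fin dv} : x ∈ usedHalfEdges σ r S Q ↔
    (∃ c ∈ Q, outHalfEdge σ r c = x) ∨ ∃ p, some p ∈ S ∧ varHalfEdge σ r p = x := by
  classical
  simp [usedHalfEdges, Finset.mem_eraseNone]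

theorem card_usedHalfEdges_le (h : none ∈ S) :
    (usedHalfEdges σ r S Q).card ≤ S.card + Q.card := by
  classical
  refine (Finset.card_union_le _ _).trans ?_
  rw [add_comm]
  gcongr
  · refine Finset.card_image_le.trans ?_
    rw [Finset.card_eraseNone_of_mem h]
    omega
  · exact Finset.card_image_le

/-- The explored part of the covering map only depends on the explored edges. -/
theorem halfEdges_eq_of_agree (hS : ∀ p, some p ∈ S → p.1 ∈ Q) (hQ : ∀ c ∈ Q, c.parent ∈ S)
    (h : ∀ x ∈ usedHalfEdges σ r S Q, σ' x = σ x) :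
    (∀ c ∈ Q, outHalfEdge σ' r c = outHalfEdge σ r c ∧
      checkHalfEdge σ' r c = checkHalfEdge σ r c) ∧
    ∀ p, some p ∈ S → varHalfEdge σ' r p = varHalfEdge σ r p ∧
      downHalfEdge σ' r p = downHalfEdge σ r p := by
  have hvar : ∀ p, some p ∈ S → checkHalfEdge σ' r p.1 = checkHalfEdge σ r p.1 →
      varHalfEdge σ' r p = varHalfEdge σ r p ∧ downHalfEdge σ' r p = downHalfEdge σ r p := by
    intro p hp hc
    have hd : downHalfEdge σ' r p = downHalfEdge σ r p := by
      simp only [downHalfEdge, hc]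
    refine ⟨?_, hd⟩
    have h1 := h (varHalfEdge σ r p) (mem_usedHalfEdges.2 (Or.inr ⟨p, hp, rfl⟩))
    rw [apply_varHalfEdge, ← hd] at h1
    rw [varHalfEdge, ← h1, Equiv.symm_apply_apply]
  have hcheck : ∀ c ∈ Q, outHalfEdge σ' r c = outHalfEdge σ r c ∧
      checkHalfEdge σ' r c = checkHalfEdge σ r c := by
    intro c
    induction c with
    | top i =>
      intro hc
      refine ⟨rfl, ?_⟩
      rw [checkHalfEdge_eq, checkHalfEdge_eq,
        ← h (outHalfEdge σ r (.top i)) (mem_usedHalfEdges.2 (Or.inl ⟨_, hc, rfl⟩))]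
      rfl
    | deeper c b j ih =>
      intro hc
      have hp : some (c, b) ∈ S := hQ _ hc
      have h1 := hvar _ hp (ih (hS _ hp)).2
      have ho : outHalfEdge σ' r (.deeper c b j) = outHalfEdge σ r (.deeper c b j) := by
        simp only [outHalfEdge, h1.1]
      refine ⟨ho, ?_⟩
      rw [checkHalfEdge_eq, checkHalfEdge_eq, ho,
        ← h (outHalfEdge σ r (.deeper c b j)) (mem_usedHalfEdges.2 (Or.inl ⟨_, hc, rfl⟩))]
  exact ⟨hcheck, fun p hp => hvar p hp (hcheck _ (hS _ hp)).2⟩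

theorem coverVar_eq_of_agree (hS : ∀ p, some p ∈ S → p.1 ∈ Q) (hQ : ∀ c ∈ Q, c.parent ∈ S)
    (h : ∀ x ∈ usedHalfEdges σ r S Q, σ' x = σ x) {v : TreeVar dv dc} (hv : v ∈ S) :
    coverVar σ' r v = coverVar σ r v := by
  rcases v with _ | p
  · rfl
  · simp only [coverVar, ((halfEdges_eq_of_agree hS hQ h).2 p hv).1]

/-- The next half-edge to be matched is fresh. If it had been used, injectivity would identify the
tree nodes at which it sits, and at a single node `skip` separates all half-edges. So switching it
does not disturb the explored part. -/
theorem InjectiveOn.outHalfEdge_notMem (hinj : InjectiveOn σ r S Q)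
    (hQ : ∀ c ∈ Q, c.parent ∈ S) {c : TreeCheck dv dc} (hc : c.parent ∈ S) (hcQ : c ∉ Q) :
    outHalfEdge σ r c ∉ usedHalfEdges σ r S Q := by
  rw [mem_usedHalfEdges]
  rintro (⟨c', hc', heq⟩ | ⟨p, hp, heq⟩)
  · have hpar : c'.parent = c.parent := hinj.1 (hQ c' hc') hc (by
      rw [← outHalfEdge_fst, ← outHalfEdge_fst, heq])
    refine hcQ ?_
    rcases c with i | ⟨c, b, j⟩ <;> rcases c' with i' | ⟨c', b', j'⟩
    · have : i' = i := congrArg Prod.snd heq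
      rwa [← this]
    · simp [TreeCheck.parent] at hpar
    · simp [TreeCheck.parent] at hpar
    · simp only [TreeCheck.parent, Option.some.injEq, Prod.mk.injEq] at hpar
      obtain ⟨rfl, rfl⟩ := hpar
      have := skip_injective _ (congrArg Prod.snd heq)
      rwa [← this]
  · have hpar : some p = c.parent := hinj.1 hp hc (by
      rw [← outHalfEdge_fst, ← heq]
      rfl)
    rcases c with i | ⟨c, b, j⟩
    · simp [TreeCheck.parent] at hpar
    · simp only [TreeCheck.parent, Option.some.injEq] at hpar
      subst hpar
      exact skip_ne _ _ (congrArg Prod.snd heq).symm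

/-- The counterpart of `InjectiveOn.outHalfEdge_notMem` for a half-edge leaving a check node. -/
theorem InjectiveOn.downHalfEdge_notMem (hinj : InjectiveOn σ r S Q)
    (hS : ∀ p, some p ∈ S → p.1 ∈ Q) {p : TreeCheck dv dc × Fin (dc - 1)} (hp : p.1 ∈ Q)
    (hpS : some p ∉ S) : σ.symm (downHalfEdge σ r p) ∉ usedHalfEdges σ r S Q := by
  rw [mem_usedHalfEdges]
  rintro (⟨c, hc, heq⟩ | ⟨p', hp', heq⟩)
  · rw [Equiv.eq_symm_apply, ← checkHalfEdge_eq] at heq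
    have hcp : c = p.1 := hinj.2 hc hp (congrArg (fun y => y.1) heq :)
    subst hcp
    exact skip_ne _ _ (congrArg Prod.snd heq).symm
  · rw [Equiv.eq_symm_apply, apply_varHalfEdge] at heq
    have hcp : p'.1 = p.1 := hinj.2 (hS _ hp') hp (congrArg (fun y => y.1) heq :)
    refine hpS ?_
    obtain ⟨c', b'⟩ := p'
    obtain ⟨c, b⟩ := p
    simp only at hcp
    subst hcp
    have hb : b' = b := skip_injective _ (congrArg Prod.snd heq)
    rwa [← hb]

open Classical in
-- The switched point is the half-edge leading to the new check node, the target set consists of the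
-- half-edges at check nodes already covered, and the excluded points are the used half-edges. As
-- the switching keeps the explored part, point and target stay the same.
theorem card_collision_check_le (r : Fin n) (hS : ∀ p, some p ∈ S → p.1 ∈ Q)
    (hQ : ∀ c ∈ Q, c.parent ∈ S) (h0 : none ∈ S) {c₀ : TreeCheck dv dc} (hc₀ : c₀.parent ∈ S)
    (hc₀Q : c₀ ∉ Q) :
    (Finset.univ.filter fun σ : Config m n dv dc =>
        InjectiveOn σ r S Q ∧ ∃ c ∈ Q, coverCheck σ r c = coverCheck σ r c₀).card
      * (n * dv - (S.card + Q.card)) ≤ Q.card * dc * Fintype.card (Config m n dv dc) := by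
  have hagree : ∀ σ : Config m n dv dc, InjectiveOn σ r S Q → ∀ x ∉ usedHalfEdges σ r S Q,
      ∀ y ∈ usedHalfEdges σ r S Q, ((Equiv.swap (outHalfEdge σ r c₀) x).trans σ) y = σ y := by
    intro σ hσ x hx y hy
    rw [Equiv.trans_apply, Equiv.swap_apply_of_ne_of_ne]
    · rintro rfl
      exact hσ.outHalfEdge_notMem hQ hc₀ hc₀Q hy
    · rintro rfl
      exact hx hy
  have hout : ∀ σ : Config m n dv dc, InjectiveOn σ r S Q → ∀ x ∉ usedHalfEdges σ r S Q,
      outHalfEdge ((Equiv.swap (outHalfEdge σ r c₀) x).trans σ) r c₀ = outHalfEdge σ r c₀ := by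
    intro σ hσ x hx
    have h := (halfEdges_eq_of_agree hS hQ (hagree σ hσ x hx)).2
    rcases c₀ with i | ⟨c, b, j⟩
    · rfl
    · change ((varHalfEdge _ r (c, b)).1, skip (varHalfEdge _ r (c, b)).2 j) = _
      rw [(h (c, b) hc₀).1]
      rfl
  have := card_mul_le_of_switching
    (Finset.univ.filter fun σ : Config m n dv dc =>
      InjectiveOn σ r S Q ∧ ∃ c ∈ Q, coverCheck σ r c = coverCheck σ r c₀)
    (fun σ => outHalfEdge σ r c₀)
    (fun σ => (Q ×ˢ (Finset.univ : Finset (Fin dc))).image fun q => (coverCheck σ r q.1, q.2))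
    (fun σ => usedHalfEdges σ r S Q) (Q.card * dc) (S.card + Q.card)
    (fun σ => Finset.card_image_le.trans (by simp)) (fun σ _ => card_usedHalfEdges_le h0)
    (fun σ hσ => by
      obtain ⟨-, c, hc, heq⟩ := (Finset.mem_filter.1 hσ).2
      rw [← checkHalfEdge_eq]
      exact Finset.mem_image.2 ⟨(c, (checkHalfEdge σ r c₀).2), by simp [hc],
        Prod.ext heq rfl⟩)
    (fun σ hσ x hx => hout σ (Finset.mem_filter.1 hσ).2.1 x hx)
    (fun σ hσ x hx => by
      refine Finset.image_congr fun q hq => ?_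
      simp only [Finset.coe_product, Set.mem_prod, Finset.mem_coe] at hq
      have := ((halfEdges_eq_of_agree hS hQ (hagree σ (Finset.mem_filter.1 hσ).2.1 x hx)).1
        q.1 hq.1).2
      simp only [coverCheck, this])
  simpa using this

open Classical in
-- Same argument as for check nodes, applied to the inverse bijections, since the half-edge being
-- matched now lies on the check side.
theorem card_collision_var_le (r : Fin n) (hS : ∀ p, some p ∈ S → p.1 ∈ Q)
    (hQ : ∀ c ∈ Q, c.parent ∈ S) (h0 : none ∈ S) {p₀ : TreeCheck dv dc × Fin (dc - 1)}
    (hp₀ : p₀.1 ∈ Q) (hp₀S : some p₀ ∉ S) :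
    (Finset.univ.filter fun σ : Config m n dv dc =>
        InjectiveOn σ r S Q ∧ ∃ v ∈ S, coverVar σ r v = coverVar σ r (some p₀)).card
      * (n * dv - (S.card + Q.card)) ≤ S.card * dv * Fintype.card (Config m n dv dc) := by
  have hagree : ∀ σ : Config m n dv dc, InjectiveOn σ r S Q →
      ∀ y ∉ (usedHalfEdges σ r S Q).image σ, ∀ x ∈ usedHalfEdges σ r S Q,
      ((Equiv.swap (downHalfEdge σ r p₀) y).trans σ.symm).symm x = σ x := by
    intro σ hσ y hy x hx
    rw [Equiv.symm_apply_eq, Equiv.trans_apply, Equiv.swap_apply_of_ne_of_ne]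
    · simp
    · intro h
      refine hσ.downHalfEdge_notMem hS hp₀ hp₀S ?_
      rw [← h]
      simpa using hx
    · rintro rfl
      exact hy (Finset.mem_image_of_mem _ hx)
  have hdown : ∀ σ : Config m n dv dc, InjectiveOn σ r S Q →
      ∀ y ∉ (usedHalfEdges σ r S Q).image σ,
      downHalfEdge ((Equiv.swap (downHalfEdge σ r p₀) y).trans σ.symm).symm r p₀
        = downHalfEdge σ r p₀ := by
    intro σ hσ y hy
    have h := ((halfEdges_eq_of_agree hS hQ (hagree σ hσ y hy)).1 p₀.1 hp₀).2
    unfold downHalfEdge at h ⊢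
    rw [h]
  set B := Finset.univ.filter fun σ : Config m n dv dc =>
    InjectiveOn σ r S Q ∧ ∃ v ∈ S, coverVar σ r v = coverVar σ r (some p₀) with hB
  have hmem : ∀ τ ∈ B.image Equiv.symm, τ.symm ∈ B := by
    intro τ hτ
    obtain ⟨σ, hσ, rfl⟩ := Finset.mem_image.1 hτ
    simpa using hσ
  have hinj : ∀ τ ∈ B.image Equiv.symm, InjectiveOn τ.symm r S Q := fun τ hτ =>
    (Finset.mem_filter.1 (hmem τ hτ)).2.1
  have key := card_mul_le_of_switching (B.image Equiv.symm)
    (fun τ => downHalfEdge τ.symm r p₀)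
    (fun τ => (S ×ˢ (Finset.univ : Finset (Fin dv))).image fun q => (coverVar τ.symm r q.1, q.2))
    (fun τ => (usedHalfEdges τ.symm r S Q).image τ.symm) (S.card * dv) (S.card + Q.card)
    (fun τ => Finset.card_image_le.trans (by simp))
    (fun τ _ => Finset.card_image_le.trans (card_usedHalfEdges_le h0))
    (fun τ hτ => by
      obtain ⟨-, v, hv, heq⟩ := (Finset.mem_filter.1 (hmem τ hτ)).2
      refine Finset.mem_image.2 ⟨(v, (τ (downHalfEdge τ.symm r p₀)).2), by simp [hv], ?_⟩
      refine Prod.ext (heq.trans ?_) rfl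
      simp [coverVar, varHalfEdge])
    (fun τ hτ y hy => hdown τ.symm (hinj τ hτ) y hy)
    (fun τ hτ y hy => by
      refine Finset.image_congr fun q hq => ?_
      simp only [Finset.coe_product, Set.mem_prod, Finset.mem_coe] at hq
      have := coverVar_eq_of_agree hS hQ (hagree τ.symm (hinj τ hτ) y hy) hq.1
      simp only [Equiv.symm_symm] at this
      simp only [this])
  rw [Finset.card_image_of_injective _ Equiv.symm_bijective.injective] at key
  -- `key` counts half-edges at check nodes; any configuration shows that there are equally many at
  -- variable nodes.
  rcases isEmpty_or_nonempty (Config m n dv dc) with hE | ⟨⟨σ₀⟩⟩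
  · have : B = ∅ := Finset.eq_empty_of_isEmpty _
    simp [this]
  · rw [← Fintype.card_congr σ₀, ← Fintype.card_congr (Equiv.symmEquiv _ _)] at key
    simpa using key

open Classical in
/-- The covering map is injective on a finite part of the tree, up to a probability of order
`1 / n`. -/
theorem card_not_injectiveOn_le (r : Fin n) (h : Explored S Q) :
    ∀ k, S.card + Q.card ≤ k →
    (Finset.univ.filter fun σ : Config m n dv dc => ¬ InjectiveOn σ r S Q).card * (n * dv - k)
      ≤ (S.card + Q.card) * (k * (dv + dc) * Fintype.card (Config m n dv dc)) := by
  -- `k` is a bound for the final size, so all steps share the denominator `n * dv - k`. Each added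
  -- node contributes a collision probability of at most `k * (dv + dc)` over it.
  induction h with
  | root =>
    intro k _
    simp [InjectiveOn]
  | @var S Q S' p hSQ hp hpS hS' ih =>
    intro k hk
    obtain ⟨h0, hS, hQ⟩ := hSQ.closed
    obtain rfl : S' = insert (some p) S := by
      ext v
      rw [hS', Finset.mem_insert]
    rw [Finset.card_insert_of_notMem hpS] at hk ⊢
    have hsub : (Finset.univ.filter fun σ : Config m n dv dc =>
        ¬ InjectiveOn σ r (insert (some p) S) Q)
        ⊆ (Finset.univ.filter fun σ : Config m n dv dc => ¬ InjectiveOn σ r S Q) ∪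
          Finset.univ.filter fun σ : Config m n dv dc => InjectiveOn σ r S Q ∧
            ∃ v ∈ S, coverVar σ r v = coverVar σ r (some p) := by
      intro σ hσ
      simp only [Finset.mem_filter, Finset.mem_univ, true_and, Finset.mem_union] at hσ ⊢
      by_contra hcon
      simp only [not_or, not_not, not_and] at hcon
      refine hσ ⟨?_, hcon.1.2⟩
      rw [Finset.coe_insert, Set.injOn_insert (by simpa using hpS)]
      refine ⟨hcon.1.1, ?_⟩
      rintro ⟨v, hv, heq⟩
      exact hcon.2 hcon.1 ⟨v, hv, heq⟩
    have h1 := ih k (by omega)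
    have h2 := card_collision_var_le (m := m) r hS hQ h0 hp hpS
    have h3 : n * dv - k ≤ n * dv - (S.card + Q.card) := by omega
    have h4 : S.card * dv ≤ k * (dv + dc) := Nat.mul_le_mul (by omega) (by omega)
    refine (Nat.mul_le_mul_right _ ((Finset.card_le_card hsub).trans
      (Finset.card_union_le _ _))).trans ?_
    rw [add_mul]
    refine (Nat.add_le_add h1 ((Nat.mul_le_mul_left _ h3).trans
      (h2.trans (Nat.mul_le_mul_right _ h4)))).trans (le_of_eq ?_)
    ring
  | @check S Q Q' c hSQ hc hcQ hQ' ih =>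
    intro k hk
    obtain ⟨h0, hS, hQ⟩ := hSQ.closed
    obtain rfl : Q' = insert c Q := by
      ext v
      rw [hQ', Finset.mem_insert]
    rw [Finset.card_insert_of_notMem hcQ] at hk ⊢
    have hsub : (Finset.univ.filter fun σ : Config m n dv dc =>
        ¬ InjectiveOn σ r S (insert c Q))
        ⊆ (Finset.univ.filter fun σ : Config m n dv dc => ¬ InjectiveOn σ r S Q) ∪
          Finset.univ.filter fun σ : Config m n dv dc => InjectiveOn σ r S Q ∧
            ∃ c' ∈ Q, coverCheck σ r c' = coverCheck σ r c := by
      intro σ hσ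
      simp only [Finset.mem_filter, Finset.mem_univ, true_and, Finset.mem_union] at hσ ⊢
      by_contra hcon
      simp only [not_or, not_not, not_and] at hcon
      refine hσ ⟨hcon.1.1, ?_⟩
      rw [Finset.coe_insert, Set.injOn_insert (by simpa using hcQ)]
      refine ⟨hcon.1.2, ?_⟩
      rintro ⟨v, hv, heq⟩
      exact hcon.2 hcon.1 ⟨v, hv, heq⟩
    have h1 := ih k (by omega)
    have h2 := card_collision_check_le (m := m) r hS hQ h0 hc hcQ
    have h3 : n * dv - k ≤ n * dv - (S.card + Q.card) := by omega
    have h4 : Q.card * dc ≤ k * (dv + dc) := Nat.mul_le_mul (by omega) (by omega)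
    refine (Nat.mul_le_mul_right _ ((Finset.card_le_card hsub).trans
      (Finset.card_union_le _ _))).trans ?_
    rw [add_mul]
    refine (Nat.add_le_add h1 ((Nat.mul_le_mul_left _ h3).trans
      (h2.trans (Nat.mul_le_mul_right _ h4)))).trans (le_of_eq ?_)
    ring

end Config

/-! ## Restriction of the random input to finitely many nodes -/

theorem isProbabilityMeasure_signalElementLaw (g : Measure ℝ) [IsProbabilityMeasure g] {α : ℝ}
    (hα : α ∈ Set.Icc (0 : ℝ) 1) : IsProbabilityMeasure (signalElementLaw g α) := by
  constructor
  simp only [signalElementLaw, Measure.coe_add, Measure.coe_smul, Pi.add_apply, Pi.smul_apply,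
    measure_univ, smul_eq_mul, mul_one]
  rw [← ENNReal.ofReal_add hα.1 (by linarith [hα.2])]
  simp

/-- Distinct coordinates of an i.i.d. family are again i.i.d. -/
theorem map_infinitePi_of_injective {ι κ E : Type*} [Fintype ι] [MeasurableSpace E]
    (μ : Measure E) [IsProbabilityMeasure μ] {θ : ι → κ} (hθ : Function.Injective θ) :
    (Measure.infinitePi fun _ : κ => μ).map (fun ω i => ω (θ i)) = Measure.pi fun _ => μ := by
  have h := (iIndepFun_infinitePi (P := fun _ : κ => μ) (X := fun _ ω => ω)
    (fun _ => measurable_id)).precomp hθ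
  rw [iIndepFun_iff_map_fun_eq_pi_map (fun i => (measurable_pi_apply (θ i)).aemeasurable)] at h
  rw [h]
  congr 1
  funext i
  exact Measure.infinitePi_map_eval _ _

variable {V' C' V C : Type}

/-- The input read along the maps `φ` and `ψ`. -/
def pullInput (φ : V → V') (ψ : C → C')
    (ω : (C' × V' → ℝ) × (V' → ℝ) × (C' × V' → unitInterval)) :
    (C × V → ℝ) × (V → ℝ) × (C × V → unitInterval) :=
  (fun e => ω.1 (ψ e.1, φ e.2), fun v => ω.2.1 (φ v), fun e => ω.2.2 (ψ e.1, φ e.2))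

/-- The restriction of the input to finite sets of variable and check nodes. -/
def restrictInput (S : Finset V) (Q : Finset C)
    (ω : (C × V → ℝ) × (V → ℝ) × (C × V → unitInterval)) :
    ((Q ×ˢ S : Finset (C × V)) → ℝ) × (S → ℝ) × ((Q ×ˢ S : Finset (C × V)) → unitInterval) :=
  (fun e => ω.1 e.1, fun v => ω.2.1 v.1, fun e => ω.2.2 e.1)

open Classical in
/-- The extension by zero of a restricted input. -/
noncomputable def extendInput (S : Finset V) (Q : Finset C)
    (ω : ((Q ×ˢ S : Finset (C × V)) → ℝ) × (S → ℝ) ×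
      ((Q ×ˢ S : Finset (C × V)) → unitInterval)) :
    (C × V → ℝ) × (V → ℝ) × (C × V → unitInterval) :=
  (fun e => if h : e ∈ Q ×ˢ S then ω.1 ⟨e, h⟩ else 0,
    fun v => if h : v ∈ S then ω.2.1 ⟨v, h⟩ else 0,
    fun e => if h : e ∈ Q ×ˢ S then ω.2.2 ⟨e, h⟩ else 0)

theorem measurable_extendInput (S : Finset V) (Q : Finset C) :
    Measurable (extendInput S Q) := by
  classical
  refine Measurable.prodMk ?_ (Measurable.prodMk ?_ ?_)
  · refine measurable_pi_lambda _ fun e => ?_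
    by_cases h : e ∈ Q ×ˢ S
    · simp only [h, dif_pos]
      fun_prop
    · simp only [h, dif_neg, not_false_eq_true]
      fun_prop
  · refine measurable_pi_lambda _ fun e => ?_
    by_cases h : e ∈ S
    · simp only [h, dif_pos]
      fun_prop
    · simp only [h, dif_neg, not_false_eq_true]
      fun_prop
  · refine measurable_pi_lambda _ fun e => ?_
    by_cases h : e ∈ Q ×ˢ S
    · simp only [h, dif_pos]
      fun_prop
    · simp only [h, dif_neg, not_false_eq_true]
      fun_prop

/-- Along maps that are injective on finite sets of nodes, the restricted input has the law of
independent variables. -/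
theorem map_restrictInput_pullInput (f g : Measure ℝ) [IsProbabilityMeasure f]
    [IsProbabilityMeasure g] {α : ℝ} (hα : α ∈ Set.Icc (0 : ℝ) 1) {φ : V → V'} {ψ : C → C'}
    {S : Finset V} {Q : Finset C} (hφ : Set.InjOn φ S) (hψ : Set.InjOn ψ Q) :
    (inputLaw V' C' f g α).map (fun ω => restrictInput S Q (pullInput φ ψ ω)) =
      (Measure.pi fun _ => f).prod ((Measure.pi fun _ => signalElementLaw g α).prod
        (Measure.pi fun _ => volume)) := by
  have := isProbabilityMeasure_signalElementLaw g hα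
  have hedge : Function.Injective fun e : (Q ×ˢ S : Finset (C × V)) => (ψ e.1.1, φ e.1.2) := by
    rintro ⟨⟨c, v⟩, he⟩ ⟨⟨c', v'⟩, he'⟩ h
    rw [Finset.mem_product] at he he'
    simp only [Prod.mk.injEq] at h
    have h1 := hψ he.1 he'.1 h.1
    have h2 := hφ he.2 he'.2 h.2
    simp only at h1 h2
    subst h1 h2
    rfl
  have hvar : Function.Injective fun v : S => φ v.1 := fun v v' h =>
    Subtype.ext (hφ v.2 v'.2 h)
  rw [← map_infinitePi_of_injective f hedge,
    ← map_infinitePi_of_injective (signalElementLaw g α) hvar,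
    ← map_infinitePi_of_injective (volume : Measure unitInterval) hedge,
    Measure.map_prod_map _ _ (by fun_prop) (by fun_prop),
    Measure.map_prod_map _ _ (by fun_prop) (by fun_prop)]
  rfl

/-- An event that only depends on the input at finitely many nodes has the same probability when
the input is read along maps that are injective on these nodes. -/
theorem inputLaw_pullInput (f g : Measure ℝ) [IsProbabilityMeasure f] [IsProbabilityMeasure g]
    {α : ℝ} (hα : α ∈ Set.Icc (0 : ℝ) 1) {φ : V → V'} {ψ : C → C'}
    {S : Finset V} {Q : Finset C} (hφ : Set.InjOn φ S) (hψ : Set.InjOn ψ Q)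
    {B : Set ((C × V → ℝ) × (V → ℝ) × (C × V → unitInterval))} (hB : MeasurableSet B)
    (hdep : ∀ z z', restrictInput S Q z = restrictInput S Q z' → (z ∈ B ↔ z' ∈ B)) :
    (inputLaw V' C' f g α) (pullInput φ ψ ⁻¹' B) = (inputLaw V C f g α) B := by
  -- Since membership in `B` depends only on the restricted input, `B` is the preimage of `R` under
  -- restriction. Extension by zero is just a measurable way to choose a representative.
  set R := extendInput S Q ⁻¹' B with hR
  have hRm : MeasurableSet R := measurable_extendInput S Q hB
  have hext : ∀ z, restrictInput S Q (extendInput S Q (restrictInput S Q z))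
      = restrictInput S Q z := by
    intro z
    simp only [restrictInput, extendInput]
    refine Prod.ext ?_ (Prod.ext ?_ ?_)
    · funext e
      exact dif_pos e.2
    · funext e
      exact dif_pos e.2
    · funext e
      exact dif_pos e.2
  have hmem : ∀ z, z ∈ B ↔ restrictInput S Q z ∈ R := fun z =>
    (hdep _ _ (hext z)).symm
  have h1 : pullInput φ ψ ⁻¹' B = (fun ω => restrictInput S Q (pullInput φ ψ ω)) ⁻¹' R := by
    ext ω
    exact hmem _
  have h2 : B = (fun ω => restrictInput S Q (pullInput (id : V → V) (id : C → C) ω)) ⁻¹' R := by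
    ext ω
    exact hmem _
  have hm : ∀ {V' C' : Type} (φ : V → V') (ψ : C → C'),
      Measurable fun ω => restrictInput S Q (pullInput φ ψ ω) := by
    intro V' C' φ ψ
    unfold restrictInput pullInput
    fun_prop
  rw [h1, ← Measure.map_apply (hm φ ψ) hRm, map_restrictInput_pullInput f g hα hφ hψ]
  conv_rhs => rw [h2]
  rw [← Measure.map_apply (hm id id) hRm,
    map_restrictInput_pullInput f g hα Function.injective_id.injOn Function.injective_id.injOn]

/-! ### Comparing a node of the graph with the root of the tree -/

section Tree

variable (dv dc ℓ : ℕ)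

open Classical in
/-- The check nodes of the tree that matter for the root in the first iterations. -/
noncomputable def rootChecks : Finset (TreeCheck dv dc) :=
  ((tree dv dc).near (2 * ℓ) none).biUnion (tree dv dc).checksOf

open Classical in
/-- The variable nodes of the tree that matter for the root in the first iterations. -/
noncomputable def rootVars : Finset (TreeVar dv dc) :=
  (tree dv dc).near (2 * ℓ) none ∪ (rootChecks dv dc ℓ).biUnion (tree dv dc).varsOf

variable {dv dc ℓ}

theorem isUnverifiedNonzero_root_iff (alg : Algorithm)
    {z z' : (TreeCheck dv dc × TreeVar dv dc → ℝ) × (TreeVar dv dc → ℝ) ×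
      (TreeCheck dv dc × TreeVar dv dc → unitInterval)}
    (h : restrictInput (rootVars dv dc ℓ) (rootChecks dv dc ℓ) z
      = restrictInput (rootVars dv dc ℓ) (rootChecks dv dc ℓ) z') :
    IsUnverifiedNonzero (tree dv dc) z.1 z.2.1 z.2.2 alg ℓ none ↔
      IsUnverifiedNonzero (tree dv dc) z'.1 z'.2.1 z'.2.2 alg ℓ none := by
  classical
  have hw : ∀ c ∈ rootChecks dv dc ℓ, ∀ v ∈ rootVars dv dc ℓ, z.1 (c, v) = z'.1 (c, v) :=
    fun c hc v hv => congrFun (congrArg Prod.fst h) ⟨(c, v), Finset.mem_product.2 ⟨hc, hv⟩⟩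
  have hx : ∀ v ∈ rootVars dv dc ℓ, z.2.1 v = z'.2.1 v :=
    fun v hv => congrFun (congrArg (fun y => y.2.1) h) ⟨v, hv⟩
  have hu : ∀ c ∈ rootChecks dv dc ℓ, ∀ v ∈ rootVars dv dc ℓ, z.2.2 (c, v) = z'.2.2 (c, v) :=
    fun c hc v hv => congrFun (congrArg (fun y => y.2.2) h)
      ⟨(c, v), Finset.mem_product.2 ⟨hc, hv⟩⟩
  refine isUnverifiedNonzero_iff_of_agree_near alg ℓ none fun v hv => ?_
  have hc : ∀ c ∈ (tree dv dc).checksOf v, c ∈ rootChecks dv dc ℓ := fun c hc =>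
    Finset.mem_biUnion.2 ⟨v, hv, hc⟩
  have hv' : ∀ c ∈ (tree dv dc).checksOf v, ∀ y ∈ (tree dv dc).varsOf c,
      y ∈ rootVars dv dc ℓ := fun c hcv y hy =>
    Finset.mem_union_right _ (Finset.mem_biUnion.2 ⟨c, hc c hcv, hy⟩)
  have hvS : v ∈ rootVars dv dc ℓ := Finset.mem_union_left _ hv
  exact Agree.of_eq rfl (fun _ _ => rfl) (fun c hcv y hy => hw c (hc c hcv) y (hv' c hcv y hy))
    (hx v hvS) (fun c hcv y hy => hx y (hv' c hcv y hy)) (fun c hcv => hu c (hc c hcv) v hvS)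

/-- The covering map turns the event into the tree event for the pulled-back input, whatever the
cycles of the graph. Injectivity enters only through the law: it prevents one input variable from
being read at two relevant places of the tree. -/
theorem Config.IsSimple.real_isUnverifiedNonzero_eq {m n : ℕ} {σ : Config m n dv dc}
    (hσ : σ.IsSimple) {r : Fin n} {S : Finset (TreeVar dv dc)} {Q : Finset (TreeCheck dv dc)}
    (hS : rootVars dv dc ℓ ⊆ S) (hQ : rootChecks dv dc ℓ ⊆ Q) (hinj : σ.InjectiveOn r S Q)
    (alg : Algorithm) (f g : Measure ℝ) [IsProbabilityMeasure f] [IsProbabilityMeasure g]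
    {α : ℝ} (hα : α ∈ Set.Icc (0 : ℝ) 1) :
    (inputLaw (Fin n) (Fin m) f g α).real {ω |
        IsUnverifiedNonzero (ofBiadjacency σ.graph) ω.1 ω.2.1 ω.2.2 alg ℓ r}
      = cycleFreeValue alg dv dc ℓ f g α := by
  have hcover : ∀ ω : (Fin m × Fin n → ℝ) × (Fin n → ℝ) × (Fin m × Fin n → unitInterval),
      IsUnverifiedNonzero (ofBiadjacency σ.graph) ω.1 ω.2.1 ω.2.2 alg ℓ r ↔
        pullInput (σ.coverVar r) (σ.coverCheck r) ω ∈ {z : (TreeCheck dv dc × TreeVar dv dc → ℝ) ×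
          (TreeVar dv dc → ℝ) × (TreeCheck dv dc × TreeVar dv dc → unitInterval) |
          IsUnverifiedNonzero (tree dv dc) z.1 z.2.1 z.2.2 alg ℓ none} := by
    intro ω
    have := status_eq_of_localMatch (fun v => hσ.localMatch (r := r) ω.1 ω.2.1 ω.2.2 v) alg ℓ none
    change _ ∧ _ ↔ _ ∧ _
    rw [show status (ofBiadjacency σ.graph) ω.1 ω.2.1 ω.2.2 alg ℓ r = _ from this]
    rfl
  unfold cycleFreeValue Measure.real
  rw [← inputLaw_pullInput f g hα (hinj.1.mono (Finset.coe_subset.2 hS))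
    (hinj.2.mono (Finset.coe_subset.2 hQ))
    (measurableSet_isUnverifiedNonzero (tree dv dc) alg ℓ none)
    (fun z z' h => isUnverifiedNonzero_root_iff alg h)]
  congr 2
  ext ω
  exact hcover ω

end Tree

/-! ## Concentration -/

theorem GaussianMoments.mono {Ω : Type*} [MeasurableSpace Ω] {μ : Measure Ω} {f : Ω → ℝ}
    {V V' : ℝ} (h : GaussianMoments μ f V) (hV : V ≤ V') : GaussianMoments μ f V' :=
  fun t => (h t).trans (Real.exp_le_exp.2 (by gcongr))

theorem abs_integral_sub_integral_le {Ω : Type*} [MeasurableSpace Ω] {μ : Measure Ω}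
    [IsProbabilityMeasure μ] {f g : Ω → ℝ} {B c : ℝ} (hf : Measurable f) (hg : Measurable g)
    (hfB : ∀ z, |f z| ≤ B) (hgB : ∀ z, |g z| ≤ B) (h : ∀ z, |f z - g z| ≤ c) :
    |∫ z, f z ∂μ - ∫ z, g z ∂μ| ≤ c := by
  rw [← integral_sub (integrable_of_bounded hf hfB) (integrable_of_bounded hg hgB)]
  exact abs_integral_le_of_bounded h

section Input

variable {m n dv dc : ℕ}

theorem unverifiedFraction_mem_Icc (alg : Algorithm) (ℓ : ℕ)
    (T : (Fin m → Fin n → Bool) ×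
      ((Fin m × Fin n → ℝ) × (Fin n → ℝ) × (Fin m × Fin n → unitInterval))) :
    unverifiedFraction alg ℓ T ∈ Set.Icc (0 : ℝ) 1 := by
  classical
  unfold unverifiedFraction
  refine ⟨by positivity, div_le_one_of_le₀ ?_ (by positivity)⟩
  exact_mod_cast (Finset.card_filter_le _ _).trans (by simp)

theorem abs_unverifiedFraction_le (alg : Algorithm) (ℓ : ℕ)
    (T : (Fin m → Fin n → Bool) ×
      ((Fin m × Fin n → ℝ) × (Fin n → ℝ) × (Fin m × Fin n → unitInterval))) :
    |unverifiedFraction alg ℓ T| ≤ 1 := by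
  have := unverifiedFraction_mem_Icc alg ℓ T
  rw [abs_of_nonneg this.1]
  exact this.2

/-- A bound for `n` times the change of the fraction of unverified nonzero variable nodes when one
variable is changed. -/
def influence (dv dc ℓ : ℕ) : ℝ := (dv * dc + 1) ^ (2 * ℓ + 1)

theorem influence_pos (dv dc ℓ : ℕ) : 0 < influence dv dc ℓ := by
  unfold influence
  positivity

theorem card_mul_div_le_influence {ℓ k j : ℕ} (h : k ≤ j * (dv * dc + 1)) :
    (k : ℝ) * (dv * dc + 1) ^ (2 * ℓ) / n ≤ j * (influence dv dc ℓ / n) := by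
  rw [← mul_div_assoc]
  unfold influence
  rw [pow_succ', ← mul_assoc]
  have : (k : ℝ) ≤ j * (dv * dc + 1) := by exact_mod_cast h
  exact div_le_div_of_nonneg_right (mul_le_mul_of_nonneg_right this (by positivity))
    n.cast_nonneg

variable {A : Fin m → Fin n → Bool}

/-- The value at `v` enters the measurements at its checks, so it is seen exactly by the nodes of
`nbr v`. -/
theorem abs_sub_le_of_update_signal (hA : (ofBiadjacency A).DegreesLE dv dc)
    (alg : Algorithm) (ℓ : ℕ) (w : Fin m × Fin n → ℝ)
    (x : Fin n → ℝ) (u : Fin m × Fin n → unitInterval) (v : Fin n) (a : ℝ) :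
    |unverifiedFraction alg ℓ (A, (w, Function.update x v a, u))
      - unverifiedFraction alg ℓ (A, (w, x, u))| ≤ influence dv dc ℓ / n := by
  set G := ofBiadjacency A
  refine (abs_unverifiedFraction_sub_le alg ℓ hA (G.nbr v) fun v' hv' => ?_).trans
    ((card_mul_div_le_influence (j := 1) (by rw [one_mul]; exact G.card_nbr_le hA v)).trans
      (by simp))
  have hne : ∀ c ∈ G.checksOf v', ∀ z ∈ G.varsOf c, z ≠ v := by
    rintro c hc z hz rfl
    exact hv' ((G.mem_nbr).2 (Or.inr ⟨c, (G.mem_iff _ _).2 hz, (G.mem_iff _ _).1 hc⟩))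
  refine Agree.of_eq rfl (fun _ _ => rfl) (fun _ _ _ _ => rfl) ?_
    (fun c hc z hz => Function.update_of_ne (hne c hc z hz) _ _) (fun _ _ => rfl)
  exact Function.update_of_ne (fun h => hv' (by rw [h]; exact G.self_mem_nbr v)) _ _

/-- Weights are attached to all `m * n` pairs, but those off the edges are never read. The bound 0
for them keeps the total variance of order `1 / n`. -/
theorem abs_sub_le_of_update_weight (hA : (ofBiadjacency A).DegreesLE dv dc) (hdv : 0 < dv)
    (alg : Algorithm) (ℓ : ℕ) (w : Fin m × Fin n → ℝ)
    (x : Fin n → ℝ) (u : Fin m × Fin n → unitInterval) (e : Fin m × Fin n) (a : ℝ) :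
    |unverifiedFraction alg ℓ (A, (Function.update w e a, x, u))
      - unverifiedFraction alg ℓ (A, (w, x, u))|
      ≤ if A e.1 e.2 = true then influence dv dc ℓ / n else 0 := by
  set G := ofBiadjacency A
  have hmem : ∀ c z, z ∈ G.varsOf c ↔ A c z = true := fun c z => by simp [G, ofBiadjacency]
  split_ifs with he
  · refine (abs_unverifiedFraction_sub_le alg ℓ hA (G.varsOf e.1) fun v' hv' => ?_).trans
      ((card_mul_div_le_influence (j := 1) ?_).trans (by simp))
    · refine Agree.of_eq rfl (fun _ _ => rfl) (fun c hc z _ => ?_) rfl (fun _ _ _ _ => rfl)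
        (fun _ _ => rfl)
      refine Function.update_of_ne (fun h => hv' ?_) _ _
      rw [← h]
      exact (G.mem_iff _ _).1 hc
    · have h1 := hA.2 e.1
      have h2 : dc ≤ dv * dc := Nat.le_mul_of_pos_left dc hdv
      omega
  · refine (abs_unverifiedFraction_sub_le alg ℓ hA ∅ fun v' _ => ?_).trans (by simp)
    refine Agree.of_eq rfl (fun _ _ => rfl) (fun c _ z hz => ?_) rfl (fun _ _ _ _ => rfl)
      (fun _ _ => rfl)
    refine Function.update_of_ne (fun h => he ?_) _ _
    rw [← h]
    exact (hmem _ _).1 hz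

theorem abs_sub_le_of_update_tie (hA : (ofBiadjacency A).DegreesLE dv dc)
    (alg : Algorithm) (ℓ : ℕ) (w : Fin m × Fin n → ℝ)
    (x : Fin n → ℝ) (u : Fin m × Fin n → unitInterval) (e : Fin m × Fin n) (a : unitInterval) :
    |unverifiedFraction alg ℓ (A, (w, x, Function.update u e a))
      - unverifiedFraction alg ℓ (A, (w, x, u))|
      ≤ if A e.1 e.2 = true then influence dv dc ℓ / n else 0 := by
  set G := ofBiadjacency A
  have hmem : ∀ c z, c ∈ G.checksOf z ↔ A c z = true := fun c z => by simp [G, ofBiadjacency]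
  split_ifs with he
  · refine (abs_unverifiedFraction_sub_le alg ℓ hA {e.2} fun v' hv' => ?_).trans
      ((card_mul_div_le_influence (j := 1) (by simp)).trans (by simp))
    refine Agree.of_eq rfl (fun _ _ => rfl) (fun _ _ _ _ => rfl) rfl (fun _ _ _ _ => rfl)
      (fun c _ => ?_)
    refine Function.update_of_ne (fun h => hv' ?_) _ _
    simp [← h]
  · refine (abs_unverifiedFraction_sub_le alg ℓ hA ∅ fun v' _ => ?_).trans (by simp)
    refine Agree.of_eq rfl (fun _ _ => rfl) (fun _ _ _ _ => rfl) rfl (fun _ _ _ _ => rfl)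
      (fun c hc => ?_)
    refine Function.update_of_ne (fun h => he ?_) _ _
    rw [← h]
    exact (hmem _ _).1 hc

theorem sum_edges_le (hA : (ofBiadjacency A).DegreesLE dv dc) (b : ℝ) :
    ∑ e : Fin m × Fin n, (if A e.1 e.2 = true then b else 0) ^ 2 ≤ n * dv * b ^ 2 := by
  have h1 : ∀ v : Fin n, ∑ c : Fin m, (if A c v = true then b else 0) ^ 2 ≤ dv * b ^ 2 := by
    intro v
    have : ∀ c, (if A c v = true then b else 0) ^ 2 = if A c v = true then b ^ 2 else 0 := by
      intro c
      split_ifs <;> simp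
    simp only [this]
    rw [← Finset.sum_filter, Finset.sum_const, nsmul_eq_mul]
    gcongr
    exact hA.1 v
  rw [Fintype.sum_prod_type_right]
  refine (Finset.sum_le_sum fun v _ => h1 v).trans (le_of_eq ?_)
  simp [mul_assoc]

/-- In a given graph, the fraction of unverified nonzero variable nodes has Gaussian exponential
moments. -/
theorem gaussianMoments_input (hA : (ofBiadjacency A).DegreesLE dv dc) (hdv : 0 < dv)
    (alg : Algorithm) (ℓ : ℕ) (f g : Measure ℝ)
    [IsProbabilityMeasure f] [IsProbabilityMeasure g] {α : ℝ} (hα : α ∈ Set.Icc (0 : ℝ) 1) :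
    GaussianMoments (inputLaw (Fin n) (Fin m) f g α) (fun z => unverifiedFraction alg ℓ (A, z))
      ((2 * dv + 1) * n * (influence dv dc ℓ / n) ^ 2) := by
  have := isProbabilityMeasure_signalElementLaw g hα
  have hm : Measurable fun z => unverifiedFraction alg ℓ (A, z) :=
    (measurable_unverifiedFraction alg ℓ).comp measurable_prodMk_left
  have hm' : ∀ w, Measurable fun y => unverifiedFraction alg ℓ (A, (w, y)) :=
    fun w => hm.comp measurable_prodMk_left
  -- With influence κ per variable, weights and tie-breaking numbers contribute `n * dv * κ ^ 2`
  -- each and the signal `n * κ ^ 2`.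
  refine GaussianMoments.mono (GaussianMoments.prod (B := 1) hm
    (fun z => abs_unverifiedFraction_le alg ℓ _)
    (gaussianMoments_infinitePi (B := 1) f (hm.stronglyMeasurable.integral_prod_right').measurable
      (fun w => abs_integral_le_of_bounded fun y => abs_unverifiedFraction_le alg ℓ _)
      (fun e => if A e.1 e.2 = true then influence dv dc ℓ / n else 0)
      fun w e a => abs_integral_sub_integral_le (hm' _) (hm' _)
        (fun y => abs_unverifiedFraction_le alg ℓ _) (fun y => abs_unverifiedFraction_le alg ℓ _)
        fun y => abs_sub_le_of_update_weight hA hdv alg ℓ w y.1 y.2 e a)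
    fun w => GaussianMoments.prod (B := 1) (hm' w)
      (fun z => abs_unverifiedFraction_le alg ℓ _)
      (gaussianMoments_infinitePi (B := 1) _
        ((hm' w).stronglyMeasurable.integral_prod_right').measurable
        (fun x => abs_integral_le_of_bounded fun u => abs_unverifiedFraction_le alg ℓ _)
        (fun _ => influence dv dc ℓ / n)
        fun x v a => abs_integral_sub_integral_le ((hm' w).comp measurable_prodMk_left)
          ((hm' w).comp measurable_prodMk_left)
          (fun u => abs_unverifiedFraction_le alg ℓ _) (fun u => abs_unverifiedFraction_le alg ℓ _)
          fun u => abs_sub_le_of_update_signal hA alg ℓ w x u v a)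
      fun x => gaussianMoments_infinitePi (B := 1) _ ((hm' w).comp measurable_prodMk_left)
        (fun u => abs_unverifiedFraction_le alg ℓ _)
        (fun e => if A e.1 e.2 = true then influence dv dc ℓ / n else 0)
        fun u e a => abs_sub_le_of_update_tie hA alg ℓ w x u e a) ?_
  have h1 := sum_edges_le hA (influence dv dc ℓ / n)
  simp only [Finset.sum_const, Finset.card_univ, Fintype.card_fin, nsmul_eq_mul]
  linarith

end Input

/-! ### Influence of the matching of half-edges -/

namespace Config

variable {m n dv dc : ℕ}

/-- Exchanging two edges of a configuration has little influence on the decoder. -/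
theorem abs_sub_le_of_swap (hdv : 0 < dv) (alg : Algorithm) (ℓ : ℕ) (σ : Config m n dv dc)
    (a b : Fin n × Fin dv)
    (z : (Fin m × Fin n → ℝ) × (Fin n → ℝ) × (Fin m × Fin n → unitInterval)) :
    |unverifiedFraction alg ℓ (graph ((Equiv.swap a b).trans σ), z)
      - unverifiedFraction alg ℓ (σ.graph, z)| ≤ 4 * (influence dv dc ℓ / n) := by
  classical
  set G := ofBiadjacency σ.graph
  -- A node outside `T` keeps its checks, since it is an endpoint of neither edge, and these checks
  -- keep their neighbours, since they are not the two check nodes involved. `T` has at most `2 + 2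
  -- * dc` elements.
  set T : Finset (Fin n) := {a.1, b.1} ∪ (G.varsOf (σ a).1 ∪ G.varsOf (σ b).1) with hT
  have hcard : T.card ≤ 4 * (dv * dc + 1) := by
    have h0 := Finset.card_union_le ({a.1, b.1} : Finset (Fin n))
      (G.varsOf (σ a).1 ∪ G.varsOf (σ b).1)
    have h1 := Finset.card_union_le (G.varsOf (σ a).1) (G.varsOf (σ b).1)
    have h2 : ({a.1, b.1} : Finset (Fin n)).card ≤ 2 := Finset.card_le_two
    have h3 : (G.varsOf (σ a).1).card ≤ dc := σ.degreesLE_graph.2 (σ a).1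
    have h4 : (G.varsOf (σ b).1).card ≤ dc := σ.degreesLE_graph.2 (σ b).1
    have h5 : dc ≤ dv * dc := Nat.le_mul_of_pos_left dc hdv
    rw [hT]
    omega
  refine (abs_unverifiedFraction_sub_le alg ℓ σ.degreesLE_graph T fun v hv => ?_).trans
    ((card_mul_div_le_influence hcard).trans (by norm_num))
  simp only [hT, Finset.mem_union, Finset.mem_insert, Finset.mem_singleton, not_or] at hv
  obtain ⟨⟨hva, hvb⟩, hca, hcb⟩ := hv
  have hoth : ∀ x, x ≠ a → x ≠ b → ((Equiv.swap a b).trans σ) x = σ x := fun x hxa hxb => by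
    rw [Equiv.trans_apply, Equiv.swap_apply_of_ne_of_ne hxa hxb]
  refine Agree.of_eq ?_ (fun c hc => ?_) (fun _ _ _ _ => rfl) rfl (fun _ _ _ _ => rfl)
    (fun _ _ => rfl)
  · ext c
    rw [mem_checksOf_graph, mem_checksOf_graph]
    refine exists_congr fun i => ?_
    rw [hoth _ (fun h => hva (by rw [← h])) (fun h => hvb (by rw [← h]))]
  · have hc1 : (σ a).1 ≠ c := by
      rintro rfl
      exact hca ((G.mem_iff _ _).1 hc)
    have hc2 : (σ b).1 ≠ c := by
      rintro rfl
      exact hcb ((G.mem_iff _ _).1 hc)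
    ext v'
    rw [← Bigraph.mem_iff, ← Bigraph.mem_iff, mem_checksOf_graph, mem_checksOf_graph]
    refine exists_congr fun i => ?_
    by_cases h1 : (v', i) = a
    · rw [h1, Equiv.trans_apply, Equiv.swap_apply_left]
      exact iff_of_false hc2 hc1
    · by_cases h2 : (v', i) = b
      · rw [h2, Equiv.trans_apply, Equiv.swap_apply_right]
        exact iff_of_false hc1 hc2
      · rw [hoth _ h1 h2]

end Config

/-! ### Recentring at the mean and the Chernoff bound -/

section Centering

variable {Ω : Type*} [MeasurableSpace Ω] {μ : Measure Ω} [IsProbabilityMeasure μ]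

theorem exp_integral_le {f : Ω → ℝ} {B : ℝ} (hf : Measurable f) (hB : ∀ ω, |f ω| ≤ B) (t b : ℝ) :
    Real.exp (t * (∫ ω, f ω ∂μ - b)) ≤ ∫ ω, Real.exp (t * (f ω - b)) ∂μ := by
  have hint : Integrable (fun ω => t * (f ω - b)) μ :=
    ((integrable_of_bounded hf hB).sub (integrable_const b)).const_mul t
  have h := convexOn_exp.map_integral_le (μ := μ) (f := fun ω => t * (f ω - b))
    Real.continuous_exp.continuousOn isClosed_univ (Filter.Eventually.of_forall fun _ => trivial)
    hint (integrable_exp_of_bounded hf hB t b)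
  rwa [integral_const_mul, integral_sub (integrable_of_bounded hf hB) (integrable_const b),
    integral_const, probReal_univ, one_smul] at h

/-- Exponential moments around an arbitrary centre give exponential moments around the mean. -/
theorem exp_moment_mean_le {f : Ω → ℝ} {B K V b : ℝ} (hf : Measurable f) (hB : ∀ ω, |f ω| ≤ B)
    (h : ∀ t : ℝ, ∫ ω, Real.exp (t * (f ω - b)) ∂μ ≤ K * Real.exp (t ^ 2 * V / 2)) (t : ℝ) :
    ∫ ω, Real.exp (t * (f ω - ∫ ω', f ω' ∂μ)) ∂μ ≤ K ^ 2 * Real.exp (t ^ 2 * V) := by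
  set M := ∫ ω', f ω' ∂μ
  have h1 : ∫ ω, Real.exp (t * (f ω - M)) ∂μ
      = (∫ ω, Real.exp (t * (f ω - b)) ∂μ) * Real.exp (-t * (M - b)) := by
    rw [← integral_mul_const]
    refine integral_congr_ae (Filter.Eventually.of_forall fun ω => ?_)
    simp only
    rw [← Real.exp_add]
    ring_nf
  -- Jensen's inequality at `-t` bounds the factor caused by moving the centre from `b` to the mean.
  -- The price is a second factor `K` and a doubled exponent.
  have h2 := (exp_integral_le (μ := μ) hf hB (-t) b).trans (h (-t))
  have h3 := h t
  rw [h1]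
  calc _ ≤ (K * Real.exp (t ^ 2 * V / 2)) * (K * Real.exp ((-t) ^ 2 * V / 2)) := by
        refine mul_le_mul h3 h2 (Real.exp_nonneg _) ?_
        exact (integral_nonneg fun _ => Real.exp_nonneg _).trans h3
    _ = K ^ 2 * (Real.exp (t ^ 2 * V / 2) * Real.exp (t ^ 2 * V / 2)) := by ring_nf
    _ = _ := by
        rw [← Real.exp_add]
        ring_nf

theorem real_lt_sub_le {f : Ω → ℝ} {B K V M : ℝ} (hf : Measurable f) (hB : ∀ ω, |f ω| ≤ B)
    (hV : 0 < V) (h : ∀ t : ℝ, ∫ ω, Real.exp (t * (f ω - M)) ∂μ ≤ K * Real.exp (t ^ 2 * V))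
    {s : ℝ} (hs : 0 < s) :
    μ.real {ω | s < f ω - M} ≤ K * Real.exp (-(s ^ 2 / (4 * V))) := by
  -- The minimiser of the Chernoff exponent `t ^ 2 * V - t * s`.
  set t := s / (2 * V) with ht
  have htpos : 0 < t := by positivity
  have hmarkov := mul_meas_ge_le_integral_of_nonneg (μ := μ)
    (f := fun ω => Real.exp (t * (f ω - M)))
    (Filter.Eventually.of_forall fun _ => Real.exp_nonneg _)
    (integrable_exp_of_bounded hf hB t M) (Real.exp (t * s))
  have hsub : μ.real {ω | s < f ω - M}
      ≤ μ.real {ω | Real.exp (t * s) ≤ Real.exp (t * (f ω - M))} := by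
    refine measureReal_mono fun ω hω => ?_
    exact Real.exp_le_exp.2 (mul_le_mul_of_nonneg_left (le_of_lt hω) htpos.le)
  have h1 : Real.exp (t * s) * μ.real {ω | s < f ω - M} ≤ K * Real.exp (t ^ 2 * V) :=
    (mul_le_mul_of_nonneg_left hsub (Real.exp_nonneg _)).trans (hmarkov.trans (h t))
  have h2 : μ.real {ω | s < f ω - M}
      = Real.exp (-(t * s)) * (Real.exp (t * s) * μ.real {ω | s < f ω - M}) := by
    rw [← mul_assoc, ← Real.exp_add]
    simp
  rw [h2]
  refine (mul_le_mul_of_nonneg_left h1 (Real.exp_nonneg _)).trans (le_of_eq ?_)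
  rw [mul_left_comm, ← Real.exp_add]
  congr 2
  rw [ht]
  field_simp
  ring

theorem real_lt_abs_sub_le {f : Ω → ℝ} {B K V M : ℝ} (hf : Measurable f) (hB : ∀ ω, |f ω| ≤ B)
    (hV : 0 < V) (h : ∀ t : ℝ, ∫ ω, Real.exp (t * (f ω - M)) ∂μ ≤ K * Real.exp (t ^ 2 * V))
    {s : ℝ} (hs : 0 < s) :
    μ.real {ω | s < |f ω - M|} ≤ 2 * K * Real.exp (-(s ^ 2 / (4 * V))) := by
  have h1 := real_lt_sub_le hf hB hV h hs
  have h2 := real_lt_sub_le (f := fun ω => -f ω) (M := -M) hf.neg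
    (fun ω => by rw [abs_neg]; exact hB ω) hV (fun t => by
      have := h (-t)
      rw [neg_sq] at this
      refine le_trans (le_of_eq ?_) this
      congr 1
      funext ω
      ring_nf) hs
  have hsub : {ω | s < |f ω - M|} ⊆ {ω | s < f ω - M} ∪ {ω | s < -f ω - -M} := by
    intro ω hω
    rcases lt_abs.1 (show s < |f ω - M| from hω) with h | h
    · exact Or.inl h
    · refine Or.inr ?_
      change s < -f ω - -M
      linarith
  calc _ ≤ _ := measureReal_mono hsub
    _ ≤ _ := measureReal_union_le _ _
    _ ≤ K * Real.exp (-(s ^ 2 / (4 * V))) + K * Real.exp (-(s ^ 2 / (4 * V))) := add_le_add h1 h2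
    _ = _ := by ring

end Centering

/-- The factor in front of an exponential bound for a probability can be absorbed. -/
theorem le_two_mul_exp_of_le {p K y k : ℝ} (hp : p ≤ 1) (hK : 0 < K) (hk : 2 ≤ k)
    (hkK : 2 * Real.log K ≤ k * Real.log 2) (h : p ≤ 2 * K * Real.exp (-y)) :
    p ≤ 2 * Real.exp (-(y / k)) := by
  have hk0 : 0 < k := by linarith
  -- For `y / k ≤ log 2` the claimed bound is at least 1. Otherwise `log K ≤ y / 2` and `y / k ≤ y /
  -- 2`, so half of the exponent pays for `K`.
  rcases le_total (y / k) (Real.log 2) with hy | hy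
  · have : Real.exp (-Real.log 2) ≤ Real.exp (-(y / k)) := Real.exp_le_exp.2 (by linarith)
    rw [Real.exp_neg, Real.exp_log (by norm_num)] at this
    linarith
  · refine h.trans ?_
    rw [mul_assoc]
    gcongr
    rw [← Real.exp_log hK, ← Real.exp_add, Real.exp_le_exp]
    have hlog2 : 0 < Real.log 2 := Real.log_pos (by norm_num)
    have h1 : k * Real.log 2 ≤ y := by
      rw [le_div_iff₀ hk0] at hy
      linarith
    have h2 : 0 ≤ y := le_trans (by positivity) h1
    have h3 : y / k ≤ y / 2 := by gcongr
    linarith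

/-! ## The random graph -/

theorem isProbabilityMeasure_inputLaw (V C : Type) (f g : Measure ℝ) [IsProbabilityMeasure f]
    [IsProbabilityMeasure g] {α : ℝ} (hα : α ∈ Set.Icc (0 : ℝ) 1) :
    IsProbabilityMeasure (inputLaw V C f g α) := by
  have := isProbabilityMeasure_signalElementLaw g hα
  unfold inputLaw
  infer_instance

section Ensemble

variable {m n dv dc : ℕ} {f g : Measure ℝ} {α : ℝ}

theorem isProbabilityMeasure_uniformOn_ensemble (h : (biregularEnsemble m n dv dc).Nonempty) :
    IsProbabilityMeasure (uniformOn (biregularEnsemble m n dv dc)) :=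
  isProbabilityMeasure_uniformOn (Set.toFinite _) h

theorem isProbabilityMeasure_sensingLaw [IsProbabilityMeasure f] [IsProbabilityMeasure g]
    (hα : α ∈ Set.Icc (0 : ℝ) 1) (h : (biregularEnsemble m n dv dc).Nonempty) :
    IsProbabilityMeasure (sensingLaw m n dv dc f g α) := by
  have := isProbabilityMeasure_uniformOn_ensemble h
  have := isProbabilityMeasure_inputLaw (Fin n) (Fin m) f g hα
  unfold sensingLaw
  infer_instance

open Classical in
/-- The expectation over the random biregular graph is an average over simple configurations. -/
theorem integral_sensingLaw [IsProbabilityMeasure f] [IsProbabilityMeasure g]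
    (hα : α ∈ Set.Icc (0 : ℝ) 1) (h : (biregularEnsemble m n dv dc).Nonempty)
    {Φ : (Fin m → Fin n → Bool) ×
      ((Fin m × Fin n → ℝ) × (Fin n → ℝ) × (Fin m × Fin n → unitInterval)) → ℝ} {B : ℝ}
    (hΦ : Measurable Φ) (hB : ∀ T, |Φ T| ≤ B) :
    ∫ T, Φ T ∂(sensingLaw m n dv dc f g α) =
      (∑ σ ∈ Finset.univ.filter (fun σ : Config m n dv dc => σ.IsSimple),
        ∫ z, Φ (σ.graph, z) ∂(inputLaw (Fin n) (Fin m) f g α)) /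
      (Finset.univ.filter fun σ : Config m n dv dc => σ.IsSimple).card := by
  have hprob := isProbabilityMeasure_uniformOn_ensemble h
  have := isProbabilityMeasure_inputLaw (Fin n) (Fin m) f g hα
  set E := (biregularEnsemble m n dv dc).toFinset with hE
  have hreal : ∀ A, (uniformOn (biregularEnsemble m n dv dc)).real {A}
      = if A ∈ E then (E.card : ℝ)⁻¹ else 0 := by
    intro A
    have h1 : uniformOn (biregularEnsemble m n dv dc) {A}
        = ((E ∩ {A}).card : ENNReal) / E.card := by
      rw [← uniformOn_apply_finset, hE, Set.coe_toFinset, Finset.coe_singleton]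
    rw [Measure.real, h1]
    split_ifs with hA
    · rw [Finset.inter_singleton_of_mem hA]
      simp
    · rw [Finset.inter_singleton_of_notMem hA]
      simp
  have hcard : 0 < E.card := Finset.card_pos.2 (Set.toFinset_nonempty.2 h)
  have hones := Config.sum_simple_graph (m := m) (n := n) (dv := dv) (dc := dc) fun _ => 1
  simp only [Finset.sum_const, nsmul_eq_mul, mul_one] at hones
  rw [Config.sum_simple_graph fun A => ∫ z, Φ (A, z) ∂(inputLaw (Fin n) (Fin m) f g α), hones]
  have hR : (0 : ℝ) < (dv.factorial ^ n * dc.factorial ^ m : ℕ) := by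
    exact_mod_cast Nat.mul_pos (pow_pos dv.factorial_pos n) (pow_pos dc.factorial_pos m)
  rw [mul_div_mul_left _ _ hR.ne']
  unfold sensingLaw
  rw [integral_prod _ (integrable_of_bounded hΦ hB), integral_fintype Integrable.of_finite]
  simp only [hreal, smul_eq_mul, ite_mul, zero_mul]
  rw [Finset.sum_ite_mem, Finset.univ_inter, ← Finset.mul_sum, div_eq_inv_mul]

/-- The centre `b` is the mean over all configurations, simple or not. The exponential is
nonnegative, so restricting to simple configurations costs only the factor `simplicityConst`. The
number 66 is 64 from the bijection, whose oscillation per step is `2 * (4 * κ)`, plus 2 from weights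
and tie-breaking numbers. -/
theorem exp_moment_sensingLaw_le (hdv : 0 < dv) (hdc : 0 < dc) [IsProbabilityMeasure f]
    [IsProbabilityMeasure g] (hα : α ∈ Set.Icc (0 : ℝ) 1)
    (h : (biregularEnsemble m n dv dc).Nonempty) (alg : Algorithm) (ℓ : ℕ) :
    ∃ b : ℝ, ∀ t : ℝ,
      ∫ T, Real.exp (t * (unverifiedFraction alg ℓ T - b)) ∂(sensingLaw m n dv dc f g α)
        ≤ Config.simplicityConst dv dc *
          Real.exp (t ^ 2 * ((66 * dv + 1) * n * (influence dv dc ℓ / n) ^ 2) / 2) := by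
  classical
  have := isProbabilityMeasure_inputLaw (Fin n) (Fin m) f g hα
  set P := inputLaw (Fin n) (Fin m) f g α
  set F := unverifiedFraction (m := m) (n := n) alg ℓ
  have hFm : Measurable F := measurable_unverifiedFraction alg ℓ
  have hFm' : ∀ A, Measurable fun z => F (A, z) := fun A => hFm.comp measurable_prodMk_left
  have hFB : ∀ T, |F T| ≤ 1 := abs_unverifiedFraction_le alg ℓ
  set hc : Config m n dv dc → ℝ := fun σ => ∫ z, F (σ.graph, z) ∂P
  set b : ℝ := (∑ ρ, hc ρ) / Fintype.card (Config m n dv dc)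
  refine ⟨b, fun t => ?_⟩
  set κ := influence dv dc ℓ / n
  have hexpB : ∀ T, |Real.exp (t * (F T - b))| ≤ Real.exp (|t| * (1 + |b|)) := by
    intro T
    rw [Real.abs_exp]
    refine Real.exp_le_exp.2 ((le_abs_self _).trans ?_)
    rw [abs_mul]
    gcongr
    exact (abs_sub _ _).trans (by gcongr; exact hFB T)
  rw [integral_sensingLaw hα h (Φ := fun T => Real.exp (t * (F T - b)))
    (by fun_prop) hexpB]
  set S := Finset.univ.filter fun σ : Config m n dv dc => σ.IsSimple
  have hinner : ∀ σ : Config m n dv dc, ∫ z, Real.exp (t * (F (σ.graph, z) - b)) ∂P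
      ≤ Real.exp (t * (hc σ - b)) * Real.exp (t ^ 2 * ((2 * dv + 1) * n * κ ^ 2) / 2) := by
    intro σ
    have hg := gaussianMoments_input (f := f) (g := g) σ.degreesLE_graph hdv alg ℓ hα t
    refine le_trans (le_of_eq ?_) (mul_le_mul_of_nonneg_left hg (Real.exp_nonneg _))
    rw [← integral_const_mul]
    refine integral_congr_ae (Filter.Eventually.of_forall fun z => ?_)
    simp only
    rw [← Real.exp_add]
    congr 1
    simp only [hc, F, P]
    ring
  have houter := sum_exp_equiv_le (f := hc) (c := 4 * κ) (fun σ x y =>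
    abs_integral_sub_integral_le (hFm' _) (hFm' _) (fun z => hFB _) (fun z => hFB _)
      fun z => Config.abs_sub_le_of_swap hdv alg ℓ σ x y z) t
  have hS : (Fintype.card (Config m n dv dc) : ℝ)
      ≤ Config.simplicityConst dv dc * S.card := by
    exact_mod_cast Config.card_le_simplicityConst_mul hdv hdc (Config.exists_isSimple h)
  have hSpos : (0 : ℝ) < S.card := by
    obtain ⟨σ, hσ⟩ := Config.exists_isSimple h
    exact_mod_cast Finset.card_pos.2 ⟨σ, by simpa [S] using hσ⟩
  rw [div_le_iff₀ hSpos]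
  calc ∑ σ ∈ S, ∫ z, Real.exp (t * (F (σ.graph, z) - b)) ∂P
      ≤ ∑ σ ∈ S, Real.exp (t * (hc σ - b))
          * Real.exp (t ^ 2 * ((2 * dv + 1) * n * κ ^ 2) / 2) :=
        Finset.sum_le_sum fun σ _ => hinner σ
    _ ≤ ∑ σ, Real.exp (t * (hc σ - b))
          * Real.exp (t ^ 2 * ((2 * dv + 1) * n * κ ^ 2) / 2) :=
        Finset.sum_le_sum_of_subset_of_nonneg (Finset.subset_univ _)
          fun _ _ _ => by positivity
    _ ≤ (Fintype.card (Config m n dv dc) *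
          Real.exp (t ^ 2 * (Fintype.card (Fin n × Fin dv) * (2 * (4 * κ)) ^ 2) / 2))
          * Real.exp (t ^ 2 * ((2 * dv + 1) * n * κ ^ 2) / 2) := by
        rw [← Finset.sum_mul]
        exact mul_le_mul_of_nonneg_right houter (Real.exp_nonneg _)
    _ = Fintype.card (Config m n dv dc) *
          Real.exp (t ^ 2 * ((66 * dv + 1) * n * κ ^ 2) / 2) := by
        rw [mul_assoc, ← Real.exp_add]
        congr 2
        simp only [Fintype.card_prod, Fintype.card_fin]
        push_cast
        ring
    _ ≤ (Config.simplicityConst dv dc * S.card) *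
          Real.exp (t ^ 2 * ((66 * dv + 1) * n * κ ^ 2) / 2) := by gcongr
    _ = _ := by ring

/-- The exponential moment bound is recentred at the mean, and the factor in front is absorbed by
`k`. The number 16 comes from inserting the deviation `ε / 2` into the Chernoff exponent `s ^ 2 / (4
* V)`. -/
theorem concentration (hdv : 0 < dv) (hdc : 0 < dc) [IsProbabilityMeasure f]
    [IsProbabilityMeasure g] (hα : α ∈ Set.Icc (0 : ℝ) 1)
    (h : (biregularEnsemble m n dv dc).Nonempty) (alg : Algorithm) (ℓ : ℕ) {k : ℝ} (hk : 2 ≤ k)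
    (hkK : 2 * Real.log ((Config.simplicityConst dv dc : ℝ) ^ 2) ≤ k * Real.log 2) {ε : ℝ}
    (hε : 0 < ε) :
    (sensingLaw m n dv dc f g α).real {T | ε / 2 < |unverifiedFraction alg ℓ T -
        ∫ T', unverifiedFraction alg ℓ T' ∂(sensingLaw m n dv dc f g α)|}
      ≤ 2 * Real.exp (-(ε ^ 2 * n / (16 * ((66 * dv + 1) * influence dv dc ℓ ^ 2) * k))) := by
  have := isProbabilityMeasure_sensingLaw (f := f) (g := g) hα h
  have hκ := influence_pos dv dc ℓ
  have hk0 : 0 < k := by linarith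
  rcases n.eq_zero_or_pos with rfl | hn
  · refine measureReal_le_one.trans ?_
    simp
  have hn' : (0 : ℝ) < n := by exact_mod_cast hn
  obtain ⟨b, hb⟩ := exp_moment_sensingLaw_le (f := f) (g := g) hdv hdc hα h alg ℓ
  have hV : 0 < ((66 * dv + 1) * n * (influence dv dc ℓ / n) ^ 2 : ℝ) := by positivity
  have hF := measurable_unverifiedFraction (m := m) (n := n) alg ℓ
  have hFB := abs_unverifiedFraction_le (m := m) (n := n) alg ℓ
  have hdev := real_lt_abs_sub_le hF hFB hV (exp_moment_mean_le hF hFB hb) (half_pos hε)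
  have hK : (0 : ℝ) < (Config.simplicityConst dv dc : ℝ) ^ 2 := by
    have : (0 : ℝ) < Config.simplicityConst dv dc := by
      exact_mod_cast Config.simplicityConst_pos dv dc
    positivity
  refine (le_two_mul_exp_of_le measureReal_le_one hK hk hkK hdev).trans (le_of_eq ?_)
  congr 3
  field_simp
  norm_num

theorem integral_unverifiedFraction_eq (alg : Algorithm) (ℓ : ℕ) [IsProbabilityMeasure f]
    [IsProbabilityMeasure g] (hα : α ∈ Set.Icc (0 : ℝ) 1) (A : Fin m → Fin n → Bool) :
    ∫ z, unverifiedFraction alg ℓ (A, z) ∂(inputLaw (Fin n) (Fin m) f g α) =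
      (∑ v : Fin n, (inputLaw (Fin n) (Fin m) f g α).real
        {ω | IsUnverifiedNonzero (ofBiadjacency A) ω.1 ω.2.1 ω.2.2 alg ℓ v}) / n := by
  classical
  have := isProbabilityMeasure_inputLaw (Fin n) (Fin m) f g hα
  unfold unverifiedFraction
  rw [integral_div]
  congr 1
  have hms := fun v => measurableSet_isUnverifiedNonzero (ofBiadjacency A) alg ℓ v
  have : ∀ z : (Fin m × Fin n → ℝ) × (Fin n → ℝ) × (Fin m × Fin n → unitInterval),
      ((Finset.univ.filter fun v : Fin n =>
        IsUnverifiedNonzero (ofBiadjacency A) z.1 z.2.1 z.2.2 alg ℓ v).card : ℝ)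
      = ∑ v : Fin n, Set.indicator
        {ω : (Fin m × Fin n → ℝ) × (Fin n → ℝ) × (Fin m × Fin n → unitInterval) |
          IsUnverifiedNonzero (ofBiadjacency A) ω.1 ω.2.1 ω.2.2 alg ℓ v} 1 z := by
    intro z
    rw [Finset.card_filter]
    push_cast
    refine Finset.sum_congr rfl fun v _ => ?_
    simp [Set.indicator]
  simp only [this]
  rw [integral_finsetSum _ fun v _ => (integrable_const 1).indicator (hms v)]
  exact Finset.sum_congr rfl fun v _ => integral_indicator_one (hms v)

open Classical in
-- By linearity of expectation this is an average over roots. Roots with injective covering map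
-- contribute no error, and every other root contributes at most 1.
theorem abs_integral_sub_cycleFreeValue_le (alg : Algorithm) (ℓ : ℕ) [IsProbabilityMeasure f]
    [IsProbabilityMeasure g] (hα : α ∈ Set.Icc (0 : ℝ) 1) {σ : Config m n dv dc}
    (hσ : σ.IsSimple) {S : Finset (TreeVar dv dc)} {Q : Finset (TreeCheck dv dc)}
    (hS : rootVars dv dc ℓ ⊆ S) (hQ : rootChecks dv dc ℓ ⊆ Q) (hn : 0 < n) :
    |∫ z, unverifiedFraction alg ℓ (σ.graph, z) ∂(inputLaw (Fin n) (Fin m) f g α)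
        - cycleFreeValue alg dv dc ℓ f g α|
      ≤ (∑ v : Fin n, if σ.InjectiveOn v S Q then (0 : ℝ) else 1) / n := by
  have := isProbabilityMeasure_inputLaw (Fin n) (Fin m) f g hα
  have := isProbabilityMeasure_inputLaw (TreeVar dv dc) (TreeCheck dv dc) f g hα
  have hn' : (0 : ℝ) < n := by exact_mod_cast hn
  rw [integral_unverifiedFraction_eq alg ℓ hα]
  set a := cycleFreeValue alg dv dc ℓ f g α with ha
  have ha0 : 0 ≤ a := measureReal_nonneg
  have ha1 : a ≤ 1 := measureReal_le_one
  have hsub : ∀ p : Fin n → ℝ, (∑ v, p v) / n - a = (∑ v, (p v - a)) / n := by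
    intro p
    rw [Finset.sum_sub_distrib]
    simp
    field_simp
  rw [hsub, abs_div, Nat.abs_cast]
  gcongr
  refine (Finset.abs_sum_le_sum_abs _ _).trans (Finset.sum_le_sum fun v _ => ?_)
  split_ifs with hinj
  · rw [hσ.real_isUnverifiedNonzero_eq hS hQ hinj alg f g hα, ← ha]
    simp
  · have h0 := measureReal_nonneg (μ := inputLaw (Fin n) (Fin m) f g α)
      (s := {ω | IsUnverifiedNonzero (ofBiadjacency σ.graph) ω.1 ω.2.1 ω.2.2 alg ℓ v})
    have h1 := measureReal_le_one (μ := inputLaw (Fin n) (Fin m) f g α)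
      (s := {ω | IsUnverifiedNonzero (ofBiadjacency σ.graph) ω.1 ω.2.1 ω.2.2 alg ℓ v})
    rw [abs_le]
    constructor <;> linarith

/-- The expected fraction of unverified nonzero variable nodes is close to its cycle-free value. -/
theorem abs_mean_sub_cycleFreeValue_le (hdv : 0 < dv) (hdc : 0 < dc) (alg : Algorithm) (ℓ : ℕ)
    [IsProbabilityMeasure f] [IsProbabilityMeasure g] (hα : α ∈ Set.Icc (0 : ℝ) 1)
    (h : (biregularEnsemble m n dv dc).Nonempty)
    {S : Finset (TreeVar dv dc)} {Q : Finset (TreeCheck dv dc)} (hSQ : Config.Explored S Q)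
    (hS : rootVars dv dc ℓ ⊆ S) (hQ : rootChecks dv dc ℓ ⊆ Q) (hn : 2 * (S.card + Q.card) ≤ n) :
    |∫ T, unverifiedFraction alg ℓ T ∂(sensingLaw m n dv dc f g α)
        - cycleFreeValue alg dv dc ℓ f g α|
      ≤ Config.simplicityConst dv dc * (2 * (S.card + Q.card) ^ 2 * (dv + dc)) / n := by
  classical
  set k := S.card + Q.card with hk
  have hkpos : 0 < k := by
    have := Finset.card_pos.2 ⟨_, hSQ.closed.1⟩
    omega
  have hn0 : 0 < n := by omega
  have hn' : (0 : ℝ) < n := by exact_mod_cast hn0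
  set a := cycleFreeValue alg dv dc ℓ f g α
  rw [integral_sensingLaw hα h (measurable_unverifiedFraction alg ℓ)
    (abs_unverifiedFraction_le alg ℓ)]
  set R := Finset.univ.filter fun σ : Config m n dv dc => σ.IsSimple with hR
  set M := Fintype.card (Config m n dv dc)
  have hRpos : (0 : ℝ) < R.card := by
    obtain ⟨σ, hσ⟩ := Config.exists_isSimple h
    exact_mod_cast Finset.card_pos.2 ⟨σ, by simpa [R] using hσ⟩
  have hM : (M : ℝ) ≤ Config.simplicityConst dv dc * R.card := by
    exact_mod_cast Config.card_le_simplicityConst_mul hdv hdc (Config.exists_isSimple h)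
  set q : Config m n dv dc → ℝ := fun σ =>
    ∫ z, unverifiedFraction alg ℓ (σ.graph, z) ∂(inputLaw (Fin n) (Fin m) f g α)
  have hsub : (∑ σ ∈ R, q σ) / R.card - a = (∑ σ ∈ R, (q σ - a)) / R.card := by
    rw [Finset.sum_sub_distrib]
    simp
    field_simp
  have hbad : ∀ v : Fin n,
      ((Finset.univ.filter fun σ : Config m n dv dc => ¬ σ.InjectiveOn v S Q).card : ℝ) * n
        ≤ 2 * k ^ 2 * (dv + dc) * M := by
    intro v
    have h1 := Config.card_not_injectiveOn_le (m := m) (n := n) v hSQ k le_rfl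
    rw [← hk] at h1
    set B := (Finset.univ.filter fun σ : Config m n dv dc => ¬ σ.InjectiveOn v S Q).card
    -- From `2 * k ≤ n` and `1 ≤ dv`, the denominator `n * dv - k` is at least `n / 2`.
    have h2 : n ≤ 2 * (n * dv - k) := by
      have : n ≤ n * dv := Nat.le_mul_of_pos_right n hdv
      omega
    have h3 : B * n ≤ 2 * k ^ 2 * (dv + dc) * M := by
      calc B * n ≤ B * (2 * (n * dv - k)) := Nat.mul_le_mul_left _ h2
        _ = 2 * (B * (n * dv - k)) := by ring
        _ ≤ 2 * (k * (k * (dv + dc) * M)) := Nat.mul_le_mul_left _ h1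
        _ = _ := by ring
    exact_mod_cast h3
  -- The sum is enlarged from simple to all configurations, where collisions were counted; `hM` then
  -- turns the total `M` into a multiple of the number of simple ones.
  have hsum : ∑ σ ∈ R, |q σ - a| ≤ 2 * k ^ 2 * (dv + dc) * M / n := by
    calc ∑ σ ∈ R, |q σ - a|
        ≤ ∑ σ ∈ R, (∑ v : Fin n, if σ.InjectiveOn v S Q then (0 : ℝ) else 1) / n :=
          Finset.sum_le_sum fun σ hσ => abs_integral_sub_cycleFreeValue_le alg ℓ hα
            (Finset.mem_filter.1 hσ).2 hS hQ hn0
      _ ≤ ∑ σ : Config m n dv dc,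
            (∑ v : Fin n, if σ.InjectiveOn v S Q then (0 : ℝ) else 1) / n :=
          Finset.sum_le_sum_of_subset_of_nonneg (Finset.subset_univ _) fun σ _ _ =>
            div_nonneg (Finset.sum_nonneg fun v _ => by split_ifs <;> norm_num) hn'.le
      _ = (∑ v : Fin n, ((Finset.univ.filter fun σ : Config m n dv dc =>
            ¬ σ.InjectiveOn v S Q).card : ℝ)) / n := by
          rw [← Finset.sum_div, Finset.sum_comm]
          congr 1
          refine Finset.sum_congr rfl fun v _ => ?_
          rw [Finset.card_filter]
          push_cast
          refine Finset.sum_congr rfl fun σ _ => ?_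
          split_ifs <;> simp_all
      _ ≤ (∑ v : Fin n, 2 * (k : ℝ) ^ 2 * (dv + dc) * M / n) / n := by
          gcongr with v
          rw [le_div_iff₀ hn']
          exact hbad v
      _ = _ := by
          rw [Finset.sum_const, Finset.card_univ, Fintype.card_fin, nsmul_eq_mul]
          field_simp
  rw [hsub, abs_div, Nat.abs_cast, div_le_iff₀ hRpos]
  refine (Finset.abs_sum_le_sum_abs _ _).trans (hsum.trans ?_)
  calc (2 * (k : ℝ) ^ 2 * (dv + dc) * M / n)
      ≤ 2 * (k : ℝ) ^ 2 * (dv + dc) * (Config.simplicityConst dv dc * R.card) / n := by gcongr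
    _ = _ := by
        push_cast [hk]
        ring

end Ensemble

end VB

/-! ### Choice of the constants -/

theorem theorem2 (alg : VB.Algorithm) (dv dc ℓ : ℕ) (hdv : 0 < dv) (hdc : 0 < dc) :
    ∃ μ γ : ℝ, 0 < μ ∧ 0 < γ ∧
      ∀ (f g : Measure ℝ) (_ : IsProbabilityMeasure f) (_ : IsProbabilityMeasure g)
        (_ : f {0} = 0) (_ : g {0} = 0) (α : ℝ) (_ : α ∈ Set.Icc (0 : ℝ) 1)
        (m n : ℕ) (_ : (VB.biregularEnsemble m n dv dc).Nonempty),
        Integrable (VB.unverifiedFraction alg ℓ) (VB.sensingLaw m n dv dc f g α) ∧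
        (∀ ε : ℝ, 0 < ε →
          (VB.sensingLaw m n dv dc f g α).real
              {T | ε / 2 < |VB.unverifiedFraction alg ℓ T -
                ∫ T', VB.unverifiedFraction alg ℓ T' ∂(VB.sensingLaw m n dv dc f g α)|}
            ≤ 2 * Real.exp (-(ε ^ 2 * n / μ))) ∧
        (∀ ε : ℝ, 0 < ε → 2 * γ / ε < n →
          |(∫ T, VB.unverifiedFraction alg ℓ T ∂(VB.sensingLaw m n dv dc f g α)) -
              VB.cycleFreeValue alg dv dc ℓ f g α| < ε / 2) := by
  obtain ⟨S, Q, hSQ, hS, hQ⟩ := VB.Config.exists_explored_superset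
    (VB.rootVars dv dc ℓ) (VB.rootChecks dv dc ℓ)
  have hlog2 : 0 < Real.log 2 := Real.log_pos (by norm_num)
  set L := Real.log ((VB.Config.simplicityConst dv dc : ℝ) ^ 2)
  -- Chosen to satisfy both requirements of `le_two_mul_exp_of_le` with the squared constant
  -- `simplicityConst ^ 2`.
  set k : ℝ := 2 + 2 * |L| / Real.log 2 with hk
  have hk2 : 2 ≤ k := by
    have : 0 ≤ 2 * |L| / Real.log 2 := by positivity
    linarith
  have hkL : 2 * L ≤ k * Real.log 2 := by
    rw [hk, add_mul, div_mul_cancel₀ _ hlog2.ne']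
    linarith [le_abs_self L]
  have hκ := VB.influence_pos dv dc ℓ
  -- The first summand is the error constant for `n ≥ 2 * (S.card + Q.card)`. The second makes `γ /
  -- n` at least 1 for smaller `n`, where the difference of two numbers in `[0, 1]` is bounded
  -- trivially.
  set γ : ℝ := VB.Config.simplicityConst dv dc * (2 * (S.card + Q.card) ^ 2 * (dv + dc))
    + (2 * (S.card + Q.card) + 1) with hγ
  have hγ0 : 0 < γ := by positivity
  refine ⟨16 * ((66 * dv + 1) * VB.influence dv dc ℓ ^ 2) * k, γ, by positivity, hγ0, ?_⟩
  intro f g hf hg _ _ α hα m n hne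
  have := VB.isProbabilityMeasure_sensingLaw (f := f) (g := g) hα hne
  have hF := VB.measurable_unverifiedFraction (m := m) (n := n) alg ℓ
  have hint : Integrable (VB.unverifiedFraction alg ℓ) (VB.sensingLaw m n dv dc f g α) :=
    VB.integrable_of_bounded hF (VB.abs_unverifiedFraction_le alg ℓ)
  refine ⟨hint, fun ε hε => VB.concentration hdv hdc hα hne alg ℓ hk2 hkL hε, fun ε hε hn => ?_⟩
  have hn0 : (0 : ℝ) < n := lt_trans (by positivity) hn
  have hγn : γ / n < ε / 2 := by
    rw [div_lt_iff₀ hε] at hn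
    rw [div_lt_iff₀ hn0]
    linarith
  refine lt_of_le_of_lt ?_ hγn
  rcases le_total (2 * (S.card + Q.card)) n with hle | hle
  · refine (VB.abs_mean_sub_cycleFreeValue_le hdv hdc alg ℓ hα hne hSQ hS hQ hle).trans ?_
    refine div_le_div_of_nonneg_right ?_ hn0.le
    rw [hγ]
    have : (0 : ℝ) ≤ 2 * (S.card + Q.card) + 1 := by positivity
    linarith
  · have h1 : |(∫ T, VB.unverifiedFraction alg ℓ T ∂(VB.sensingLaw m n dv dc f g α)) -
        VB.cycleFreeValue alg dv dc ℓ f g α| ≤ 1 := by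
      have := VB.isProbabilityMeasure_inputLaw (VB.TreeVar dv dc) (VB.TreeCheck dv dc) f g hα
      have ha0 : 0 ≤ VB.cycleFreeValue alg dv dc ℓ f g α := measureReal_nonneg
      have ha1 : VB.cycleFreeValue alg dv dc ℓ f g α ≤ 1 := measureReal_le_one
      have hm0 : 0 ≤ ∫ T, VB.unverifiedFraction alg ℓ T ∂(VB.sensingLaw m n dv dc f g α) :=
        integral_nonneg fun T => (VB.unverifiedFraction_mem_Icc alg ℓ T).1
      have hm1 := (abs_le.1 (VB.abs_integral_le_of_bounded
        (μ := VB.sensingLaw m n dv dc f g α) (VB.abs_unverifiedFraction_le alg ℓ))).2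
      rw [abs_le]
      constructor <;> linarith
    refine h1.trans ?_
    rw [le_div_iff₀ hn0, one_mul, hγ]
    have h2 : (n : ℝ) ≤ 2 * (S.card + Q.card) := by exact_mod_cast hle
    have h3 : (0 : ℝ) ≤ VB.Config.simplicityConst dv dc
        * (2 * (S.card + Q.card) ^ 2 * (dv + dc)) := by positivity
    linarith
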